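/- Fix $m>0$, $\lambda>0$, $\alpha\in\mathbb R$, an integer $\ell\ge 1$, and put $\mu=\frac{2}{m+1}$, $\nu=1-\frac{\mu^2}{4}$. Let $m^*>0$ be the unique positive root of $\Lambda(m)=1$, where $$\Lambda(m)=\tfrac{2}{\pi}(m+1)^2\Big(\tfrac{1}{\sqrt{m(m+2)}}-\arcsin\tfrac{1}{m+1}\Big).$$ Let $H^s_\ell(\mathbb R^3)$ be the sector of angular symmetry $\ell$ of $H^s(\mathbb R^3)$, i.e. the $\xi\in H^s(\mathbb R^3)$ whose Fourier transform is a finite sum of functions $g(|p|)\,Y(p/|p|)$ with $Y$ a spherical harmonic of degree $\ell$. Define, in Fourier transform, $$\widehat{T_\lambda\xi}(p)=2\pi^2\sqrt{\nu p^2+\lambda}\;\widehat\xi(p)+\int_{\mathbb R^3}\frac{\widehat\xi(q)}{p^2+q^2+\mu\,p\cdot q+\lambda}\,dq,$$ $$\widehat{W_\lambda\xi}(p)=\frac{2\pi^2}{\sqrt{\nu p^2+\lambda}}\;\widehat\xi(p)-2\int_{\mathbb R^3}\frac{\widehat\xi(q)}{(p^2+q^2+\mu\,p\cdot q+\lambda)^2}\,dq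 .$$ $W_\lambda$ is a bijection of $H^{-1/2}_\ell(\mathbb R^3)$ onto $H^{1/2}_\ell(\mathbb R^3)$, and $H^{-1/2}_{W_\lambda,\ell}(\mathbb R^3)$ denotes $H^{-1/2}_\ell(\mathbb R^3)$ with the scalar product $\langle\xi,\eta\rangle_{W_\lambda}=\langle\xi,W_\lambda\eta\rangle_{H^{-1/2},H^{1/2}}=\int\overline{\widehat\xi}\,\widehat{W_\lambda\eta}\,dp$, which makes it a Hilbert space. On it consider $$\mathcal A^{(\ell)}_{\lambda,\alpha}=2W_\lambda^{-1}(T_\lambda+\alpha),\qquad \mathcal D(\mathcal A^{(\ell)}_{\lambda,\alpha})=H^{3/2}_\ell(\mathbb R^3),$$ a densely defined symmetric operator. **Proposition.** Let $m>m^*$ and $\alpha\in\mathbb R$. There is $\lambda_0\ge 0$, depending only on $m$ and $\alpha$ and equal to $0$ if $\alpha\ge0$, such that for all $\lambda>\lambda_0$ and all $\ell\ge1$ the bottom of $\mathcal A^{(\ell)}_{\lambda,\alpha}$ is strictly positive. Whenever $\ell\ge 1$ and $\lambda>0$ are such that the bottom of $\mathcal A^{(\ell)}_{\lambda,\alpha}$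 is strictly positive, the Friedrichs extension $\mathcal A^{(\ell),F}_{\lambda,\alpha}$ of $\mathcal A^{(\ell)}_{\lambda,\alpha}$ in $H^{-1/2}_{W_\lambda,\ell}(\mathbb R^3)$ is the self-adjoint operator $$\mathcal D(\mathcal A^{(\ell),F}_{\lambda,\alpha})=\{\xi\in H^{1/2}_\ell(\mathbb R^3)\,:\,(T_\lambda+\alpha)\xi\in H^{1/2}_\ell(\mathbb R^3)\},\qquad \mathcal A^{(\ell),F}_{\lambda,\alpha}\,\xi=2W_\lambda^{-1}(T_\lambda+\alpha)\xi .$$ In particular $\mathcal D(\mathcal A^{(\ell),F}_{\lambda,\alpha})\supset H^{3/2}_\ell(\mathbb R^3)$. Its quadratic form is $$\mathcal D[\mathcal A^{(\ell),F}_{\lambda,\alpha}]=H^{1/2}_\ell(\mathbb R^3),\qquad \mathcal A^{(\ell),F}_{\lambda,\alpha}[\xi_1,\xi_2]=2\,\langle\xi_1,(T_\lambda+\alpha)\xi_2\rangle_{H^{1/2},H^{-1/2}},$$ where $(T_\lambda+\alpha)\xi_2\in H^{-1/2}_\ell(\mathbb R^3)$ for $\xi_2\in H^{1/2}_\ell(\mathbb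 R^3)$ and the pairing $\langle\xi,\tau\rangle=\int\overline{\widehat\xi}\,\widehat\tau\,dp$ is absolutely convergent. -/

import Mathlib

open MeasureTheory Filter Topology
open scoped SchwartzMap FourierTransform ComplexConjugate

namespace TMS
noncomputable section

/-- `ℝ³`, used both for positions and for momenta. -/
abbrev R3 : Type := EuclideanSpace ℝ (Fin 3)

/-- `f` is the Fourier transform `ξ̂(p) = (2π)^{-3/2} ∫ e^{-i p·x} ξ(x) dx` of the tempered
distribution `ξ`. Mathlib's `𝓕 ξ` is taken at `k = p / 2π`, that is, formally
`(𝓕 ξ)(k) = (2π)^{3/2} ξ̂(2πk)`; the condition below is this identity tested on `φ(k)`. -/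
structure HasMomentum (ξ : 𝓢'(R3, ℂ)) (f : R3 → ℂ) : Prop where
  locallyIntegrable : LocallyIntegrable f volume
  integrable : ∀ φ : 𝓢(R3, ℂ), Integrable (fun p => φ ((2 * Real.pi)⁻¹ • p) * f p) volume
  fourier_apply : ∀ φ : 𝓢(R3, ℂ),
    𝓕 ξ φ = ((2 * Real.pi) ^ (-(3 / 2) : ℝ) : ℝ) * ∫ p : R3, φ ((2 * Real.pi)⁻¹ • p) * f p

theorem HasMomentum.zero : HasMomentum 0 0 := by
  refine ⟨locallyIntegrable_zero, by simp, ?_⟩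
  intro φ
  simp

theorem HasMomentum.add {ξ η : 𝓢'(R3, ℂ)} {f g : R3 → ℂ} (hf : HasMomentum ξ f)
    (hg : HasMomentum η g) : HasMomentum (ξ + η) (f + g) := by
  refine ⟨hf.1.add hg.1, fun φ => ?_, fun φ => ?_⟩
  · refine ((hf.2 φ).add (hg.2 φ)).congr (.of_forall fun p => ?_)
    simp [mul_add]
  · have h1 := hf.3 φ
    have h2 := hg.3 φ
    rw [TemperedDistribution.fourier_apply] at *
    change ξ (𝓕 φ) + η (𝓕 φ) = _
    rw [h1, h2, ← mul_add, ← integral_add (hf.2 φ) (hg.2 φ)]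
    simp [mul_add]

theorem HasMomentum.smul {ξ : 𝓢'(R3, ℂ)} {f : R3 → ℂ} (c : ℂ) (hf : HasMomentum ξ f) :
    HasMomentum (c • ξ) (c • f) := by
  refine ⟨hf.1.smul c, fun φ => ?_, fun φ => ?_⟩
  · simpa [mul_left_comm] using (hf.2 φ).const_mul c
  · have h1 := hf.3 φ
    rw [TemperedDistribution.fourier_apply] at *
    change c * ξ (𝓕 φ) = _
    rw [h1, mul_left_comm, ← integral_const_mul]
    simp [mul_left_comm]

theorem HasMomentum.ae_eq {ξ : 𝓢'(R3, ℂ)} {f g : R3 → ℂ} (hf : HasMomentum ξ f)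
    (hg : HasMomentum ξ g) : f =ᵐ[volume] g := by
  have hc : (2 * Real.pi) ≠ 0 := by positivity
  refine ae_eq_of_integral_contDiff_smul_eq hf.1 hg.1 fun G hG hGc => ?_
  have hg₁ : HasCompactSupport (fun k : R3 => (G ((2 * Real.pi) • k) : ℂ)) := by
    have : HasCompactSupport (fun k : R3 => G ((2 * Real.pi) • k)) := hGc.comp_smul hc
    exact this.comp_left (g := Complex.ofReal) rfl
  have hg₂ : ContDiff ℝ (⊤ : ℕ∞) (fun k : R3 => (G ((2 * Real.pi) • k) : ℂ)) :=
    Complex.ofRealCLM.contDiff.comp (hG.comp (contDiff_const_smul _))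
  have h1 := hf.3 (hg₁.toSchwartzMap hg₂)
  rw [hg.3 (hg₁.toSchwartzMap hg₂)] at h1
  have h2 : (((2 * Real.pi) ^ (-(3 / 2) : ℝ) : ℝ) : ℂ) ≠ 0 := by
    exact_mod_cast (Real.rpow_pos_of_pos (by positivity) _).ne'
  have h3 := mul_left_cancel₀ h2 h1
  have h4 : ∀ p : R3, (hg₁.toSchwartzMap hg₂) ((2 * Real.pi)⁻¹ • p) = (G p : ℂ) := fun p => by
    change (G ((2 * Real.pi) • (2 * Real.pi)⁻¹ • p) : ℂ) = _
    rw [smul_inv_smul₀ hc]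
  simp only [h4] at h3
  simpa only [Complex.real_smul] using h3.symm

theorem HasMomentum.congr {ξ : 𝓢'(R3, ℂ)} {f g : R3 → ℂ} (hf : HasMomentum ξ f)
    (h : f =ᵐ[volume] g) : HasMomentum ξ g := by
  have h' : ∀ φ : 𝓢(R3, ℂ), (fun p => φ ((2 * Real.pi)⁻¹ • p) * f p) =ᵐ[volume]
      fun p => φ ((2 * Real.pi)⁻¹ • p) * g p := fun φ => by
    filter_upwards [h] with p hp
    rw [hp]
  refine ⟨?_, fun φ => (hf.2 φ).congr (h' φ), fun φ => ?_⟩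
  · intro x
    obtain ⟨s, hs, h2⟩ := hf.1 x
    exact ⟨s, hs, h2.congr (ae_restrict_of_ae h)⟩
  · rw [hf.3 φ, integral_congr_ae (h' φ)]

theorem HasMomentum.eq_of_ae_eq {ξ η : 𝓢'(R3, ℂ)} {f g : R3 → ℂ} (hf : HasMomentum ξ f)
    (hg : HasMomentum η g) (h : f =ᵐ[volume] g) : ξ = η := by
  have h1 : 𝓕 ξ = 𝓕 η := by
    ext φ
    rw [hf.3 φ, (hg.congr h.symm).3 φ]
  have := congrArg (fun u => 𝓕⁻ u) h1
  simpa using this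

theorem HasMomentum.integrable_weight {ξ : 𝓢'(R3, ℂ)} {f : R3 → ℂ} (hf : HasMomentum ξ f)
    {s : ℝ} (h : TemperedDistribution.MemSobolev s 2 ξ) :
    Integrable (fun p : R3 => (1 + ‖(2 * Real.pi)⁻¹ • p‖ ^ 2) ^ s * ‖f p‖ ^ 2) volume := by
  obtain ⟨F, hF⟩ := TemperedDistribution.memSobolev_iff_exists_smulLeftCLM_fourier.1 h
  have hc : (2 * Real.pi) ≠ 0 := by positivity
  have hc' : (2 * Real.pi)⁻¹ ≠ 0 := inv_ne_zero hc
  have hFsm : StronglyMeasurable (fun p : R3 => F ((2 * Real.pi)⁻¹ • p)) :=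
    (Lp.stronglyMeasurable F).comp_measurable (measurable_const_smul _)
  have hF2 : Integrable (fun p : R3 => ‖F ((2 * Real.pi)⁻¹ • p)‖ ^ 2) volume :=
    ((memLp_two_iff_integrable_sq_norm (Lp.aestronglyMeasurable F)).1 (Lp.memLp F)).comp_smul hc'
  have hFm : MemLp (fun p : R3 => F ((2 * Real.pi)⁻¹ • p)) 2 volume :=
    (memLp_two_iff_integrable_sq_norm hFsm.aestronglyMeasurable).2 hF2
  set w : R3 → ℝ := fun p => (1 + ‖(2 * Real.pi)⁻¹ • p‖ ^ 2) ^ (s / 2) with hw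
  have hwc : Continuous w := by
    refine Continuous.rpow_const (by fun_prop) fun p => Or.inl ?_
    positivity
  set c : ℝ := (2 * Real.pi) ^ (-(3 / 2) : ℝ) with hcdef
  have hcpos : 0 < c := Real.rpow_pos_of_pos (by positivity) _
  set d : ℝ := |((2 * Real.pi)⁻¹ ^ Module.finrank ℝ R3)⁻¹| with hd
  have hdpos : 0 < d := by positivity
  have hfl : LocallyIntegrable (fun p => ((d * c * w p : ℝ) : ℂ) * f p) volume := by
    have h0 : Continuous fun p => ((d * c * w p : ℝ) : ℂ) :=
      Complex.continuous_ofReal.comp (continuous_const.mul hwc)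
    simpa only [smul_eq_mul] using hf.1.continuous_smul h0
  have key : (fun p => ((d * c * w p : ℝ) : ℂ) * f p) =ᵐ[volume]
      fun p : R3 => F ((2 * Real.pi)⁻¹ • p) := by
    refine ae_eq_of_integral_contDiff_smul_eq hfl (hFm.locallyIntegrable (by norm_num))
      fun G hG hGc => ?_
    have hg₁ : HasCompactSupport (fun k : R3 => (G ((2 * Real.pi) • k) : ℂ)) := by
      have : HasCompactSupport (fun k : R3 => G ((2 * Real.pi) • k)) := hGc.comp_smul hc
      exact this.comp_left (g := Complex.ofReal) rfl
    have hg₂ : ContDiff ℝ (⊤ : ℕ∞) (fun k : R3 => (G ((2 * Real.pi) • k) : ℂ)) :=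
      Complex.ofRealCLM.contDiff.comp (hG.comp (contDiff_const_smul _))
    set φ := hg₁.toSchwartzMap hg₂ with hφ
    have h4 : ∀ p : R3, φ ((2 * Real.pi)⁻¹ • p) = (G p : ℂ) := fun p => by
      change (G ((2 * Real.pi) • (2 * Real.pi)⁻¹ • p) : ℂ) = _
      rw [smul_inv_smul₀ hc]
    have h1 := DFunLike.congr_fun hF φ
    rw [TemperedDistribution.smulLeftCLM_apply_apply, hf.3, Lp.toTemperedDistribution_apply] at h1
    have h5 := Measure.integral_comp_smul (volume : Measure R3) (fun k => φ k • F k)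
      (2 * Real.pi)⁻¹
    rw [← h1, ← hd] at h5
    have h6 : ∀ p : R3, (SchwartzMap.smulLeftCLM ℂ
        (fun x : R3 => (((1 + ‖x‖ ^ 2) ^ (s / 2) : ℝ) : ℂ)) φ) ((2 * Real.pi)⁻¹ • p)
          = (w p : ℂ) * (G p : ℂ) := fun p => by
      rw [SchwartzMap.smulLeftCLM_apply_apply (by fun_prop), h4, smul_eq_mul]
    simp only [h4, h6] at h5
    calc ∫ x, G x • (((d * c * w x : ℝ) : ℂ) * f x)
        = (d : ℂ) * ((c : ℂ) * ∫ x, (w x : ℂ) * (G x : ℂ) * f x) := by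
          rw [← integral_const_mul, ← integral_const_mul]
          refine integral_congr_ae (.of_forall fun x => ?_)
          simp only [Complex.real_smul]
          push_cast
          ring
      _ = ∫ x : R3, G x • F ((2 * Real.pi)⁻¹ • x) := by
          simp only [Complex.real_smul, smul_eq_mul] at h5 ⊢
          exact h5.symm
  have h7 : Integrable (fun p : R3 => ((d * c) ^ 2)⁻¹ * ‖F ((2 * Real.pi)⁻¹ • p)‖ ^ 2) volume :=
    hF2.const_mul _
  refine h7.congr ?_
  filter_upwards [key] with p hp
  have hwp : w p ^ 2 = (1 + ‖(2 * Real.pi)⁻¹ • p‖ ^ 2) ^ s := by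
    rw [hw, ← Real.rpow_natCast, ← Real.rpow_mul (by positivity)]
    norm_num
  rw [← hp, norm_mul, mul_pow ‖((d * c * w p : ℝ) : ℂ)‖, Complex.norm_real, Real.norm_eq_abs,
    sq_abs, mul_pow (d * c), ← hwp, ← mul_assoc, ← mul_assoc, inv_mul_cancel₀ (by positivity),
    one_mul]

/-- The mass ratio `m > 0` and the shift `λ > 0`. -/
structure Params where
  mass : ℝ
  lam : ℝ
  mass_pos : 0 < mass
  lam_pos : 0 < lam

namespace Params
variable (P : Params)

/-- `μ = 2 / (m + 1)`. -/
def mu : ℝ := 2 / (P.mass + 1)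
/-- `ν = 1 - μ² / 4`. -/
def nu : ℝ := 1 - P.mu ^ 2 / 4
/-- `p² + q² + μ p·q + λ`. -/
def den (p q : R3) : ℝ := ‖p‖ ^ 2 + ‖q‖ ^ 2 + P.mu * inner ℝ p q + P.lam

theorem mu_pos : 0 < P.mu := by
  have := P.mass_pos
  unfold mu; positivity

theorem mu_lt_two : P.mu < 2 := by
  have := P.mass_pos
  unfold mu
  rw [div_lt_iff₀ (by linarith)]; linarith

theorem nu_pos : 0 < P.nu := by
  have := P.mu_pos
  have := P.mu_lt_two
  unfold nu
  nlinarith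

theorem den_eq (p q : R3) :
    P.den p q = ‖q + (P.mu / 2) • p‖ ^ 2 + (P.nu * ‖p‖ ^ 2 + P.lam) := by
  rw [norm_add_sq_real, norm_smul, inner_smul_right, real_inner_comm, mul_pow, Real.norm_eq_abs,
    sq_abs]
  unfold den nu
  ring

theorem den_comm (p q : R3) : P.den p q = P.den q p := by
  unfold den
  rw [real_inner_comm]
  ring

theorem rad_pos (p : R3) : 0 < P.nu * ‖p‖ ^ 2 + P.lam := by
  have := P.nu_pos
  have := P.lam_pos
  positivity

theorem den_pos (p q : R3) : 0 < P.den p q := by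
  rw [den_eq]
  have := P.rad_pos p
  positivity

theorem continuous_den : Continuous fun z : R3 × R3 => P.den z.1 z.2 := by
  unfold den
  fun_prop

end Params

theorem radial_aux {a : ℝ} (ha : 0 < a) :
    IntegrableOn (fun r : ℝ => r ^ 2 * ((r ^ 2 + a) ^ 2)⁻¹) (Set.Ioi 0) ∧
    ∫ r in Set.Ioi (0 : ℝ), r ^ 2 * ((r ^ 2 + a) ^ 2)⁻¹ = Real.pi / (4 * √a) := by
  have hs : 0 < √a := Real.sqrt_pos.2 ha
  have hsa : √a ^ 2 = a := Real.sq_sqrt ha.le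
  set g : ℝ → ℝ := fun r => (Real.arctan (r / √a) / √a - r / (r ^ 2 + a)) / 2 with hg
  have hderiv : ∀ x : ℝ, HasDerivAt g (x ^ 2 * ((x ^ 2 + a) ^ 2)⁻¹) x := by
    intro x
    have hx : x ^ 2 + a ≠ 0 := by positivity
    have hx' : a + x ^ 2 ≠ 0 := by positivity
    have h1 : HasDerivAt (fun r : ℝ => r / √a) (1 / √a) x := (hasDerivAt_id x).div_const _
    have h2 := (h1.arctan.div_const (√a))
    have h3 : HasDerivAt (fun r : ℝ => r ^ 2 + a) (2 * x) x := by
      simpa using (hasDerivAt_pow 2 x).add_const a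
    have h4 := ((h2.sub ((hasDerivAt_id x).div h3 hx)).div_const 2)
    refine h4.congr_deriv ?_
    rw [div_pow, hsa]
    have : (1 + x ^ 2 / a) = (x ^ 2 + a) / a := by field_simp; ring
    rw [this]
    simp only [id]
    field_simp
    rw [hsa]
    ring
  have hlim : Tendsto g atTop (𝓝 ((Real.pi / 2 / √a - 0) / 2)) := by
    refine ((Tendsto.div_const ?_ _).sub ?_).div_const _
    · exact (Real.tendsto_arctan_atTop.mono_right nhdsWithin_le_nhds).comp
        (tendsto_id.atTop_div_const hs)
    · have h5 : Tendsto (fun r : ℝ => r⁻¹) atTop (𝓝 0) := tendsto_inv_atTop_zero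
      refine squeeze_zero' ?_ ?_ h5
      · filter_upwards [eventually_gt_atTop 0] with r hr
        positivity
      · filter_upwards [eventually_gt_atTop 0] with r hr
        rw [div_le_iff₀ (by positivity)]
        have : r⁻¹ * (r ^ 2 + a) = r + r⁻¹ * a := by field_simp
        rw [this]
        have : 0 < r⁻¹ * a := by positivity
        linarith
  have hc : ContinuousWithinAt g (Set.Ici 0) 0 := (hderiv 0).continuousAt.continuousWithinAt
  refine ⟨integrableOn_Ioi_deriv_of_nonneg hc (fun x _ => hderiv x)
    (fun x _ => by positivity) hlim, ?_⟩
  rw [integral_Ioi_of_hasDerivAt_of_nonneg hc (fun x _ => hderiv x)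
    (fun x _ => by positivity) hlim]
  simp only [hg]
  simp
  field_simp
  norm_num

theorem volume_ball_R3 : (volume : Measure R3).real (Metric.ball 0 1) = 4 * Real.pi / 3 := by
  rw [Measure.real, EuclideanSpace.volume_ball_fin_three]
  simp
  rw [ENNReal.toReal_ofReal (by positivity)]
  ring

theorem integral_inv_sq {a : ℝ} (ha : 0 < a) :
    Integrable (fun x : R3 => ((‖x‖ ^ 2 + a) ^ 2)⁻¹) volume ∧
    ∫ x : R3, ((‖x‖ ^ 2 + a) ^ 2)⁻¹ = Real.pi ^ 2 / √a := by
  obtain ⟨h1, h2⟩ := radial_aux ha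
  constructor
  · rw [integrable_fun_norm_addHaar volume (f := fun r : ℝ => ((r ^ 2 + a) ^ 2)⁻¹)]
    simpa using h1
  · rw [integral_fun_norm_addHaar volume (fun r : ℝ => ((r ^ 2 + a) ^ 2)⁻¹), volume_ball_R3]
    simp only [finrank_euclideanSpace, Fintype.card_fin, smul_eq_mul, nsmul_eq_mul]
    norm_num
    rw [h2]
    field_simp

theorem Params.integral_den (P : Params) (p : R3) :
    Integrable (fun q : R3 => (P.den p q ^ 2)⁻¹) volume ∧
    ∫ q : R3, (P.den p q ^ 2)⁻¹ = Real.pi ^ 2 / √(P.nu * ‖p‖ ^ 2 + P.lam) := by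
  obtain ⟨h1, h2⟩ := integral_inv_sq (P.rad_pos p)
  simp only [P.den_eq]
  exact ⟨h1.comp_add_right ((P.mu / 2) • p), by
    rw [integral_add_right_eq_self
      (fun x : R3 => ((‖x‖ ^ 2 + (P.nu * ‖p‖ ^ 2 + P.lam)) ^ 2)⁻¹) ((P.mu / 2) • p), h2]⟩


/-- The function `(W_λ ξ)^` in terms of `f = ξ̂`. -/
def Params.wFun (P : Params) (f : R3 → ℂ) (p : R3) : ℂ :=
  (2 * Real.pi ^ 2 / √(P.nu * ‖p‖ ^ 2 + P.lam) : ℝ) * f p - 2 * ∫ q, f q / (P.den p q : ℂ) ^ 2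

/-- `f` is the Fourier transform of an element of `H^{-1/2}`: a weighted `L²` condition. -/
structure Params.WInt (P : Params) (f : R3 → ℂ) : Prop where
  aesm : AEStronglyMeasurable f volume
  int : Integrable (fun p : R3 => ‖f p‖ ^ 2 / √(P.nu * ‖p‖ ^ 2 + P.lam)) volume

theorem integral_four {X : Type*} [MeasurableSpace X] {μ : Measure X} {a b c d : X → ℂ}
    (ha : Integrable a μ) (hb : Integrable b μ) (hc : Integrable c μ) (hd : Integrable d μ) :
    ∫ x, (a x - b x - c x + d x) ∂μ
      = ∫ x, a x ∂μ - ∫ x, b x ∂μ - ∫ x, c x ∂μ + ∫ x, d x ∂μ := by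
  have h1 : Integrable (fun x => a x - b x) μ := ha.sub hb
  have h2 : Integrable (fun x => a x - b x - c x) μ := h1.sub hc
  rw [integral_add h2 hd, integral_sub h1 hc, integral_sub ha hb]

namespace Params.WInt
variable {P : Params} {f g : R3 → ℂ}

theorem memLp_fst (hf : P.WInt f) :
    MemLp (fun z : R3 × R3 => f z.1 / (P.den z.1 z.2 : ℂ)) 2 (volume.prod volume) := by
  have hm : AEStronglyMeasurable (fun z : R3 × R3 => f z.1 / (P.den z.1 z.2 : ℂ))
      (volume.prod volume) := by
    have h1 : AEStronglyMeasurable (fun z : R3 × R3 => f z.1) (volume.prod volume) :=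
      hf.aesm.comp_fst
    have h2 : Continuous fun z : R3 × R3 => ((P.den z.1 z.2 : ℂ))⁻¹ :=
      (Complex.continuous_ofReal.comp P.continuous_den).inv₀ fun z =>
        Complex.ofReal_ne_zero.2 (P.den_pos z.1 z.2).ne'
    refine (h1.mul h2.aestronglyMeasurable).congr (.of_forall fun z => ?_)
    simp [div_eq_mul_inv]
  rw [memLp_two_iff_integrable_sq_norm hm]
  have hn : ∀ z : R3 × R3, ‖f z.1 / (P.den z.1 z.2 : ℂ)‖ ^ 2
      = ‖f z.1‖ ^ 2 * (P.den z.1 z.2 ^ 2)⁻¹ := fun z => by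
    rw [norm_div, div_pow, Complex.norm_real, Real.norm_eq_abs, sq_abs, div_eq_mul_inv]
  simp only [hn]
  refine (integrable_prod_iff ?_).2 ⟨?_, ?_⟩
  · exact (hm.norm.pow 2).congr (.of_forall hn)
  · exact .of_forall fun p => (P.integral_den p).1.const_mul (‖f p‖ ^ 2)
  · have h3 : ∀ p : R3, ∫ q : R3, ‖‖f p‖ ^ 2 * (P.den p q ^ 2)⁻¹‖
        = Real.pi ^ 2 * (‖f p‖ ^ 2 / √(P.nu * ‖p‖ ^ 2 + P.lam)) := fun p => by
      have : ∀ q : R3, ‖‖f p‖ ^ 2 * (P.den p q ^ 2)⁻¹‖ = ‖f p‖ ^ 2 * (P.den p q ^ 2)⁻¹ :=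
        fun q => Real.norm_of_nonneg (by positivity)
      simp only [this]
      rw [integral_const_mul, (P.integral_den p).2]
      ring
    simp only [h3]
    exact hf.int.const_mul _

theorem memLp_snd (hf : P.WInt f) :
    MemLp (fun z : R3 × R3 => f z.2 / (P.den z.1 z.2 : ℂ)) 2 (volume.prod volume) := by
  have h := hf.memLp_fst.comp_measurePreserving (Measure.measurePreserving_swap)
  refine h.ae_eq (.of_forall fun z => ?_)
  change f z.2 / (P.den z.2 z.1 : ℂ) = _
  rw [P.den_comm]

theorem integrable_mul (hf : P.WInt f) (hg : P.WInt g) :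
    Integrable (fun p => conj (f p) * P.wFun g p) volume ∧
    ∫ p, conj (f p) * P.wFun g p =
      ∫ z : R3 × R3, conj ((f z.1 - f z.2) / (P.den z.1 z.2 : ℂ)) *
        ((g z.1 - g z.2) / (P.den z.1 z.2 : ℂ)) ∂(volume.prod volume) := by
  have hAA : Integrable (fun z : R3 × R3 => conj (f z.1 / (P.den z.1 z.2 : ℂ)) *
      (g z.1 / (P.den z.1 z.2 : ℂ))) (volume.prod volume) :=
    hf.memLp_fst.star.integrable_mul hg.memLp_fst
  have hAB : Integrable (fun z : R3 × R3 => conj (f z.1 / (P.den z.1 z.2 : ℂ)) *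
      (g z.2 / (P.den z.1 z.2 : ℂ))) (volume.prod volume) :=
    hf.memLp_fst.star.integrable_mul hg.memLp_snd
  have hBA : Integrable (fun z : R3 × R3 => conj (f z.2 / (P.den z.1 z.2 : ℂ)) *
      (g z.1 / (P.den z.1 z.2 : ℂ))) (volume.prod volume) :=
    hf.memLp_snd.star.integrable_mul hg.memLp_fst
  have hBB : Integrable (fun z : R3 × R3 => conj (f z.2 / (P.den z.1 z.2 : ℂ)) *
      (g z.2 / (P.den z.1 z.2 : ℂ))) (volume.prod volume) :=
    hf.memLp_snd.star.integrable_mul hg.memLp_snd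
  have sBB : ∫ z : R3 × R3, conj (f z.2 / (P.den z.1 z.2 : ℂ)) *
      (g z.2 / (P.den z.1 z.2 : ℂ)) ∂(volume.prod volume) =
      ∫ z : R3 × R3, conj (f z.1 / (P.den z.1 z.2 : ℂ)) *
      (g z.1 / (P.den z.1 z.2 : ℂ)) ∂(volume.prod volume) := by
    rw [← integral_prod_swap]
    refine integral_congr_ae (.of_forall fun z => ?_)
    simp only [Prod.fst_swap, Prod.snd_swap]
    rw [P.den_comm]
  have sBA : ∫ z : R3 × R3, conj (f z.2 / (P.den z.1 z.2 : ℂ)) *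
      (g z.1 / (P.den z.1 z.2 : ℂ)) ∂(volume.prod volume) =
      ∫ z : R3 × R3, conj (f z.1 / (P.den z.1 z.2 : ℂ)) *
      (g z.2 / (P.den z.1 z.2 : ℂ)) ∂(volume.prod volume) := by
    rw [← integral_prod_swap]
    refine integral_congr_ae (.of_forall fun z => ?_)
    simp only [Prod.fst_swap, Prod.snd_swap]
    rw [P.den_comm]
  have iA := hAA.integral_prod_left
  have iB := hAB.integral_prod_left
  have hpt : ∀ p : R3, conj (f p) * P.wFun g p =
      2 * (∫ q : R3, conj (f p / (P.den p q : ℂ)) * (g p / (P.den p q : ℂ)))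
      - 2 * ∫ q : R3, conj (f p / (P.den p q : ℂ)) * (g q / (P.den p q : ℂ)) := fun p => by
    have e1 : ∀ q : R3, conj (f p / (P.den p q : ℂ)) * (g p / (P.den p q : ℂ)) =
        (conj (f p) * g p) * (((P.den p q ^ 2)⁻¹ : ℝ) : ℂ) := fun q => by
      rw [map_div₀, Complex.conj_ofReal]
      push_cast
      ring
    have e2 : ∀ q : R3, conj (f p / (P.den p q : ℂ)) * (g q / (P.den p q : ℂ)) =
        conj (f p) * (g q / (P.den p q : ℂ) ^ 2) := fun q => by
      rw [map_div₀, Complex.conj_ofReal]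
      ring
    simp only [e1, e2]
    rw [integral_const_mul, integral_const_mul, integral_complex_ofReal, (P.integral_den p).2]
    unfold wFun
    push_cast
    ring
  simp only [hpt]
  refine ⟨(iA.const_mul 2).sub (iB.const_mul 2), ?_⟩
  rw [integral_sub (iA.const_mul 2) (iB.const_mul 2), integral_const_mul, integral_const_mul,
    ← integral_prod _ hAA, ← integral_prod _ hAB]
  have e3 : ∀ z : R3 × R3, conj ((f z.1 - f z.2) / (P.den z.1 z.2 : ℂ)) *
        ((g z.1 - g z.2) / (P.den z.1 z.2 : ℂ)) =
      ((conj (f z.1 / (P.den z.1 z.2 : ℂ)) * (g z.1 / (P.den z.1 z.2 : ℂ)) -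
        conj (f z.1 / (P.den z.1 z.2 : ℂ)) * (g z.2 / (P.den z.1 z.2 : ℂ))) -
        conj (f z.2 / (P.den z.1 z.2 : ℂ)) * (g z.1 / (P.den z.1 z.2 : ℂ))) +
        conj (f z.2 / (P.den z.1 z.2 : ℂ)) * (g z.2 / (P.den z.1 z.2 : ℂ)) := fun z => by
    simp only [map_div₀, map_sub]
    ring
  simp only [e3]
  rw [integral_four hAA hAB hBA hBB, sBB, sBA]
  ring

theorem ae_eq_zero (hf : P.WInt f) (h : ∫ p, conj (f p) * P.wFun f p = 0) :
    f =ᵐ[volume] 0 := by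
  have hu : MemLp (fun z : R3 × R3 => (f z.1 - f z.2) / (P.den z.1 z.2 : ℂ)) 2
      (volume.prod volume) := by
    refine (hf.memLp_fst.sub hf.memLp_snd).ae_eq (.of_forall fun z => ?_)
    simp [sub_div]
  have hu2 := (memLp_two_iff_integrable_sq_norm hu.1).1 hu
  rw [(hf.integrable_mul hf).2] at h
  simp only [Complex.conj_mul', ← Complex.ofReal_pow] at h
  rw [integral_complex_ofReal, Complex.ofReal_eq_zero,
    integral_eq_zero_iff_of_nonneg (fun z => by positivity) hu2] at h
  have h1 : ∀ᵐ z : R3 × R3 ∂(volume.prod volume), f z.1 = f z.2 := by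
    filter_upwards [h] with z hz
    have hd : (P.den z.1 z.2 : ℂ) ≠ 0 := Complex.ofReal_ne_zero.2 (P.den_pos z.1 z.2).ne'
    have : (f z.1 - f z.2) / (P.den z.1 z.2 : ℂ) = 0 := by simpa using hz
    exact sub_eq_zero.1 ((div_eq_zero_iff.1 this).resolve_right hd)
  obtain ⟨p₀, hp₀⟩ := (Measure.ae_ae_of_ae_prod h1).exists
  set c := f p₀ with hc
  have h2 : f =ᵐ[volume] fun _ => c := by
    filter_upwards [hp₀] with q hq using hq.symm
  by_cases hc0 : c = 0
  · rw [hc0] at h2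
    exact h2
  exfalso
  have h3 : Integrable (fun p : R3 => (√(P.nu * ‖p‖ ^ 2 + P.lam))⁻¹) volume := by
    refine (hf.int.const_mul (‖c‖ ^ 2)⁻¹).congr ?_
    filter_upwards [h2] with p hp
    have : ‖c‖ ≠ 0 := norm_ne_zero_iff.2 hc0
    rw [hp]
    field_simp
  rw [integrable_fun_norm_addHaar volume (f := fun r : ℝ => (√(P.nu * r ^ 2 + P.lam))⁻¹)] at h3
  have h4 : IntegrableOn (fun _ : ℝ => (√(P.nu + P.lam))⁻¹) (Set.Ioi 1) := by
    refine (h3.mono_set (Set.Ioi_subset_Ioi zero_le_one)).mono' (by fun_prop) ?_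
    refine (ae_restrict_iff' measurableSet_Ioi).2 (.of_forall fun r hr => ?_)
    have hr1 : (1 : ℝ) < r := hr
    have hnu := P.nu_pos
    have hlam := P.lam_pos
    rw [Real.norm_of_nonneg (by positivity)]
    simp only [finrank_euclideanSpace, Fintype.card_fin, smul_eq_mul]
    have h5 : √(P.nu * r ^ 2 + P.lam) ≤ √(P.nu + P.lam) * r := by
      rw [← Real.sqrt_sq (by linarith : (0:ℝ) ≤ r), ← Real.sqrt_mul (by positivity),
        Real.sqrt_sq (by linarith : (0:ℝ) ≤ r)]
      apply Real.sqrt_le_sqrt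
      have : 1 ≤ r ^ 2 := one_le_pow₀ hr1.le
      nlinarith
    have h6 : 0 < √(P.nu * r ^ 2 + P.lam) := Real.sqrt_pos.2 (by positivity)
    have h7 : 0 < √(P.nu + P.lam) := Real.sqrt_pos.2 (by positivity)
    rw [← div_eq_mul_inv, inv_eq_one_div, div_le_div_iff₀ h7 h6]
    norm_num
    nlinarith
  rw [integrableOn_const_iff] at h4
  have h7 : 0 < √(P.nu + P.lam) := Real.sqrt_pos.2 (by linarith [P.nu_pos, P.lam_pos])
  rcases h4 with h4 | h4
  · exact (inv_pos.2 h7).ne' (by simpa using h4)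
  · simp at h4

end Params.WInt

/-- A choice of the (angular, unitary) Fourier transform of `ξ` as a function; it is determined
almost everywhere whenever it exists. -/
def momentum (ξ : 𝓢'(R3, ℂ)) : R3 → ℂ := by
  classical
  exact if h : ∃ f, HasMomentum ξ f then h.choose else 0

theorem HasMomentum.momentum {ξ : 𝓢'(R3, ℂ)} {f : R3 → ℂ} (h : HasMomentum ξ f) :
    HasMomentum ξ (momentum ξ) := by
  have h' : ∃ f, HasMomentum ξ f := ⟨f, h⟩
  unfold TMS.momentum
  rw [dif_pos h']
  exact h'.choose_spec

/-- Harmonic homogeneous polynomials of degree `ℓ` in three variables; their restrictions to the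
unit sphere are the spherical harmonics `span {Y_{ℓ,-ℓ}, …, Y_{ℓ,ℓ}}`. -/
def harmonicPolys (ℓ : ℕ) : Submodule ℂ (MvPolynomial (Fin 3) ℂ) where
  carrier := {Y | Y.IsHomogeneous ℓ ∧
    ∑ i : Fin 3, MvPolynomial.pderiv i (MvPolynomial.pderiv i Y) = 0}
  add_mem' := by
    rintro a b ⟨ha, ha'⟩ ⟨hb, hb'⟩
    refine ⟨ha.add hb, ?_⟩
    simp only [map_add, Finset.sum_add_distrib, ha', hb', add_zero]
  zero_mem' := ⟨MvPolynomial.isHomogeneous_zero _ _ _, by simp⟩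
  smul_mem' := by
    rintro c a ⟨ha, ha'⟩
    refine ⟨(MvPolynomial.homogeneousSubmodule (Fin 3) ℂ ℓ).smul_mem c ha, ?_⟩
    have h : ∀ i : Fin 3, MvPolynomial.pderiv i (MvPolynomial.pderiv i (c • a))
        = c • MvPolynomial.pderiv i (MvPolynomial.pderiv i a) := fun i => by
      rw [Derivation.map_smul, Derivation.map_smul]
    simp only [h, ← Finset.smul_sum, ha', smul_zero]

/-- Functions of angular symmetry `ℓ`: finite sums of `g(|p|) Y(p/|p|)` with `g` measurable and `Y`
a spherical harmonic of degree `ℓ`. -/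
def sectorFunctions (ℓ : ℕ) : Submodule ℂ (R3 → ℂ) :=
  Submodule.span ℂ {f | ∃ g : ℝ → ℂ, Measurable g ∧ ∃ Y ∈ harmonicPolys ℓ,
    f = fun p => g ‖p‖ * MvPolynomial.eval (fun i => ((‖p‖⁻¹ * p i : ℝ) : ℂ)) Y}

/-- The sector `H^s_ℓ(ℝ³)` of angular symmetry `ℓ` of the Sobolev space `H^s(ℝ³)`. -/
def sobolevSector (s : ℝ) (ℓ : ℕ) : Submodule ℂ 𝓢'(R3, ℂ) where
  carrier := {ξ | TemperedDistribution.MemSobolev s 2 ξ ∧ ∃ f ∈ sectorFunctions ℓ, HasMomentum ξ f}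
  add_mem' := by
    rintro ξ η ⟨hξ, f, hf, hf'⟩ ⟨hη, g, hg, hg'⟩
    exact ⟨hξ.add hη, f + g, add_mem hf hg, hf'.add hg'⟩
  zero_mem' := ⟨TemperedDistribution.memSobolev_fun_zero _ _ _ _, 0, zero_mem _, .zero⟩
  smul_mem' := by
    rintro c ξ ⟨hξ, f, hf, hf'⟩
    exact ⟨hξ.smul c, c • f, Submodule.smul_mem _ c hf, hf'.smul c⟩

/-- The space of charges `H^{-1/2}_{W_λ,ℓ}(ℝ³)`: the vector space `H^{-1/2}_ℓ(ℝ³)`, to be equipped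
with the scalar product `⟨ξ, η⟩_{W_λ} = ⟨ξ, W_λ η⟩_{H^{-1/2},H^{1/2}}`. -/
def ChargeSpace (_P : Params) (ℓ : ℕ) : Type := sobolevSector (-(1 / 2)) ℓ

namespace ChargeSpace
variable {P : Params} {ℓ : ℕ}

instance : AddCommGroup (ChargeSpace P ℓ) :=
  inferInstanceAs (AddCommGroup (sobolevSector (-(1 / 2)) ℓ))

instance : Module ℂ (ChargeSpace P ℓ) :=
  inferInstanceAs (Module ℂ (sobolevSector (-(1 / 2)) ℓ))

/-- A charge as a tempered distribution. -/
def toDist : ChargeSpace P ℓ →ₗ[ℂ] 𝓢'(R3, ℂ) := (sobolevSector (-(1 / 2)) ℓ).subtype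

theorem toDist_injective : Function.Injective (toDist (P := P) (ℓ := ℓ)) :=
  Subtype.val_injective

theorem toDist_mem (ξ : ChargeSpace P ℓ) : ξ.toDist ∈ sobolevSector (-(1 / 2)) ℓ :=
  Subtype.property ξ

theorem hasMomentum (ξ : ChargeSpace P ℓ) : HasMomentum ξ.toDist (momentum ξ.toDist) := by
  obtain ⟨-, f, -, hf⟩ := ξ.toDist_mem
  exact hf.momentum

theorem wInt (ξ : ChargeSpace P ℓ) : P.WInt (momentum ξ.toDist) := by
  have h := ξ.hasMomentum
  have h1 := h.integrable_weight ξ.toDist_mem.1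
  have hnu := P.nu_pos
  have hlam := P.lam_pos
  refine ⟨h.locallyIntegrable.aestronglyMeasurable, ?_⟩
  refine (h1.const_mul (√(1 / P.lam + 1 / P.nu))).mono' ?_ (.of_forall fun p => ?_)
  · have h2 : Continuous fun p : R3 => (√(P.nu * ‖p‖ ^ 2 + P.lam))⁻¹ :=
      Continuous.inv₀ (by fun_prop) fun p => (Real.sqrt_pos.2 (P.rad_pos p)).ne'
    refine ((h.locallyIntegrable.aestronglyMeasurable.norm.pow 2).mul
      h2.aestronglyMeasurable).congr (.of_forall fun p => ?_)
    simp [div_eq_mul_inv]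
  · have hr := P.rad_pos p
    have hr' : 0 < √(P.nu * ‖p‖ ^ 2 + P.lam) := Real.sqrt_pos.2 hr
    have hb : 0 < 1 + ‖(2 * Real.pi)⁻¹ • p‖ ^ 2 := by positivity
    rw [Real.norm_of_nonneg (by positivity), Real.rpow_neg hb.le, ← Real.sqrt_eq_rpow,
      ← mul_assoc, div_eq_mul_inv, mul_comm (‖_‖ ^ 2)]
    refine mul_le_mul_of_nonneg_right ?_ (by positivity)
    rw [← div_eq_mul_inv, inv_eq_one_div, div_le_div_iff₀ hr' (Real.sqrt_pos.2 hb), one_mul,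
      ← Real.sqrt_mul (by positivity)]
    apply Real.sqrt_le_sqrt
    have h3 : ‖(2 * Real.pi)⁻¹ • p‖ ^ 2 ≤ ‖p‖ ^ 2 := by
      rw [norm_smul, mul_pow]
      have h4 : ‖(2 * Real.pi)⁻¹‖ ≤ 1 := by
        rw [Real.norm_of_nonneg (by positivity)]
        exact inv_le_one_of_one_le₀ (by linarith [Real.pi_gt_three])
      have h5 : ‖(2 * Real.pi)⁻¹‖ ^ 2 ≤ 1 := pow_le_one₀ (norm_nonneg _) h4
      exact mul_le_of_le_one_left (by positivity) h5
    have h6 : (1 / P.lam + 1 / P.nu) * (P.nu * ‖p‖ ^ 2 + P.lam)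
        = 1 + ‖p‖ ^ 2 + (P.nu * ‖p‖ ^ 2 / P.lam + P.lam / P.nu) := by
      field_simp
      ring
    have h7 : 0 ≤ P.nu * ‖p‖ ^ 2 / P.lam + P.lam / P.nu := by positivity
    rw [h6]
    linarith

theorem momentum_add (ξ η : ChargeSpace P ℓ) :
    momentum (ξ + η).toDist =ᵐ[volume] momentum ξ.toDist + momentum η.toDist :=
  (ξ + η).hasMomentum.ae_eq (by rw [map_add]; exact ξ.hasMomentum.add η.hasMomentum)

theorem momentum_smul (c : ℂ) (ξ : ChargeSpace P ℓ) :
    momentum (c • ξ).toDist =ᵐ[volume] c • momentum ξ.toDist :=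
  (c • ξ).hasMomentum.ae_eq (by rw [map_smul]; exact ξ.hasMomentum.smul c)

/-- `⟨ξ, η⟩_{W_λ} = ∫ conj ξ̂(p) (W_λ η)^(p) dp`. -/
def wInner (ξ η : ChargeSpace P ℓ) : ℂ :=
  ∫ p, conj (momentum ξ.toDist p) * P.wFun (momentum η.toDist) p

@[reducible] def core : InnerProductSpace.Core ℂ (ChargeSpace P ℓ) where
  inner := wInner
  conj_inner_symm ξ η := by
    simp only [wInner]
    rw [(ξ.wInt.integrable_mul η.wInt).2, (η.wInt.integrable_mul ξ.wInt).2, ← integral_conj]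
    refine integral_congr_ae (.of_forall fun z => ?_)
    simp only [map_mul, Complex.conj_conj]
    rw [mul_comm]
  re_inner_nonneg ξ := by
    simp only [wInner]
    rw [(ξ.wInt.integrable_mul ξ.wInt).2]
    simp only [Complex.conj_mul', ← Complex.ofReal_pow]
    rw [integral_complex_ofReal]
    simp only [RCLike.re_to_complex, Complex.ofReal_re]
    exact integral_nonneg fun z => by positivity
  add_left ξ η ζ := by
    simp only [wInner]
    rw [← integral_add (ξ.wInt.integrable_mul ζ.wInt).1 (η.wInt.integrable_mul ζ.wInt).1]
    refine integral_congr_ae ?_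
    filter_upwards [momentum_add ξ η] with p hp
    rw [hp]
    simp [add_mul]
  smul_left ξ η c := by
    simp only [wInner]
    rw [← integral_const_mul]
    refine integral_congr_ae ?_
    filter_upwards [momentum_smul c ξ] with p hp
    rw [hp]
    simp [mul_assoc]
  definite ξ h := by
    have h1 := ξ.wInt.ae_eq_zero h
    exact toDist_injective (by
      rw [map_zero]
      exact ξ.hasMomentum.eq_of_ae_eq .zero h1)

instance : NormedAddCommGroup (ChargeSpace P ℓ) := core.toNormedAddCommGroup

instance : InnerProductSpace ℂ (ChargeSpace P ℓ) := InnerProductSpace.ofCore core.toCore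

theorem inner_eq (ξ η : ChargeSpace P ℓ) : inner ℂ ξ η = wInner ξ η := rfl

end ChargeSpace

/-- The pairing `⟨ξ, τ⟩ = ∫ conj ξ̂(p) τ̂(p) dp` of `H^{1/2}(ℝ³)` with `H^{-1/2}(ℝ³)`. -/
def sobolevPairing (ξ τ : 𝓢'(R3, ℂ)) : ℂ := ∫ p, conj (momentum ξ p) * momentum τ p

namespace Params
variable (P : Params)

/-- The function `(T_λ ξ)^` in terms of `f = ξ̂`. -/
def tFun (f : R3 → ℂ) (p : R3) : ℂ :=
  (2 * Real.pi ^ 2 * √(P.nu * ‖p‖ ^ 2 + P.lam) : ℝ) * f p + ∫ q, f q / (P.den p q : ℂ)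

/-- `T_λ ξ = τ`, with absolutely convergent integral at almost every momentum. -/
def IsT (ξ τ : 𝓢'(R3, ℂ)) : Prop :=
  ∃ f, HasMomentum ξ f ∧ (∀ᵐ p : R3, Integrable (fun q => f q / (P.den p q : ℂ)) volume) ∧
    HasMomentum τ (P.tFun f)

/-- `W_λ ζ = ω`, with absolutely convergent integral at almost every momentum. -/
def IsW (ζ ω : 𝓢'(R3, ℂ)) : Prop :=
  ∃ f, HasMomentum ζ f ∧ (∀ᵐ p : R3, Integrable (fun q => f q / (P.den p q : ℂ) ^ 2) volume) ∧
    HasMomentum ω (P.wFun f)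

theorem IsT.add {P : Params} {ξ η τ σ : 𝓢'(R3, ℂ)} (h : P.IsT ξ τ) (h' : P.IsT η σ) :
    P.IsT (ξ + η) (τ + σ) := by
  obtain ⟨f, hf, hfi, hft⟩ := h
  obtain ⟨g, hg, hgi, hgt⟩ := h'
  refine ⟨f + g, hf.add hg, ?_, (hft.add hgt).congr ?_⟩
  · filter_upwards [hfi, hgi] with p h1 h2
    simpa only [Pi.add_apply, add_div] using h1.fun_add h2
  · filter_upwards [hfi, hgi] with p h1 h2
    simp only [tFun, Pi.add_apply, add_div]
    rw [integral_add h1 h2]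
    ring

theorem IsT.smul {P : Params} {ξ τ : 𝓢'(R3, ℂ)} (c : ℂ) (h : P.IsT ξ τ) :
    P.IsT (c • ξ) (c • τ) := by
  obtain ⟨f, hf, hfi, hft⟩ := h
  refine ⟨c • f, hf.smul c, ?_, (hft.smul c).congr (.of_forall fun p => ?_)⟩
  · filter_upwards [hfi] with p h1
    simpa only [Pi.smul_apply, smul_eq_mul, mul_div_assoc] using h1.const_mul c
  · simp only [tFun, Pi.smul_apply, smul_eq_mul, mul_div_assoc]
    rw [integral_const_mul]
    ring

theorem IsT.zero : P.IsT 0 0 :=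
  ⟨0, .zero, by simp, HasMomentum.zero.congr (.of_forall fun p => by simp [tFun])⟩

theorem IsW.add {P : Params} {ξ η τ σ : 𝓢'(R3, ℂ)} (h : P.IsW ξ τ) (h' : P.IsW η σ) :
    P.IsW (ξ + η) (τ + σ) := by
  obtain ⟨f, hf, hfi, hft⟩ := h
  obtain ⟨g, hg, hgi, hgt⟩ := h'
  refine ⟨f + g, hf.add hg, ?_, (hft.add hgt).congr ?_⟩
  · filter_upwards [hfi, hgi] with p h1 h2
    simpa only [Pi.add_apply, add_div] using h1.fun_add h2
  · filter_upwards [hfi, hgi] with p h1 h2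
    simp only [wFun, Pi.add_apply, add_div]
    rw [integral_add h1 h2]
    ring

theorem IsW.smul {P : Params} {ξ τ : 𝓢'(R3, ℂ)} (c : ℂ) (h : P.IsW ξ τ) :
    P.IsW (c • ξ) (c • τ) := by
  obtain ⟨f, hf, hfi, hft⟩ := h
  refine ⟨c • f, hf.smul c, ?_, (hft.smul c).congr (.of_forall fun p => ?_)⟩
  · filter_upwards [hfi] with p h1
    simpa only [Pi.smul_apply, smul_eq_mul, mul_div_assoc] using h1.const_mul c
  · simp only [wFun, Pi.smul_apply, smul_eq_mul, mul_div_assoc]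
    rw [integral_const_mul]
    ring

theorem IsW.zero : P.IsW 0 0 :=
  ⟨0, .zero, by simp, HasMomentum.zero.congr (.of_forall fun p => by simp [wFun])⟩

end Params

/-- `ζ = 2 W_λ⁻¹ (T_λ + α) ξ`, meaning that `(T_λ + α) ξ` belongs to `H^{1/2}_ℓ(ℝ³)` and that
`W_λ ζ = 2 (T_λ + α) ξ`. -/
def IsAuxValue (P : Params) (α : ℝ) (ℓ : ℕ) (ξ ζ : ChargeSpace P ℓ) : Prop :=
  ∃ τ, P.IsT ξ.toDist τ ∧ τ + (α : ℂ) • ξ.toDist ∈ sobolevSector (1 / 2) ℓ ∧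
    P.IsW ζ.toDist ((2 : ℂ) • (τ + (α : ℂ) • ξ.toDist))

theorem dist_smul_zero (c : ℂ) : c • (0 : 𝓢'(R3, ℂ)) = 0 := by
  ext φ
  exact mul_zero c

/-- The graph of `𝒜_{λ,α}^{(ℓ)} = 2 W_λ⁻¹ (T_λ + α)` with domain `H^{3/2}_ℓ(ℝ³)`. -/
def auxGraph (P : Params) (α : ℝ) (ℓ : ℕ) : Submodule ℂ (ChargeSpace P ℓ × ChargeSpace P ℓ) where
  carrier := {x | x.1.toDist ∈ sobolevSector (3 / 2) ℓ ∧ IsAuxValue P α ℓ x.1 x.2}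
  add_mem' := by
    rintro x y ⟨hx, τ, h1, h2, h3⟩ ⟨hy, σ, k1, k2, k3⟩
    have e : (τ + σ) + (α : ℂ) • (x.1.toDist + y.1.toDist)
        = (τ + (α : ℂ) • x.1.toDist) + (σ + (α : ℂ) • y.1.toDist) := by
      rw [smul_add]; abel
    refine ⟨?_, τ + σ, ?_, ?_, ?_⟩
    · rw [Prod.fst_add, map_add]; exact add_mem hx hy
    · rw [Prod.fst_add, map_add]; exact h1.add k1
    · rw [Prod.fst_add, map_add, e]; exact add_mem h2 k2
    · rw [Prod.fst_add, Prod.snd_add, map_add, map_add, e, smul_add]; exact h3.add k3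
  zero_mem' := by
    refine ⟨?_, 0, ?_, ?_, ?_⟩
    · simp
    · simpa using Params.IsT.zero P
    · rw [Prod.fst_zero, map_zero, dist_smul_zero, add_zero]; exact zero_mem _
    · rw [Prod.fst_zero, Prod.snd_zero, map_zero, dist_smul_zero, add_zero, dist_smul_zero]
      exact Params.IsW.zero P
  smul_mem' := by
    rintro c x ⟨hx, τ, h1, h2, h3⟩
    have e : c • τ + (α : ℂ) • c • x.1.toDist = c • (τ + (α : ℂ) • x.1.toDist) := by
      rw [smul_add, smul_comm]
    refine ⟨?_, c • τ, ?_, ?_, ?_⟩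
    · rw [Prod.smul_fst, map_smul]; exact Submodule.smul_mem _ c hx
    · rw [Prod.smul_fst, map_smul]; exact h1.smul c
    · rw [Prod.smul_fst, map_smul, e]; exact Submodule.smul_mem _ c h2
    · rw [Prod.smul_fst, Prod.smul_snd, map_smul, map_smul, e, smul_comm]; exact h3.smul c

/-- The graph is single valued, so that it is the graph of the operator defined from it below. -/
theorem auxGraph_functional (P : Params) (α : ℝ) (ℓ : ℕ) :
    ∀ x ∈ auxGraph P α ℓ, x.1 = 0 → x.2 = 0 := by
  rintro ⟨ξ, ζ⟩ ⟨-, τ, ⟨f, hf, -, hτ⟩, -, ⟨g, hg, -, hω⟩⟩ h0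
  simp only at h0 hf hτ hg hω ⊢
  subst h0
  rw [map_zero] at hf hω
  have hf0 : f =ᵐ[volume] 0 := hf.ae_eq .zero
  have hT0 : P.tFun f =ᵐ[volume] 0 := by
    filter_upwards [hf0] with p hp
    have : ∫ q, f q / (P.den p q : ℂ) = 0 := by
      rw [← integral_zero R3 ℂ (μ := volume)]
      refine integral_congr_ae ?_
      filter_upwards [hf0] with q hq
      simp [hq]
    simp [Params.tFun, this, hp]
  have hτ0 : τ = 0 := hτ.eq_of_ae_eq .zero hT0
  rw [hτ0, dist_smul_zero, add_zero, dist_smul_zero] at hω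
  have hω0 : P.wFun g =ᵐ[volume] 0 := hω.ae_eq .zero
  have hgm : g =ᵐ[volume] momentum ζ.toDist := hg.ae_eq ζ.hasMomentum
  have hW : P.wFun (momentum ζ.toDist) =ᵐ[volume] 0 := by
    filter_upwards [hω0, hgm] with p hp hgp
    have : ∫ q, momentum ζ.toDist q / (P.den p q : ℂ) ^ 2 = ∫ q, g q / (P.den p q : ℂ) ^ 2 := by
      refine integral_congr_ae ?_
      filter_upwards [hgm] with q hq
      rw [hq]
    rw [← hp]
    simp only [Params.wFun, this, hgp]
  refine inner_self_eq_zero.1 (?_ : inner ℂ ζ ζ = 0)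
  rw [ChargeSpace.inner_eq, ChargeSpace.wInner, ← integral_zero R3 ℂ (μ := volume)]
  refine integral_congr_ae ?_
  filter_upwards [hW] with p hp
  simp [hp]

/-- The operator `𝒜_{λ,α}^{(ℓ)}` in the Hilbert space `H^{-1/2}_{W_λ,ℓ}(ℝ³)`. -/
def auxOp (P : Params) (α : ℝ) (ℓ : ℕ) : ChargeSpace P ℓ →ₗ.[ℂ] ChargeSpace P ℓ :=
  (auxGraph P α ℓ).toLinearPMap

theorem auxOp_graph (P : Params) (α : ℝ) (ℓ : ℕ) : (auxOp P α ℓ).graph = auxGraph P α ℓ :=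
  Submodule.toLinearPMap_graph_eq _ (auxGraph_functional P α ℓ)

/-- The Efimov transcendental function `Λ(m)`. -/
def efimov (m : ℝ) : ℝ :=
  2 / Real.pi * (m + 1) ^ 2 * (1 / √(m * (m + 2)) - Real.arcsin (1 / (m + 1)))

/-- The threshold `m*`, the (unique) root of `Λ(m) = 1` in `(0, ∞)`. -/
def mStar : ℝ := sInf {m | 0 < m ∧ efimov m = 1}

section Operators
variable {H : Type*} [NormedAddCommGroup H] [InnerProductSpace ℂ H]

/-- The quadratic form of `A` has strictly positive bottom. -/
def HasPositiveBottom (A : H →ₗ.[ℂ] H) : Prop :=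
  ∃ c : ℝ, 0 < c ∧ ∀ x : A.domain, c * ‖(x : H)‖ ^ 2 ≤ (inner ℂ (x : H) (A x)).re

/-- A sequence in the domain of `A` converges to `x` in the norm and is Cauchy for the quadratic
form `⟨·, A ·⟩`; for semi-bounded symmetric `A` this is the Cauchy property in the form norm. -/
def FormConverges (A : H →ₗ.[ℂ] H) (u : ℕ → A.domain) (x : H) : Prop :=
  Tendsto (fun n => (u n : H)) atTop (𝓝 x) ∧
  Tendsto (fun n : ℕ × ℕ => inner ℂ ((u n.1 - u n.2 : A.domain) : H) (A (u n.1 - u n.2)))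
    atTop (𝓝 0)

/-- The domain `𝒟[A]` of the closure of the quadratic form of a semi-bounded symmetric `A`. -/
def formDomain (A : H →ₗ.[ℂ] H) : Set H := {x | ∃ u, FormConverges A u x}

/-- `A[x, y] = c`, where `A[·, ·]` is the closure of the form `⟨·, A ·⟩`. -/
def IsFormValue (A : H →ₗ.[ℂ] H) (x y : H) (c : ℂ) : Prop :=
  x ∈ formDomain A ∧ y ∈ formDomain A ∧
  ∀ u v, FormConverges A u x → FormConverges A v y →
    Tendsto (fun n => inner ℂ ((u n : A.domain) : H) (A (v n))) atTop (𝓝 c)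

/-- `B` is the Friedrichs extension of the semi-bounded symmetric operator `A`, that is, the
operator of the closed form `A[·, ·]`: `B x = z` if and only if `x ∈ 𝒟[A]` and
`A[y, x] = ⟨y, z⟩` for all `y ∈ 𝒟[A]`. -/
def IsFriedrichsExtension (A B : H →ₗ.[ℂ] H) : Prop :=
  ∀ x z : H, (x, z) ∈ B.graph ↔
    x ∈ formDomain A ∧ ∀ y ∈ formDomain A, IsFormValue A y x (inner ℂ y z)

end Operators

end
end TMS

/-!
In momentum space the denominator `p² + q² + μ p·q + λ` depends on the directions of `p` and `q`
only through their scalar product. By the Funk–Hecke formula (`funkHecke`) the operators `T_λ` and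
`W_λ` therefore act on a function `∑ g_j(|p|) Y_j(p/|p|)` of angular symmetry `ℓ` through scalar
kernels in the radial variables, the same for every spherical harmonic `Y_j` of degree `ℓ`. The
formula is proved for powers by Gaussian integration by parts (`gaussInt_funkHecke`) and extended to
power series.

Put `w(p) = √(ν p² + λ)`. Multiplication by `w^s` and expansion in an orthonormal family of
spherical harmonics identify `H^s_ℓ` with one and the same space `L²(r² dr)` of vector valued radial
coefficients (`HarmonicFrame.sectorEquiv`). Under this identification the inclusion of `H^{s+1}`
into `H^s` is multiplication by `1 / w`, of norm at most `λ^{-1/2}`, the pairing of `H^{1/2}` with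
`H^{-1/2}` is the scalar product, and each of `T_λ : H^{1/2} → H^{-1/2}`, `T_λ : H^{3/2} → H^{1/2}`
and `W_λ : H^{-1/2} → H^{1/2}` is `2π²` times the identity plus an integral operator, which is
bounded by Schur's test. The norms of the integral operators decide everything.

* For `T_λ` on `H^{1/2}` the norm is at most `2π² Λ(m)` (`Params.schurBound_kerT`). Since `Λ`
  decreases, `Λ(m) < 1` for `m > m*` (`efimov_lt_one`), and `T_λ` is coercive with the constant
  `c₀ = 2π² (1 - Λ(m))`, which depends neither on `λ` nor on `ℓ`. Hence `T_λ + α` is coercive if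
  `α ≥ 0`, and also if `α < 0` and `λ > (α / c₀)²`.
* For `W_λ` the norm is at most `μ π² < 2π²` (`Params.schurBound_kerW`), so that `W_λ` is coercive,
  hence bijective by the Lax–Milgram theorem, and its form is a scalar product equivalent to that of
  `H^{-1/2}`.
* For `T_λ` on `H^{3/2}` the norm is finite if `ℓ ≥ 1` (`Params.schurBound_kerS`), so that
  `2 W_λ⁻¹ (T_λ + α)` is defined on all of `H^{3/2}_ℓ`.

What remains is an abstract argument about a `ChargeModel`. A strictly positive bottom, together
with the coercivity of `T_λ`, makes the form of `T_λ + α` equivalent to the norm of `H^{1/2}`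
(`ChargeModel.shifted_coercive`). So the form domain is `H^{1/2}`, and the operator represented by
the closed form is `2 W_λ⁻¹ (T_λ + α)` on its maximal domain
(`ChargeModel.isFriedrichsExtension_maximalOp`). This operator is symmetric and, by the Lax–Milgram
theorem, onto, hence self-adjoint (`ChargeModel.isSelfAdjoint_maximalOp`).
-/

namespace TMS

/-! ### Friedrichs extension in a model space -/

section CoerciveOperators
variable {K : Type*} [NormedAddCommGroup K] [InnerProductSpace ℂ K]

theorem norm_le_of_coercive {M : K →L[ℂ] K} {c : ℝ}
    (hM : ∀ u, c * ‖u‖ ^ 2 ≤ (inner ℂ u (M u)).re) (u : K) : c * ‖u‖ ≤ ‖M u‖ := by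
  rcases eq_or_ne u 0 with rfl | hu
  · simp
  have h0 : 0 < ‖u‖ := norm_pos_iff.2 hu
  have h1 : (inner ℂ u (M u)).re ≤ ‖u‖ * ‖M u‖ :=
    (Complex.re_le_norm _).trans (norm_inner_le_norm u (M u))
  have h2 := (hM u).trans h1
  refine le_of_mul_le_mul_left (?_ : ‖u‖ * (c * ‖u‖) ≤ ‖u‖ * ‖M u‖) h0
  linarith [h2, (by ring : c * ‖u‖ ^ 2 = ‖u‖ * (c * ‖u‖))]

/-- The Lax–Milgram theorem for a bounded operator on a complex Hilbert space. -/
theorem bijective_of_coercive [CompleteSpace K] {M : K →L[ℂ] K} {c : ℝ} (hc : 0 < c)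
    (hM : ∀ u, c * ‖u‖ ^ 2 ≤ (inner ℂ u (M u)).re) : Function.Bijective M := by
  have hb := norm_le_of_coercive hM
  have hanti : AntilipschitzWith (Real.toNNReal c⁻¹) M := by
    refine M.antilipschitz_of_bound fun u => ?_
    rw [Real.coe_toNNReal _ (by positivity), inv_mul_eq_div, le_div_iff₀ hc]
    linarith [hb u]
  refine ⟨hanti.injective, ?_⟩
  have hcl : IsClosed (Set.range M) := hanti.isClosed_range M.uniformContinuous
  have hcl' : IsClosed ((LinearMap.range M.toLinearMap : Submodule ℂ K) : Set K) := by
    exact hcl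
  have : CompleteSpace (LinearMap.range M.toLinearMap : Submodule ℂ K) :=
    hcl'.completeSpace_coe
  have horth : (LinearMap.range M.toLinearMap)ᗮ = ⊥ := by
    rw [Submodule.eq_bot_iff]
    intro y hy
    have h1 : inner ℂ (M y) y = 0 := (Submodule.mem_orthogonal _ y).1 hy _ ⟨y, rfl⟩
    have h2 := hM y
    rw [← inner_conj_symm, h1] at h2
    simp only [map_zero, Complex.zero_re] at h2
    have h3 : ‖y‖ ^ 2 ≤ 0 := by nlinarith
    exact norm_eq_zero.1 (pow_eq_zero_iff two_ne_zero |>.1 (le_antisymm h3 (by positivity)))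
  have := (Submodule.orthogonal_eq_bot_iff).1 horth
  exact LinearMap.range_eq_top.1 this

/-- The orthogonal complement of the range of a symmetric operator is its kernel. -/
theorem denseRange_of_symmetric_injective [CompleteSpace K] {D : K →L[ℂ] K}
    (hD : ∀ u v, inner ℂ (D u) v = inner ℂ u (D v)) (hinj : Function.Injective D) :
    DenseRange D := by
  have horth : (LinearMap.range D.toLinearMap)ᗮ = ⊥ := by
    rw [Submodule.eq_bot_iff]
    intro y hy
    refine hinj ?_
    rw [map_zero]
    refine (inner_self_eq_zero (𝕜 := ℂ)).1 ?_
    rw [← hD]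
    exact (Submodule.mem_orthogonal _ y).1 hy _ ⟨D y, rfl⟩
  have h := (Submodule.topologicalClosure_eq_top_iff).2 horth
  have h2 := (Submodule.dense_iff_topologicalClosure_eq_top).2 h
  exact h2

end CoerciveOperators

/-- A Hilbert space `K` in which a space of charges `H` is realised. The identification `Θ` carries
`W` to the scalar product of `H`; the ranges of `Θ ∘ D` and `Θ ∘ D ∘ D` play the roles of
`H^{1/2}` and `H^{3/2}`, and `T` is the form of an operator from `H^{1/2}` to its dual whose
restriction to `H^{3/2}` takes values in `H^{1/2}`, as expressed by `T D = D S`. -/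
structure ChargeModel (K H : Type*) [NormedAddCommGroup K] [InnerProductSpace ℂ K]
    [NormedAddCommGroup H] [InnerProductSpace ℂ H] where
  Θ : K ≃ₗ[ℂ] H
  W : K →L[ℂ] K
  T : K →L[ℂ] K
  D : K →L[ℂ] K
  S : K →L[ℂ] K
  inner_Θ : ∀ u v, inner ℂ (Θ u) (Θ v) = inner ℂ u (W v)
  W_coercive : ∃ c : ℝ, 0 < c ∧ ∀ u, c * ‖u‖ ^ 2 ≤ (inner ℂ u (W u)).re
  T_symm : ∀ u v, inner ℂ (T u) v = inner ℂ u (T v)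
  D_symm : ∀ u v, inner ℂ (D u) v = inner ℂ u (D v)
  D_inj : Function.Injective D
  T_D : ∀ u, T (D u) = D (S u)

namespace ChargeModel
variable {K H : Type*} [NormedAddCommGroup K] [InnerProductSpace ℂ K]
  [NormedAddCommGroup H] [InnerProductSpace ℂ H] (X : ChargeModel K H)

theorem norm_Θ_sq (u : K) : ‖X.Θ u‖ ^ 2 = (inner ℂ u (X.W u)).re := by
  rw [← X.inner_Θ, inner_self_eq_norm_sq_to_K]
  norm_cast

theorem norm_Θ_sq_le (u : K) : ‖X.Θ u‖ ^ 2 ≤ ‖X.W‖ * ‖u‖ ^ 2 := by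
  rw [X.norm_Θ_sq]
  calc (inner ℂ u (X.W u)).re ≤ ‖u‖ * ‖X.W u‖ :=
        (Complex.re_le_norm _).trans (norm_inner_le_norm _ _)
    _ ≤ ‖u‖ * (‖X.W‖ * ‖u‖) := by gcongr; exact X.W.le_opNorm u
    _ = ‖X.W‖ * ‖u‖ ^ 2 := by ring

/-- The identification `Θ` as an isomorphism of topological vector spaces. -/
theorem exists_continuousLinearEquiv : ∃ e : K ≃L[ℂ] H, ∀ u, e u = X.Θ u := by
  obtain ⟨c, hc, h⟩ := X.W_coercive
  refine ⟨X.Θ.toContinuousLinearEquivOfBounds (√‖X.W‖) (√c⁻¹) (fun u => ?_) (fun y => ?_),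
    fun u => rfl⟩
  · rw [← Real.sqrt_sq (norm_nonneg (X.Θ u)), ← Real.sqrt_sq (norm_nonneg u),
      ← Real.sqrt_mul (norm_nonneg _)]
    exact Real.sqrt_le_sqrt (X.norm_Θ_sq_le u)
  · obtain ⟨u, rfl⟩ := X.Θ.surjective y
    rw [LinearEquiv.symm_apply_apply, ← Real.sqrt_sq (norm_nonneg (X.Θ u)),
      ← Real.sqrt_sq (norm_nonneg u), ← Real.sqrt_mul (by positivity)]
    refine Real.sqrt_le_sqrt ?_
    rw [inv_mul_eq_div, le_div_iff₀ hc, X.norm_Θ_sq]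
    linarith [h u]

theorem continuous_Θ : Continuous X.Θ := by
  obtain ⟨e, he⟩ := X.exists_continuousLinearEquiv
  exact e.continuous.congr he

/-- The operator `T + α`, as an operator from `H^{1/2}` to its dual, in the model. -/
noncomputable def shifted (α : ℝ) : K →L[ℂ] K := X.T + (α : ℂ) • X.D

theorem shifted_symm (α : ℝ) (u v : K) :
    inner ℂ (X.shifted α u) v = inner ℂ u (X.shifted α v) := by
  change inner ℂ (X.T u + (α : ℂ) • X.D u) v = inner ℂ u (X.T v + (α : ℂ) • X.D v)
  rw [inner_add_left, inner_add_right, inner_smul_left, inner_smul_right, X.T_symm, X.D_symm,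
    Complex.conj_ofReal]

theorem shifted_D (α : ℝ) (u : K) :
    X.shifted α (X.D u) = X.D (X.S u + (α : ℂ) • X.D u) := by
  simp [shifted, X.T_D]

/-- An operator whose form is `2 (T + α)` and whose domain lies between `H^{3/2}` and `H^{1/2}`. -/
structure HasForm (α : ℝ) (A : H →ₗ.[ℂ] H) : Prop where
  subset : ∀ x : A.domain, ∃ u, (x : H) = X.Θ (X.D u)
  mem : ∀ g, X.Θ (X.D (X.D g)) ∈ A.domain
  inner_eq : ∀ (x y : A.domain) (u v : K), (x : H) = X.Θ (X.D u) → (y : H) = X.Θ (X.D v) →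
    inner ℂ (x : H) (A y) = 2 * inner ℂ u (X.shifted α v)

theorem HasForm.isFormalAdjoint {X : ChargeModel K H} {α : ℝ} {A : H →ₗ.[ℂ] H}
    (hA : X.HasForm α A) : A.IsFormalAdjoint A := by
  intro x y
  obtain ⟨u, hu⟩ := hA.subset x
  obtain ⟨v, hv⟩ := hA.subset y
  rw [hA.inner_eq x y u v hu hv, ← inner_conj_symm, hA.inner_eq y x v u hv hu, map_mul,
    inner_conj_symm, X.shifted_symm, Complex.conj_ofNat]

/-- Coercivity in the norm of `H^{1/2}` is stronger than a positive bottom, since that norm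
dominates the norm of `H`. -/
theorem hasPositiveBottom {X : ChargeModel K H} {α : ℝ} {A : H →ₗ.[ℂ] H} (hA : X.HasForm α A)
    {c : ℝ} (hc : 0 < c) (hM : ∀ u, c * ‖u‖ ^ 2 ≤ (inner ℂ u (X.shifted α u)).re) :
    HasPositiveBottom A := by
  set N := ‖X.W‖ * ‖X.D‖ ^ 2 + 1 with hN
  have hN0 : 0 < N := by positivity
  refine ⟨2 * c / N, by positivity, fun x => ?_⟩
  obtain ⟨u, hu⟩ := hA.subset x
  rw [hA.inner_eq x x u u hu hu, hu]
  have h1 : ‖X.Θ (X.D u)‖ ^ 2 ≤ N * ‖u‖ ^ 2 :=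
    calc _ ≤ ‖X.W‖ * ‖X.D u‖ ^ 2 := X.norm_Θ_sq_le _
      _ ≤ ‖X.W‖ * (‖X.D‖ * ‖u‖) ^ 2 := by
          gcongr
          exact X.D.le_opNorm u
      _ = (‖X.W‖ * ‖X.D‖ ^ 2) * ‖u‖ ^ 2 := by ring
      _ ≤ N * ‖u‖ ^ 2 := by
          gcongr
          linarith
  have h2 : (2 * inner ℂ u (X.shifted α u)).re = 2 * (inner ℂ u (X.shifted α u)).re := by
    simp
  rw [h2]
  calc 2 * c / N * ‖X.Θ (X.D u)‖ ^ 2 ≤ 2 * c / N * (N * ‖u‖ ^ 2) := by gcongr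
    _ = 2 * (c * ‖u‖ ^ 2) := by field_simp
    _ ≤ _ := by linarith [hM u]

variable [CompleteSpace K]

theorem completeSpace (X : ChargeModel K H) : CompleteSpace H := by
  obtain ⟨e, -⟩ := X.exists_continuousLinearEquiv
  exact (completeSpace_congr (e := e.toEquiv) e.isUniformEmbedding).1 inferInstance

theorem W_bijective : Function.Bijective X.W := by
  obtain ⟨c, hc, h⟩ := X.W_coercive
  exact bijective_of_coercive hc h

theorem denseRange_D : DenseRange X.D := denseRange_of_symmetric_injective X.D_symm X.D_inj

theorem dense_range_Θ_D_D : DenseRange fun g => X.Θ (X.D (X.D g)) := by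
  have h := X.denseRange_D.comp X.denseRange_D X.D.continuous
  exact X.Θ.surjective.denseRange.comp h X.continuous_Θ

variable {X}

theorem HasForm.dense {α : ℝ} {A : H →ₗ.[ℂ] H} (hA : X.HasForm α A) :
    Dense (A.domain : Set H) :=
  X.dense_range_Θ_D_D.mono (by rintro _ ⟨g, rfl⟩; exact hA.mem g)

theorem tendsto_prod_atTop_iff {f : ℕ × ℕ → ℝ} (h : Tendsto f atTop (𝓝 0)) {ε : ℝ} (hε : 0 < ε) :
    ∃ N, ∀ n ≥ N, ∀ m ≥ N, f (n, m) < ε := by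
  have h1 := h.eventually (gt_mem_nhds hε)
  obtain ⟨⟨a, b⟩, hab⟩ := eventually_atTop.1 h1
  exact ⟨max a b, fun n hn m hm => hab (n, m)
    ⟨(le_max_left _ _).trans hn, (le_max_right _ _).trans hm⟩⟩

/-- Form convergence in `H` is convergence in the norm of `H^{1/2}`: coercivity turns a form-Cauchy
sequence into a Cauchy sequence of representatives. -/
theorem HasForm.tendsto {α : ℝ} {A : H →ₗ.[ℂ] H} (hA : X.HasForm α A) {c : ℝ} (hc : 0 < c)
    (hM : ∀ u, c * ‖u‖ ^ 2 ≤ (inner ℂ u (X.shifted α u)).re) {x : H} {y : ℕ → A.domain}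
    (hy : FormConverges A y x) {v : ℕ → K} (hv : ∀ n, (y n : H) = X.Θ (X.D (v n))) :
    ∃ v₀, x = X.Θ (X.D v₀) ∧ Tendsto v atTop (𝓝 v₀) := by
  have h1 : ∀ n : ℕ × ℕ, inner ℂ ((y n.1 - y n.2 : A.domain) : H) (A (y n.1 - y n.2)) =
      2 * inner ℂ (v n.1 - v n.2) (X.shifted α (v n.1 - v n.2)) := fun n => by
    have : ((y n.1 - y n.2 : A.domain) : H) = X.Θ (X.D (v n.1 - v n.2)) := by
      rw [AddSubgroupClass.coe_sub, hv, hv, map_sub, map_sub]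
    exact hA.inner_eq _ _ _ _ this this
  have h2 := hy.2
  simp only [h1] at h2
  have h3 : Tendsto (fun n : ℕ × ℕ => ‖(2 : ℂ) * inner ℂ (v n.1 - v n.2)
      (X.shifted α (v n.1 - v n.2))‖) atTop (𝓝 0) := by simpa using h2.norm
  have hcauchy : CauchySeq v := by
    rw [Metric.cauchySeq_iff]
    intro ε hε
    obtain ⟨N, hN⟩ := tendsto_prod_atTop_iff h3 (by positivity : 0 < c * ε ^ 2)
    refine ⟨N, fun n hn m hm => ?_⟩
    have h4 := hN n hn m hm
    have h5 := hM (v n - v m)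
    have h6 := Complex.re_le_norm (inner ℂ (v n - v m) (X.shifted α (v n - v m)))
    simp only [norm_mul, Complex.norm_ofNat] at h4
    rw [dist_eq_norm]
    refine lt_of_pow_lt_pow_left₀ 2 hε.le ?_
    have h7 := norm_nonneg (inner ℂ (v n - v m) (X.shifted α (v n - v m)))
    refine lt_of_mul_lt_mul_left (?_ : c * ‖v n - v m‖ ^ 2 < c * ε ^ 2) hc.le
    linarith
  obtain ⟨v₀, hv₀⟩ := cauchySeq_tendsto_of_complete hcauchy
  refine ⟨v₀, ?_, hv₀⟩
  have h8 : Tendsto (fun n => (y n : H)) atTop (𝓝 (X.Θ (X.D v₀))) := by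
    simp only [hv]
    exact ((X.continuous_Θ.comp X.D.continuous).tendsto v₀).comp hv₀
  exact tendsto_nhds_unique hy.1 h8

/-- The form domain is `H^{1/2}`: it contains nothing else by `HasForm.tendsto`, and all of it
because `H^{3/2}`, the range of `Θ ∘ D ∘ D`, is dense in it. -/
theorem HasForm.formDomain_eq {α : ℝ} {A : H →ₗ.[ℂ] H} (hA : X.HasForm α A) {c : ℝ} (hc : 0 < c)
    (hM : ∀ u, c * ‖u‖ ^ 2 ≤ (inner ℂ u (X.shifted α u)).re) :
    formDomain A = Set.range fun u => X.Θ (X.D u) := by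
  ext x
  constructor
  · rintro ⟨y, hy⟩
    choose v hv using fun n => hA.subset (y n)
    obtain ⟨v₀, h, -⟩ := hA.tendsto hc hM hy hv
    exact ⟨v₀, h.symm⟩
  · rintro ⟨v, rfl⟩
    obtain ⟨s, hs, hlim⟩ := mem_closure_iff_seq_limit.1 (X.denseRange_D v)
    choose g hg using hs
    have hlim' : Tendsto (fun n => X.D (g n)) atTop (𝓝 v) := by simpa only [hg] using hlim
    refine ⟨fun n => ⟨X.Θ (X.D (X.D (g n))), hA.mem _⟩, ?_, ?_⟩
    · exact ((X.continuous_Θ.comp X.D.continuous).tendsto v).comp hlim'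
    · have h1 : ∀ n : ℕ × ℕ, inner ℂ (((⟨X.Θ (X.D (X.D (g n.1))), hA.mem _⟩ : A.domain) -
          ⟨X.Θ (X.D (X.D (g n.2))), hA.mem _⟩ : A.domain) : H)
          (A (⟨X.Θ (X.D (X.D (g n.1))), hA.mem _⟩ - ⟨X.Θ (X.D (X.D (g n.2))), hA.mem _⟩)) =
          2 * inner ℂ (X.D (g n.1) - X.D (g n.2))
            (X.shifted α (X.D (g n.1) - X.D (g n.2))) := fun n => by
        refine hA.inner_eq _ _ _ _ ?_ ?_ <;> simp
      simp only [h1]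
      have h2 : Tendsto (fun n : ℕ × ℕ => X.D (g n.1) - X.D (g n.2)) atTop (𝓝 0) := by
        rw [← prod_atTop_atTop_eq, ← sub_self v]
        exact (hlim'.comp tendsto_fst).sub (hlim'.comp tendsto_snd)
      have h3 : Continuous fun u : K => (2 : ℂ) * inner ℂ u (X.shifted α u) :=
        continuous_const.mul (continuous_id.inner (X.shifted α).continuous)
      have h4 := (h3.tendsto 0).comp h2
      simpa [Function.comp_def] using h4

theorem HasForm.isFormValue {α : ℝ} {A : H →ₗ.[ℂ] H} (hA : X.HasForm α A) {c : ℝ} (hc : 0 < c)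
    (hM : ∀ u, c * ‖u‖ ^ 2 ≤ (inner ℂ u (X.shifted α u)).re) (u v : K) :
    IsFormValue A (X.Θ (X.D u)) (X.Θ (X.D v)) (2 * inner ℂ u (X.shifted α v)) := by
  have hd := hA.formDomain_eq hc hM
  refine ⟨hd ▸ ⟨u, rfl⟩, hd ▸ ⟨v, rfl⟩, fun y z hy hz => ?_⟩
  choose p hp using fun n => hA.subset (y n)
  choose q hq using fun n => hA.subset (z n)
  obtain ⟨p₀, hp₀, hpl⟩ := hA.tendsto hc hM hy hp
  obtain ⟨q₀, hq₀, hql⟩ := hA.tendsto hc hM hz hq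
  rw [X.D_inj (X.Θ.injective hp₀), X.D_inj (X.Θ.injective hq₀)]
  simp only [fun n => hA.inner_eq (y n) (z n) _ _ (hp n) (hq n)]
  exact (hpl.inner (((X.shifted α).continuous.tendsto q₀).comp hql)).const_mul 2

theorem IsFormValue.unique {A : H →ₗ.[ℂ] H} {x y : H} {c d : ℂ} (h : IsFormValue A x y c)
    (h' : IsFormValue A x y d) : c = d := by
  obtain ⟨⟨u, hu⟩, ⟨v, hv⟩, h1⟩ := h
  exact tendsto_nhds_unique (h1 u v hu hv) (h'.2.2 u v hu hv)

variable (X)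

/-- The graph `{(Θ D u, Θ v) : D W v = 2 (T + α) u}` of `2 W⁻¹ (T + α)` on its maximal domain. -/
def maximalGraph (α : ℝ) : Submodule ℂ (H × H) where
  carrier := {x | ∃ u v, x.1 = X.Θ (X.D u) ∧ x.2 = X.Θ v ∧
    X.D (X.W v) = (2 : ℂ) • X.shifted α u}
  add_mem' := by
    rintro x y ⟨u, v, h1, h2, h3⟩ ⟨u', v', h1', h2', h3'⟩
    exact ⟨u + u', v + v', by simp [h1, h1'], by simp [h2, h2'], by simp [h3, h3']⟩
  zero_mem' := ⟨0, 0, by simp, by simp, by simp⟩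
  smul_mem' := by
    rintro a x ⟨u, v, h1, h2, h3⟩
    refine ⟨a • u, a • v, by simp [h1], by simp [h2], ?_⟩
    rw [map_smul, map_smul, h3, map_smul, smul_comm]

theorem maximalGraph_functional (α : ℝ) : ∀ x ∈ X.maximalGraph α, x.1 = 0 → x.2 = 0 := by
  rintro x ⟨u, v, h1, h2, h3⟩ h0
  have hu : u = 0 := X.D_inj (X.Θ.injective (by rw [← h1, h0]; simp))
  have hv : v = 0 := X.W_bijective.1 (X.D_inj (by rw [h3, hu]; simp))
  rw [h2, hv, map_zero]

/-- The operator `2 W⁻¹ (T + α)` on its maximal domain. -/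
noncomputable def maximalOp (α : ℝ) : H →ₗ.[ℂ] H := (X.maximalGraph α).toLinearPMap

theorem mem_maximalOp_graph {α : ℝ} {x : H × H} : x ∈ (X.maximalOp α).graph ↔
    ∃ u v, x.1 = X.Θ (X.D u) ∧ x.2 = X.Θ v ∧ X.D (X.W v) = (2 : ℂ) • X.shifted α u := by
  unfold maximalOp
  rw [Submodule.toLinearPMap_graph_eq _ (X.maximalGraph_functional α)]
  rfl

/-- The value of `2 W⁻¹ (T + α)` on `H^{3/2}` exists because `T` maps `H^{3/2}` to `H^{1/2}`. -/
theorem mem_maximalOp_graph_of_regular (α : ℝ) (g : K) :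
    ∃ v, X.W v = (2 : ℂ) • (X.S g + (α : ℂ) • X.D g) ∧
      (X.Θ (X.D (X.D g)), X.Θ v) ∈ (X.maximalOp α).graph := by
  obtain ⟨v, hv⟩ := X.W_bijective.2 ((2 : ℂ) • (X.S g + (α : ℂ) • X.D g))
  refine ⟨v, hv, X.mem_maximalOp_graph.2 ⟨X.D g, v, rfl, rfl, ?_⟩⟩
  rw [hv, map_smul, X.shifted_D]

/-- Every restriction of `2 W⁻¹ (T + α)` that is defined on `H^{3/2}` has the form `2 (T + α)`. -/
theorem hasForm_of_le {α : ℝ} {A : H →ₗ.[ℂ] H} (hA : A ≤ X.maximalOp α)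
    (hmem : ∀ g, X.Θ (X.D (X.D g)) ∈ A.domain) : X.HasForm α A := by
  have hg : ∀ x : A.domain, ∃ u v, (x : H) = X.Θ (X.D u) ∧ A x = X.Θ v ∧
      X.D (X.W v) = (2 : ℂ) • X.shifted α u := fun x =>
    X.mem_maximalOp_graph.1 (LinearPMap.le_graph_of_le hA (LinearPMap.mem_graph A x))
  refine ⟨fun x => ?_, hmem, fun x y u v hu hv => ?_⟩
  · obtain ⟨u, -, h, -⟩ := hg x
    exact ⟨u, h⟩
  · obtain ⟨v', q, hv', hq, hW⟩ := hg y
    have : v' = v := X.D_inj (X.Θ.injective (by rw [← hv', hv]))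
    subst this
    rw [hu, hq, X.inner_Θ, X.D_symm, hW, inner_smul_right]

theorem hasForm_maximalOp (α : ℝ) : X.HasForm α (X.maximalOp α) := by
  refine X.hasForm_of_le le_rfl fun g => ?_
  obtain ⟨v, -, hv⟩ := X.mem_maximalOp_graph_of_regular α g
  exact LinearPMap.mem_domain_of_mem_graph hv

/-- The Friedrichs extension of `A` depends only on the closure of its form, which is `2 (T + α)` on
`H^{1/2}`; the operator represented by that form is the maximal one. -/
theorem isFriedrichsExtension_maximalOp {α : ℝ} {A : H →ₗ.[ℂ] H} (hA : X.HasForm α A) {c : ℝ}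
    (hc : 0 < c) (hM : ∀ u, c * ‖u‖ ^ 2 ≤ (inner ℂ u (X.shifted α u)).re) :
    IsFriedrichsExtension A (X.maximalOp α) := by
  intro x z
  rw [hA.formDomain_eq hc hM, X.mem_maximalOp_graph]
  constructor
  · rintro ⟨u, v, hx, hz, h⟩
    refine ⟨⟨u, hx.symm⟩, ?_⟩
    rintro _ ⟨y, rfl⟩
    have h1 := hA.isFormValue hc hM y u
    simp only at hx hz
    rw [hx, hz]
    convert h1 using 1
    rw [X.inner_Θ, X.D_symm, h, inner_smul_right]
  · rintro ⟨⟨u, rfl⟩, h⟩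
    obtain ⟨v, rfl⟩ := X.Θ.surjective z
    refine ⟨u, v, rfl, rfl, ?_⟩
    refine ext_inner_left ℂ fun y => ?_
    have h1 := IsFormValue.unique (h _ ⟨y, rfl⟩) (hA.isFormValue hc hM y u)
    rw [inner_smul_right, ← h1, X.inner_Θ, X.D_symm]

/-- A symmetric operator that is onto is self-adjoint; surjectivity is the Lax–Milgram theorem. -/
theorem isSelfAdjoint_maximalOp [CompleteSpace H] {α : ℝ} {c : ℝ} (hc : 0 < c)
    (hM : ∀ u, c * ‖u‖ ^ 2 ≤ (inner ℂ u (X.shifted α u)).re) :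
    IsSelfAdjoint (X.maximalOp α) := by
  have hB := X.hasForm_maximalOp α
  have hsym := hB.isFormalAdjoint
  have hle := hsym.le_adjoint hB.dense
  have hsurj : ∀ z : H, ∃ x : (X.maximalOp α).domain, X.maximalOp α x = z := by
    intro z
    obtain ⟨v, rfl⟩ := X.Θ.surjective z
    obtain ⟨u, hu⟩ := (bijective_of_coercive hc hM).2 ((2 : ℂ)⁻¹ • X.D (X.W v))
    have h1 : (X.Θ (X.D u), X.Θ v) ∈ (X.maximalOp α).graph :=
      X.mem_maximalOp_graph.2 ⟨u, v, rfl, rfl, by rw [hu, smul_inv_smul₀ two_ne_zero]⟩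
    obtain ⟨x, -, hx⟩ := (LinearPMap.mem_graph_iff _).1 h1
    exact ⟨x, hx⟩
  rw [LinearPMap.isSelfAdjoint_def]
  refine (LinearPMap.eq_of_le_of_domain_eq hle (le_antisymm hle.1 fun y hy => ?_)).symm
  obtain ⟨x, hx⟩ := hsurj ((X.maximalOp α).adjoint ⟨y, hy⟩)
  have h1 : y = x := by
    rw [← sub_eq_zero, ← inner_self_eq_zero (𝕜 := ℂ)]
    obtain ⟨t, ht⟩ := hsurj (y - x)
    nth_rewrite 2 [← ht]
    rw [inner_sub_left, ← hsym x t, hx,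
      LinearPMap.adjoint_isFormalAdjoint hB.dense ⟨y, hy⟩ t, sub_self]
  rw [h1]
  exact x.2

/-- A strictly positive bottom on `H^{3/2}` improves to coercivity in the norm of `H^{1/2}`. -/
theorem shifted_coercive {α : ℝ} {A : H →ₗ.[ℂ] H} (hA : X.HasForm α A) {c₀ : ℝ} (hc₀ : 0 < c₀)
    (hT : ∀ u, c₀ * ‖u‖ ^ 2 ≤ (inner ℂ u (X.T u)).re) (hpos : HasPositiveBottom A) :
    ∃ c : ℝ, 0 < c ∧ ∀ u, c * ‖u‖ ^ 2 ≤ (inner ℂ u (X.shifted α u)).re := by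
  obtain ⟨b, hb, hbot⟩ := hpos
  obtain ⟨w, hw, hW⟩ := X.W_coercive
  set q : K → ℝ := fun v => (inner ℂ v (X.shifted α v)).re with hq
  have hqc : Continuous q :=
    Complex.continuous_re.comp (continuous_id.inner (X.shifted α).continuous)
  have h1 : ∀ v, b * w / 2 * ‖X.D v‖ ^ 2 ≤ q v := by
    have hcl : IsClosed {v | b * w / 2 * ‖X.D v‖ ^ 2 ≤ q v} :=
      isClosed_le (by fun_prop) hqc
    refine fun v => X.denseRange_D.induction_on (p := fun v => b * w / 2 * ‖X.D v‖ ^ 2 ≤ q v) v hcl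
      fun g => ?_
    have h2 := hbot ⟨X.Θ (X.D (X.D g)), hA.mem g⟩
    rw [hA.inner_eq _ _ _ _ rfl rfl] at h2
    simp only [X.norm_Θ_sq] at h2
    have h3 := hW (X.D (X.D g))
    have h4 : b * (w * ‖X.D (X.D g)‖ ^ 2) ≤ b * (inner ℂ (X.D (X.D g)) (X.W (X.D (X.D g)))).re :=
      mul_le_mul_of_nonneg_left h3 hb.le
    have h5 : ((2 : ℂ) * inner ℂ (X.D g) (X.shifted α (X.D g))).re = 2 * q (X.D g) := by
      simp [hq]
    linarith
  have h2 : ∀ v, c₀ * ‖v‖ ^ 2 - |α| * (‖v‖ * ‖X.D v‖) ≤ q v := fun v => by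
    have h3 : q v = (inner ℂ v (X.T v)).re + α * (inner ℂ v (X.D v)).re := by
      change (inner ℂ v (X.T v + (α : ℂ) • X.D v)).re = _
      rw [inner_add_right, inner_smul_right, Complex.add_re, Complex.re_ofReal_mul]
    have h4 : |α * (inner ℂ v (X.D v)).re| ≤ |α| * (‖v‖ * ‖X.D v‖) := by
      rw [abs_mul]
      gcongr
      exact (Complex.abs_re_le_norm _).trans (norm_inner_le_norm _ _)
    linarith [hT v, neg_abs_le (α * (inner ℂ v (X.D v)).re)]
  -- `|α| ‖v‖ ‖D v‖ ≤ (c₀ / 2) ‖v‖² + (α² / (2 c₀)) ‖D v‖²`, and the last term is at most `C q(v)`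
  set C : ℝ := α ^ 2 / (c₀ * (b * w)) with hC
  have hC0 : 0 ≤ C := by positivity
  refine ⟨c₀ / 2 / (1 + C), by positivity, fun v => ?_⟩
  rw [div_mul_eq_mul_div, div_le_iff₀ (by positivity)]
  have h3 : |α| * (‖v‖ * ‖X.D v‖) ≤ c₀ / 2 * ‖v‖ ^ 2 + α ^ 2 / (2 * c₀) * ‖X.D v‖ ^ 2 := by
    have h4 := sq_nonneg (c₀ * ‖v‖ - |α| * ‖X.D v‖)
    have h5 : c₀ / 2 * ‖v‖ ^ 2 + α ^ 2 / (2 * c₀) * ‖X.D v‖ ^ 2 - |α| * (‖v‖ * ‖X.D v‖)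
        = (c₀ * ‖v‖ - |α| * ‖X.D v‖) ^ 2 / (2 * c₀) := by
      rw [← sq_abs α]
      field_simp
      ring
    have h6 : 0 ≤ (c₀ * ‖v‖ - |α| * ‖X.D v‖) ^ 2 / (2 * c₀) := by positivity
    linarith
  have h4 : α ^ 2 / (2 * c₀) * ‖X.D v‖ ^ 2 = C * (b * w / 2 * ‖X.D v‖ ^ 2) := by
    rw [hC]
    field_simp
  have h5 := mul_le_mul_of_nonneg_left (h1 v) hC0
  have h6 := h2 v
  change _ ≤ q v * (1 + C)
  nlinarith

end ChargeModel

noncomputable section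

/-! ### Polar coordinates -/

/-- The unit sphere of `ℝ³`. -/
abbrev Sph : Type := Metric.sphere (0 : R3) 1

/-- The surface measure of the unit sphere. -/
abbrev surf : Measure Sph := (volume : Measure R3).toSphere

/-- The measure `r² dr` on `(0, ∞)`, as a measure on `ℝ`. -/
def radialMeasure : Measure ℝ :=
  (volume.restrict (Set.Ioi 0)).withDensity fun r => ENNReal.ofReal (r ^ 2)

instance : SFinite radialMeasure := by unfold radialMeasure; infer_instance

instance : SigmaFinite radialMeasure := by
  exact SigmaFinite.withDensity_ofReal _

theorem measurePreserving_val_radial :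
    MeasurePreserving (Subtype.val : Set.Ioi (0 : ℝ) → ℝ) (Measure.volumeIoiPow 2)
      radialMeasure := by
  refine ⟨measurable_subtype_coe, ?_⟩
  ext s hs
  rw [Measure.map_apply measurable_subtype_coe hs, Measure.volumeIoiPow,
    withDensity_apply _ (measurable_subtype_coe hs), radialMeasure, withDensity_apply _ hs]
  have he := MeasurableEmbedding.subtype_coe (measurableSet_Ioi (a := (0 : ℝ)))
  have h1 : (volume : Measure ℝ).restrict (Set.Ioi 0) =
      (Measure.comap (Subtype.val : Set.Ioi (0 : ℝ) → ℝ) volume).map Subtype.val := by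
    rw [he.map_comap, Subtype.range_coe]
  rw [h1, he.restrict_map, he.lintegral_map]

/-- Polar coordinates carry the product of the surface measure and `r² dr` to Lebesgue measure. -/
theorem measurePreserving_polar :
    MeasurePreserving (fun z : Sph × ℝ => z.2 • (z.1 : R3)) (surf.prod radialMeasure) volume := by
  have hm : Measurable fun z : Sph × ℝ => z.2 • (z.1 : R3) := by fun_prop
  have h2 : MeasurePreserving (Prod.map id Subtype.val : Sph × Set.Ioi (0 : ℝ) → Sph × ℝ)
      (surf.prod (Measure.volumeIoiPow 2)) (surf.prod radialMeasure) :=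
    (MeasurePreserving.id _).prod measurePreserving_val_radial
  have h0 := (volume : Measure R3).measurePreserving_homeomorphUnitSphereProd
  have hd : Module.finrank ℝ R3 - 1 = 2 := by simp
  rw [hd] at h0
  have h3 : MeasurePreserving (homeomorphUnitSphereProd R3).symm
      (surf.prod (Measure.volumeIoiPow 2)) ((volume : Measure R3).comap Subtype.val) :=
    MeasurePreserving.symm (homeomorphUnitSphereProd R3).toMeasurableEquiv h0
  have h4 : MeasurePreserving (Subtype.val : ({0}ᶜ : Set R3) → R3)
      ((volume : Measure R3).comap Subtype.val) volume := by
    refine ⟨measurable_subtype_coe, ?_⟩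
    rw [(MeasurableEmbedding.subtype_coe (measurableSet_singleton (0 : R3)).compl).map_comap,
      Subtype.range_coe, restrict_compl_singleton]
  refine ⟨hm, ?_⟩
  rw [← h2.map_eq, Measure.map_map hm h2.measurable, ← (h4.comp h3).map_eq]
  congr 1

theorem lintegral_polar {F : R3 → ENNReal} (hF : Measurable F) :
    ∫⁻ p, F p = ∫⁻ r, ∫⁻ ω : Sph, F (r • (ω : R3)) ∂surf ∂radialMeasure := by
  rw [← measurePreserving_polar.lintegral_comp hF, lintegral_prod_symm]
  exact (hF.comp measurePreserving_polar.measurable).aemeasurable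

theorem integral_polar {G : Type*} [NormedAddCommGroup G] [NormedSpace ℝ G] {F : R3 → G}
    (hF : Integrable F) :
    ∫ p, F p = ∫ r, ∫ ω : Sph, F (r • (ω : R3)) ∂surf ∂radialMeasure := by
  have h1 := integral_map measurePreserving_polar.aemeasurable
    (f := F) (by rw [measurePreserving_polar.map_eq]; exact hF.1)
  rw [measurePreserving_polar.map_eq] at h1
  rw [h1]
  exact integral_prod_symm _ ((measurePreserving_polar.integrable_comp hF.1).2 hF)

theorem radialMeasure_Iic : radialMeasure (Set.Iic 0) = 0 := by
  refine withDensity_absolutelyContinuous _ _ ?_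
  have h : Set.Iic (0 : ℝ) ∩ Set.Ioi 0 = ∅ := by ext; simp
  rw [Measure.restrict_apply measurableSet_Iic, h, measure_empty]

theorem ae_radial_pos : ∀ᵐ r ∂radialMeasure, 0 < r := by
  have h : {r : ℝ | ¬0 < r} = Set.Iic 0 := by ext; simp
  rw [ae_iff, h, radialMeasure_Iic]

theorem lintegral_radial {F : ℝ → ENNReal} (hF : Measurable F) :
    ∫⁻ r, F r ∂radialMeasure = ∫⁻ r in Set.Ioi 0, ENNReal.ofReal (r ^ 2) * F r := by
  rw [radialMeasure, lintegral_withDensity_eq_lintegral_mul _ (by fun_prop) hF]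
  rfl

theorem integral_radial {G : Type*} [NormedAddCommGroup G] [NormedSpace ℝ G] (F : ℝ → G) :
    ∫ r, F r ∂radialMeasure = ∫ r in Set.Ioi 0, r ^ 2 • F r := by
  rw [radialMeasure, integral_withDensity_eq_integral_toReal_smul (by fun_prop) (by simp)]
  simp [sq_nonneg]

/-- A property of almost every radius holds at almost every point. -/
theorem ae_norm_of_ae_radial {Q : ℝ → Prop} (h : ∀ᵐ r ∂radialMeasure, Q r) :
    ∀ᵐ p : R3, Q ‖p‖ := by
  obtain ⟨t, ht, hts, h0⟩ := exists_measurable_superset_of_null (ae_iff.1 h)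
  have h1 : (volume : Measure R3) ((fun p => ‖p‖) ⁻¹' t) = 0 := by
    have hm : Measurable fun p : R3 => t.indicator (1 : ℝ → ENNReal) ‖p‖ :=
      (measurable_one.indicator hts).comp measurable_norm
    have h2 := lintegral_polar hm
    have h3 : ∫⁻ p : R3, t.indicator (1 : ℝ → ENNReal) ‖p‖ =
        volume ((fun p : R3 => ‖p‖) ⁻¹' t) := by
      rw [← lintegral_indicator_one (measurable_norm hts)]
      rfl
    rw [← h3, h2]
    refine (lintegral_eq_zero_iff' ?_).2 ?_
    · have h4 : Measurable fun z : ℝ × Sph => z.1 • (z.2 : R3) := by fun_prop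
      exact (hm.comp h4).lintegral_prod_right'.aemeasurable
    · filter_upwards [ae_radial_pos, measure_eq_zero_iff_ae_notMem.1 h0] with r hr hrt
      simp [norm_smul, abs_of_pos hr, hrt]
  refine ae_iff.2 (measure_mono_null (fun p hp => ht ?_) h1)
  exact hp

theorem surf_univ : surf.real Set.univ = 4 * Real.pi := by
  rw [Measure.toSphere_real_apply_univ, volume_ball_R3]
  simp
  ring

end

noncomputable section

/-! ### Gaussian integrals of polynomials -/

open MvPolynomial in
/-- The value at `q ∈ ℝ³` of a polynomial in three variables. -/
def polyEval (Y : MvPolynomial (Fin 3) ℂ) (q : R3) : ℂ := eval (fun i => ((q i : ℝ) : ℂ)) Y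

section PolyEval
variable (Y Z : MvPolynomial (Fin 3) ℂ) (q : R3)

@[simp] theorem polyEval_add : polyEval (Y + Z) q = polyEval Y q + polyEval Z q := by
  simp [polyEval]

@[simp] theorem polyEval_mul : polyEval (Y * Z) q = polyEval Y q * polyEval Z q := by
  simp [polyEval]

@[simp] theorem polyEval_pow (n : ℕ) : polyEval (Y ^ n) q = polyEval Y q ^ n := by
  simp [polyEval]

@[simp] theorem polyEval_smul (c : ℂ) : polyEval (c • Y) q = c * polyEval Y q := by
  simp [polyEval, MvPolynomial.smul_eval]

@[simp] theorem polyEval_zero : polyEval 0 q = 0 := by simp [polyEval]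

@[simp] theorem polyEval_one : polyEval 1 q = 1 := by simp [polyEval]

@[simp] theorem polyEval_C (c : ℂ) : polyEval (MvPolynomial.C c) q = c := by simp [polyEval]

@[simp] theorem polyEval_X (i : Fin 3) : polyEval (MvPolynomial.X i) q = (q i : ℂ) := by
  simp [polyEval]

theorem polyEval_sum {ι : Type*} (s : Finset ι) (f : ι → MvPolynomial (Fin 3) ℂ) :
    polyEval (∑ i ∈ s, f i) q = ∑ i ∈ s, polyEval (f i) q := by
  simp [polyEval]

theorem hasFDerivAt_polyEval : HasFDerivAt (polyEval Y)
    (∑ i, polyEval (MvPolynomial.pderiv i Y) q •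
      (Complex.ofRealCLM.comp (EuclideanSpace.proj i : R3 →L[ℝ] ℝ))) q := by
  induction Y using MvPolynomial.induction_on with
  | C a =>
    have : polyEval (MvPolynomial.C a) = fun _ => a := by ext; simp
    rw [this]
    refine (hasFDerivAt_const (𝕜 := ℝ) a q).congr_fderiv ?_
    ext v
    simp [Fin.sum_univ_three]
  | add p r hp hr =>
    have : polyEval (p + r) = polyEval p + polyEval r := by ext; simp
    rw [this]
    refine (hp.add hr).congr_fderiv ?_
    ext v
    simp [Fin.sum_univ_three]
    ring
  | mul_X p j hp =>
    have : polyEval (p * MvPolynomial.X j) = fun q : R3 => polyEval p q * ((q j : ℝ) : ℂ) := by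
      ext; simp
    rw [this]
    have hj : HasFDerivAt (fun q : R3 => ((q j : ℝ) : ℂ))
        (Complex.ofRealCLM.comp (EuclideanSpace.proj j : R3 →L[ℝ] ℝ)) q :=
      (Complex.ofRealCLM.comp (EuclideanSpace.proj j : R3 →L[ℝ] ℝ)).hasFDerivAt
    refine (hp.mul hj).congr_fderiv ?_
    ext v
    simp only [Derivation.leibniz, MvPolynomial.pderiv_X, polyEval_add, smul_eq_mul, polyEval_mul,
      polyEval_X, Fin.sum_univ_three]
    fin_cases j <;> simp <;> ring

theorem continuous_polyEval : Continuous (polyEval Y) :=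
  continuous_iff_continuousAt.2 fun q => (hasFDerivAt_polyEval Y q).continuousAt

/-- Polynomials grow at most exponentially; the bound is stable under products with a variable. -/
theorem exists_polyEval_le : ∃ (c : ℝ) (N : ℕ), 0 ≤ c ∧
    ∀ q, ‖polyEval Y q‖ ≤ c * Real.exp (N * ‖q‖) := by
  induction Y using MvPolynomial.induction_on with
  | C a => exact ⟨‖a‖, 0, norm_nonneg _, fun q => by simp⟩
  | add p r hp hr =>
    obtain ⟨c, N, hc, h⟩ := hp
    obtain ⟨c', N', hc', h'⟩ := hr
    refine ⟨c + c', max N N', by positivity, fun q => ?_⟩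
    rw [polyEval_add, add_mul]
    refine (norm_add_le _ _).trans (add_le_add ((h q).trans ?_) ((h' q).trans ?_)) <;> gcongr <;>
      simp
  | mul_X p j hp =>
    obtain ⟨c, N, hc, h⟩ := hp
    refine ⟨c, N + 1, hc, fun q => ?_⟩
    have h1 : ‖q j‖ ≤ Real.exp ‖q‖ :=
      (PiLp.norm_apply_le q j).trans ((lt_add_one _).le.trans (Real.add_one_le_exp _))
    rw [polyEval_mul, norm_mul, polyEval_X, Complex.norm_real]
    push_cast
    rw [add_mul, one_mul, Real.exp_add, ← mul_assoc]
    exact mul_le_mul (h q) h1 (norm_nonneg _) (by positivity)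

/-- The Gaussian weight `e^{-|q|²/2}`. -/
def gaussWeight (q : R3) : ℝ := Real.exp (-‖q‖ ^ 2 / 2)

theorem integrable_exp_neg_sq : Integrable (fun q : R3 => Real.exp (-(1 / 4) * ‖q‖ ^ 2)) := by
  rw [integrable_fun_norm_addHaar volume (f := fun r : ℝ => Real.exp (-(1 / 4) * r ^ 2))]
  have := (integrable_rpow_mul_exp_neg_mul_sq (b := 1 / 4) (by norm_num) (s := 2)
    (by norm_num)).integrableOn (s := Set.Ioi 0)
  simpa using this

theorem integrable_polyEval_gauss :
    Integrable fun q : R3 => polyEval Y q * (gaussWeight q : ℂ) := by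
  obtain ⟨c, N, hc, h⟩ := exists_polyEval_le Y
  refine (integrable_exp_neg_sq.const_mul (c * Real.exp (N ^ 2))).mono' ?_ (.of_forall fun q => ?_)
  · have : Continuous gaussWeight := by unfold gaussWeight; fun_prop
    exact ((continuous_polyEval Y).mul (Complex.continuous_ofReal.comp this)).aestronglyMeasurable
  · rw [norm_mul, Complex.norm_real, gaussWeight, Real.norm_of_nonneg (Real.exp_pos _).le]
    calc _ ≤ c * Real.exp (N * ‖q‖) * Real.exp (-‖q‖ ^ 2 / 2) := by gcongr; exact h q
      _ = c * Real.exp (N * ‖q‖ + -‖q‖ ^ 2 / 2) := by rw [mul_assoc, Real.exp_add]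
      _ ≤ c * Real.exp (N ^ 2 + -(1 / 4) * ‖q‖ ^ 2) := by
        refine mul_le_mul_of_nonneg_left (Real.exp_le_exp.2 ?_) hc
        linarith [sq_nonneg ((N : ℝ) - ‖q‖ / 2),
          (by ring : ((N : ℝ) - ‖q‖ / 2) ^ 2 = N ^ 2 - N * ‖q‖ + ‖q‖ ^ 2 / 4)]
      _ = _ := by rw [Real.exp_add, mul_assoc]

end PolyEval

/-- The Gaussian integral `∫ Y(q) e^{-|q|²/2} dq` as a linear functional on polynomials. -/
def gaussInt : MvPolynomial (Fin 3) ℂ →ₗ[ℂ] ℂ where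
  toFun Y := ∫ q : R3, polyEval Y q * (gaussWeight q : ℂ)
  map_add' Y Z := by
    rw [← integral_add (integrable_polyEval_gauss Y) (integrable_polyEval_gauss Z)]
    simp [add_mul]
  map_smul' c Y := by
    rw [RingHom.id_apply, smul_eq_mul, ← integral_const_mul]
    simp [mul_assoc]

/-- Gaussian integration by parts. -/
theorem gaussInt_X_mul (Y : MvPolynomial (Fin 3) ℂ) (i : Fin 3) :
    gaussInt (MvPolynomial.X i * Y) = gaussInt (MvPolynomial.pderiv i Y) := by
  set v : R3 := EuclideanSpace.single i 1 with hv
  have hg : ∀ q : R3, HasFDerivAt (fun q : R3 => (gaussWeight q : ℂ))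
      (Complex.ofRealCLM.comp (gaussWeight q • (-(innerSL ℝ q)))) q := fun q => by
    have h1 : HasFDerivAt (fun q : R3 => -‖q‖ ^ 2 / 2) (-(innerSL ℝ q)) q := by
      have h2 := ((hasStrictFDerivAt_norm_sq q).hasFDerivAt.neg).mul_const (2⁻¹ : ℝ)
      refine (h2.congr_fderiv ?_).congr_of_eventuallyEq (.of_forall fun x => ?_)
      · ext w; simp
      · simp [div_eq_mul_inv]
    exact Complex.ofRealCLM.hasFDerivAt.comp q h1.exp
  have hF : ∀ q, fderiv ℝ (polyEval Y) q v = polyEval (MvPolynomial.pderiv i Y) q := fun q => by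
    rw [(hasFDerivAt_polyEval Y q).fderiv]
    simp [hv, apply_ite Complex.ofReal]
  have hG : ∀ q : R3, polyEval Y q * fderiv ℝ (fun q : R3 => (gaussWeight q : ℂ)) q v =
      -(polyEval (MvPolynomial.X i * Y) q * (gaussWeight q : ℂ)) := fun q => by
    rw [(hg q).fderiv]
    simp [hv, EuclideanSpace.inner_single_right]
    ring
  have h := integral_mul_fderiv_eq_neg_fderiv_mul_of_integrable (μ := (volume : Measure R3))
    (f := polyEval Y) (g := fun q : R3 => (gaussWeight q : ℂ)) (v := v)
    (by simp only [hF]; exact integrable_polyEval_gauss _)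
    (by simp only [hG]; exact (integrable_polyEval_gauss _).neg)
    (integrable_polyEval_gauss _) (fun q _ => (hasFDerivAt_polyEval Y q).differentiableAt)
    (fun q _ => (hg q).differentiableAt)
  simp only [hF, hG] at h
  rw [integral_neg] at h
  exact neg_injective h

end

noncomputable section

/-! ### Legendre moments and the Funk–Hecke formula -/

/-- The moments `½ ∫_{-1}^{1} tⁿ P_ℓ(t) dt` of the Legendre polynomials, given by the recursion
`(n + ℓ + 1) a(n, ℓ) = n a(n - 1, ℓ - 1)`. -/
def legendreMoment : ℕ → ℕ → ℝ
  | n, 0 => if Even n then 1 / ((n : ℝ) + 1) else 0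
  | 0, _ + 1 => 0
  | n + 1, l + 1 => ((n : ℝ) + 1) / (n + l + 3) * legendreMoment n l

theorem legendreMoment_zero_right (n : ℕ) :
    legendreMoment n 0 = if Even n then 1 / ((n : ℝ) + 1) else 0 := by
  cases n <;> simp [legendreMoment]

theorem legendreMoment_zero_succ (l : ℕ) : legendreMoment 0 (l + 1) = 0 := by
  simp [legendreMoment]

theorem legendreMoment_succ_succ (n l : ℕ) :
    legendreMoment (n + 1) (l + 1) = ((n : ℝ) + 1) / (n + l + 3) * legendreMoment n l := by
  simp [legendreMoment]

theorem legendreMoment_shift (k m : ℕ) :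
    ((m : ℝ) + 1 - k) * legendreMoment (m + 1) k = (m + 1) * legendreMoment m (k + 1) := by
  induction k generalizing m with
  | zero =>
    rcases m with _ | j
    · rw [legendreMoment_zero_right, legendreMoment_zero_succ]
      simp
    · rw [legendreMoment_zero_right, legendreMoment_succ_succ, legendreMoment_zero_right]
      have h : Even (j + 1 + 1) ↔ Even j := by simp [Nat.even_add_one]
      simp only [h]
      split_ifs
      · push_cast
        field_simp
        ring
      · simp
  | succ k ih =>
    rcases m with _ | j
    · rw [legendreMoment_succ_succ, legendreMoment_zero_succ]
      rcases k with _ | k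
      · simp
      · rw [legendreMoment_zero_succ]; simp
    · rw [legendreMoment_succ_succ, legendreMoment_succ_succ]
      have h := ih j
      push_cast at h ⊢
      have e : ((j : ℝ) + (k + 1) + 3) = j + 1 + k + 3 := by ring
      rw [e]
      calc _ = ((j : ℝ) + 1 + 1) / (j + 1 + k + 3) * ((j + 1 - k) * legendreMoment (j + 1) k) := by
            ring
        _ = _ := by rw [h]; ring

/-- The recursion that Gaussian integration by parts yields for the moments. -/
theorem legendreMoment_rec (m k : ℕ) :
    ((m : ℝ) + k + 4) * legendreMoment (m + 2) (k + 1) =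
      (k + 1) * legendreMoment (m + 1) k + (m + 1) * legendreMoment m (k + 1) := by
  rw [← legendreMoment_shift, legendreMoment_succ_succ]
  have e : (((m + 1 : ℕ) : ℝ) + k + 3) = m + k + 4 := by push_cast; ring
  have h : ((m : ℝ) + k + 4) ≠ 0 := by positivity
  rw [e]
  field_simp
  push_cast
  ring

theorem legendreMoment_nonneg (n l : ℕ) : 0 ≤ legendreMoment n l := by
  induction l generalizing n with
  | zero => rw [legendreMoment_zero_right]; split_ifs <;> positivity
  | succ l ih =>
    rcases n with _ | n
    · rw [legendreMoment_zero_succ]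
    · rw [legendreMoment_succ_succ]
      exact mul_nonneg (by positivity) (ih n)

theorem legendreMoment_le (n l : ℕ) : legendreMoment n (l + 1) ≤ 1 / (n + 2) := by
  induction l generalizing n with
  | zero =>
    rcases n with _ | n
    · rw [legendreMoment_zero_succ]; positivity
    · rw [legendreMoment_succ_succ, legendreMoment_zero_right]
      split_ifs
      · push_cast
        apply le_of_eq
        field_simp
        ring
      · rw [mul_zero]; positivity
  | succ l ih =>
    rcases n with _ | n
    · rw [legendreMoment_zero_succ]; positivity
    · rw [legendreMoment_succ_succ]
      refine (mul_le_mul_of_nonneg_left (ih n) (by positivity)).trans ?_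
      rw [div_mul_div_comm, div_le_div_iff₀ (by positivity) (by positivity)]
      push_cast
      have hn : (0 : ℝ) ≤ n := by positivity
      have hl : (0 : ℝ) ≤ l := by positivity
      nlinarith [mul_nonneg hn hl]

theorem legendreMoment_eq_zero {n l : ℕ} (h : ¬Even (n + l)) : legendreMoment n l = 0 := by
  induction l generalizing n with
  | zero => rw [legendreMoment_zero_right, if_neg (by simpa using h)]
  | succ l ih =>
    rcases n with _ | n
    · rw [legendreMoment_zero_succ]
    · rw [legendreMoment_succ_succ, ih, mul_zero]
      intro h'
      apply h
      have : n + 1 + (l + 1) = n + l + 2 := by ring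
      rw [this]
      exact h'.add even_two

/-- The Gaussian moments `∫_0^∞ rᴺ e^{-r²/2} dr`. -/
def radialMoment (N : ℕ) : ℝ := ∫ r in Set.Ioi (0 : ℝ), r ^ N * Real.exp (-r ^ 2 / 2)

theorem radialMoment_eq (N : ℕ) : radialMoment N =
    (1 / 2 : ℝ) ^ (-((N : ℝ) + 1) / 2) * (1 / 2) * Real.Gamma (((N : ℝ) + 1) / 2) := by
  have h := integral_rpow_mul_exp_neg_mul_rpow (p := 2) (q := N) (b := 1 / 2) (by norm_num)
    (by linarith [(Nat.cast_nonneg N : (0 : ℝ) ≤ N)]) (by norm_num)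
  rw [← h, radialMoment]
  refine setIntegral_congr_fun measurableSet_Ioi fun r hr => ?_
  simp only [Real.rpow_natCast, Real.rpow_two]
  congr 2
  ring

theorem radialMoment_pos (N : ℕ) : 0 < radialMoment N := by
  rw [radialMoment_eq]
  have := Real.Gamma_pos_of_pos (s := ((N : ℝ) + 1) / 2) (by positivity)
  positivity

theorem radialMoment_add_two (N : ℕ) : radialMoment (N + 2) = (N + 1) * radialMoment N := by
  rw [radialMoment_eq, radialMoment_eq]
  have e1 : (((N + 2 : ℕ) : ℝ) + 1) / 2 = ((N : ℝ) + 1) / 2 + 1 := by push_cast; ring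
  have e2 : -(((N + 2 : ℕ) : ℝ) + 1) / 2 = -((N : ℝ) + 1) / 2 + -1 := by push_cast; ring
  rw [e1, e2, Real.Gamma_add_one (by positivity), Real.rpow_add (by norm_num), Real.rpow_neg_one]
  ring

theorem polyEval_smul_arg {Y : MvPolynomial (Fin 3) ℂ} {N : ℕ} (hY : Y.IsHomogeneous N) (r : ℝ)
    (q : R3) : polyEval Y (r • q) = (r : ℂ) ^ N * polyEval Y q := by
  unfold polyEval
  rw [MvPolynomial.eval_eq', MvPolynomial.eval_eq', Finset.mul_sum]
  refine Finset.sum_congr rfl fun d hd => ?_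
  have h : d 0 + d 1 + d 2 = N := by
    have := hY (MvPolynomial.mem_support_iff.1 hd)
    simpa [Finsupp.weight_apply, Finsupp.sum_fintype, Fin.sum_univ_three] using this
  simp only [Fin.prod_univ_three, PiLp.smul_apply, smul_eq_mul]
  rw [← h]
  push_cast
  ring

/-- Gaussian integrals of homogeneous polynomials are multiples of their spherical means, so that
integration by parts on `ℝ³` gives identities on the sphere. -/
theorem gaussInt_eq_sphere {Y : MvPolynomial (Fin 3) ℂ} {N : ℕ} (hY : Y.IsHomogeneous N) :
    gaussInt Y = radialMoment (N + 2) * ∫ ω : Sph, polyEval Y ω ∂surf := by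
  change ∫ q : R3, polyEval Y q * (gaussWeight q : ℂ) = _
  rw [integral_polar (integrable_polyEval_gauss Y), integral_radial, radialMoment,
    ← integral_complex_ofReal, ← integral_mul_const]
  refine setIntegral_congr_fun measurableSet_Ioi fun r hr => ?_
  have h : ∀ ω : Sph, polyEval Y (r • (ω : R3)) * (gaussWeight (r • (ω : R3)) : ℂ) =
      ((r : ℂ) ^ N * Real.exp (-r ^ 2 / 2)) * polyEval Y ω := fun ω => by
    rw [polyEval_smul_arg hY, gaussWeight, norm_smul]
    simp
    ring
  simp only [h, integral_const_mul, Complex.real_smul]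
  push_cast
  ring

open MvPolynomial in
/-- The linear form `q ↦ η · q`. -/
def linForm (η : R3) : MvPolynomial (Fin 3) ℂ := ∑ i, C ((η i : ℝ) : ℂ) * X i

theorem polyEval_linForm (η q : R3) : polyEval (linForm η) q = (inner ℝ η q : ℝ) := by
  rw [linForm, polyEval_sum, PiLp.inner_apply]
  simp [mul_comm]

theorem linForm_isHomogeneous (η : R3) : (linForm η).IsHomogeneous 1 := by
  refine MvPolynomial.IsHomogeneous.sum _ _ _ fun i _ => ?_
  simpa using (MvPolynomial.isHomogeneous_C (Fin 3) ((η i : ℝ) : ℂ)).mul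
    (MvPolynomial.isHomogeneous_X ℂ i)

open MvPolynomial in
/-- The directional derivative `η · ∇` of a polynomial. -/
def dirDeriv (η : R3) : MvPolynomial (Fin 3) ℂ →ₗ[ℂ] MvPolynomial (Fin 3) ℂ :=
  ∑ i, ((η i : ℝ) : ℂ) • (pderiv i).toLinearMap

theorem dirDeriv_apply (η : R3) (Y : MvPolynomial (Fin 3) ℂ) :
    dirDeriv η Y = ∑ i, ((η i : ℝ) : ℂ) • MvPolynomial.pderiv i Y := by
  simp [dirDeriv]

/-- Directional derivatives lower the degree of harmonic polynomials and preserve harmonicity. -/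
theorem dirDeriv_mem {η : R3} {l : ℕ} {Y : MvPolynomial (Fin 3) ℂ}
    (hY : Y ∈ harmonicPolys (l + 1)) :
    dirDeriv η Y ∈ harmonicPolys l := by
  obtain ⟨h1, h2⟩ := hY
  refine ⟨?_, ?_⟩
  · rw [dirDeriv_apply]
    refine MvPolynomial.IsHomogeneous.sum _ _ _ fun i _ => ?_
    exact (MvPolynomial.homogeneousSubmodule (Fin 3) ℂ l).smul_mem _ (h1.pderiv)
  · have hc : ∀ i j : Fin 3, ∀ p : MvPolynomial (Fin 3) ℂ,
        MvPolynomial.pderiv i (MvPolynomial.pderiv j p) =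
        MvPolynomial.pderiv j (MvPolynomial.pderiv i p) := fun i j p => by
      induction p using MvPolynomial.induction_on with
      | C a => simp
      | add p q hp hq => simp only [map_add, hp, hq]
      | mul_X p k hp =>
        simp only [Derivation.leibniz, map_add, hp, smul_eq_mul, MvPolynomial.pderiv_X]
        fin_cases i <;> fin_cases j <;> fin_cases k <;> simp <;> ring
    have h3 : ∀ j : Fin 3, ∑ i : Fin 3, MvPolynomial.pderiv i (MvPolynomial.pderiv i
        (MvPolynomial.pderiv j Y)) = 0 := fun j => by
      simp only [hc _ j]
      rw [← map_sum, h2, map_zero]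
    simp only [dirDeriv_apply, map_sum, Derivation.map_smul]
    rw [Finset.sum_comm]
    simp only [← Finset.smul_sum, h3, smul_zero, Finset.sum_const_zero]

/-- Euler's identity. -/
theorem polyEval_dirDeriv {η : R3} {N : ℕ} {Y : MvPolynomial (Fin 3) ℂ} (hY : Y.IsHomogeneous N) :
    polyEval (dirDeriv η Y) η = N * polyEval Y η := by
  have h := congrArg (fun Z => polyEval Z η) hY.sum_X_mul_pderiv
  simp only [polyEval_sum, polyEval_mul, polyEval_X] at h
  rw [dirDeriv_apply, polyEval_sum]
  simp only [polyEval_smul]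
  rw [h, ← Nat.cast_smul_eq_nsmul ℂ, polyEval_smul]

/-- By Euler's identity and integration by parts, `(l + 1) ∫ Y e^{-|q|²/2}` is
`∫ (Δ Y) e^{-|q|²/2}`. -/
theorem gaussInt_harmonic {l : ℕ} {Y : MvPolynomial (Fin 3) ℂ} (hY : Y ∈ harmonicPolys (l + 1)) :
    gaussInt Y = 0 := by
  have h := congrArg gaussInt hY.1.sum_X_mul_pderiv
  simp only [map_sum, gaussInt_X_mul] at h
  rw [← map_sum, hY.2, map_zero, map_nsmul] at h
  exact (smul_eq_zero.1 h.symm).resolve_left (by simp)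

/-- Integration by parts in the direction `η`, applied to one factor `η · q`. -/
theorem gaussInt_mul_linForm {η : R3} (hη : ‖η‖ = 1) (Y : MvPolynomial (Fin 3) ℂ) (n : ℕ) :
    gaussInt (Y * linForm η ^ (n + 1)) =
      gaussInt (dirDeriv η Y * linForm η ^ n) + n * gaussInt (Y * linForm η ^ (n - 1)) := by
  have hL : ∀ i, MvPolynomial.pderiv i (linForm η) = MvPolynomial.C ((η i : ℝ) : ℂ) := fun i => by
    rw [linForm, map_sum]
    simp [Derivation.leibniz, MvPolynomial.pderiv_X, Pi.single_apply]
  have hsq : ∑ i, ((η i : ℝ) : ℂ) * ((η i : ℝ) : ℂ) = 1 := by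
    have h1 : ∑ i, η i * η i = 1 := by
      have := EuclideanSpace.real_norm_sq_eq η
      rw [hη] at this
      simpa [sq] using this.symm
    exact_mod_cast congrArg Complex.ofReal h1
  have h1 : Y * linForm η ^ (n + 1) =
      ∑ i, ((η i : ℝ) : ℂ) • (MvPolynomial.X i * (Y * linForm η ^ n)) := by
    rw [pow_succ]
    nth_rewrite 2 [linForm]
    rw [Finset.mul_sum, Finset.mul_sum]
    refine Finset.sum_congr rfl fun i _ => ?_
    rw [MvPolynomial.smul_eq_C_mul]
    ring
  have h2 : ∀ i, MvPolynomial.pderiv i (Y * linForm η ^ n) =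
      MvPolynomial.pderiv i Y * linForm η ^ n +
        ((n : ℂ) * ((η i : ℝ) : ℂ)) • (Y * linForm η ^ (n - 1)) := fun i => by
    rw [Derivation.leibniz, Derivation.leibniz_pow, hL]
    simp only [smul_eq_mul, nsmul_eq_mul, MvPolynomial.smul_eq_C_mul, map_mul, map_natCast]
    ring
  rw [h1, map_sum]
  simp only [map_smul, gaussInt_X_mul, h2, map_add, smul_eq_mul, mul_add]
  rw [Finset.sum_add_distrib]
  congr 1
  · rw [dirDeriv_apply, Finset.sum_mul, map_sum]
    refine Finset.sum_congr rfl fun i _ => ?_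
    rw [smul_mul_assoc, map_smul, smul_eq_mul]
  · rw [← one_mul ((n : ℂ) * _), ← hsq, Finset.sum_mul]
    refine Finset.sum_congr rfl fun i _ => ?_
    ring

/-- The Funk–Hecke formula for powers, integrated against a Gaussian. The induction on `n` lowers
the degree `l` by a directional derivative and the power of `η · q` by two. -/
theorem gaussInt_funkHecke {η : R3} (hη : ‖η‖ = 1) (n : ℕ) :
    ∀ (l : ℕ) (Y : MvPolynomial (Fin 3) ℂ), Y ∈ harmonicPolys l →
    gaussInt (Y * linForm η ^ n) =
      (4 * Real.pi * radialMoment (n + l + 2) * legendreMoment n l : ℝ) * polyEval Y η := by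
  induction n using Nat.strong_induction_on with
  | _ n ih =>
    intro l Y hY
    have hzero : ∀ l Y, Y ∈ harmonicPolys l → gaussInt Y =
        (4 * Real.pi * radialMoment (0 + l + 2) * legendreMoment 0 l : ℝ) * polyEval Y η := by
      intro l Y hY
      rcases l with _ | l
      · obtain ⟨c, rfl⟩ : ∃ c, Y = MvPolynomial.C c :=
          ⟨_, MvPolynomial.totalDegree_eq_zero_iff_eq_C.1 (Nat.le_zero.1 hY.1.totalDegree_le)⟩
        rw [gaussInt_eq_sphere hY.1]
        simp only [polyEval_C, integral_const, surf_univ, legendreMoment_zero_right]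
        simp
        ring
      · rw [gaussInt_harmonic hY, legendreMoment_zero_succ]
        simp
    rcases n with _ | _ | m
    · simpa using hzero l Y hY
    · rw [gaussInt_mul_linForm hη]
      rcases l with _ | l
      · obtain ⟨c, rfl⟩ : ∃ c, Y = MvPolynomial.C c :=
          ⟨_, MvPolynomial.totalDegree_eq_zero_iff_eq_C.1 (Nat.le_zero.1 hY.1.totalDegree_le)⟩
        simp [dirDeriv_apply, legendreMoment_zero_right]
      · have h := hzero l _ (dirDeriv_mem (η := η) hY)
        rw [polyEval_dirDeriv hY.1] at h
        simp only [pow_zero, mul_one, Nat.cast_zero, zero_mul, add_zero, h]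
        rw [legendreMoment_succ_succ]
        rcases l with _ | l
        · have : radialMoment (0 + 1 + (0 + 1) + 2) = 3 * radialMoment 2 := by
            rw [radialMoment_add_two]; norm_num
          rw [this]
          push_cast
          ring
        · rw [legendreMoment_zero_succ]
          simp
    · rw [gaussInt_mul_linForm hη]
      have e : m + 1 + 1 - 1 = m + 1 := rfl
      have h2 := ih m (by omega) l Y hY
      have hR : radialMoment (m + 1 + 1 + l + 2) = (m + l + 3) * radialMoment (m + l + 2) := by
        rw [show m + 1 + 1 + l + 2 = (m + l + 2) + 2 by ring, radialMoment_add_two]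
        push_cast
        ring
      rw [Nat.add_sub_cancel, h2, hR]
      rcases l with _ | l
      · obtain ⟨c, rfl⟩ : ∃ c, Y = MvPolynomial.C c :=
          ⟨_, MvPolynomial.totalDegree_eq_zero_iff_eq_C.1 (Nat.le_zero.1 hY.1.totalDegree_le)⟩
        have h3 : dirDeriv η (MvPolynomial.C c) = 0 := by simp [dirDeriv_apply]
        rw [h3, zero_mul, map_zero, zero_add, legendreMoment_zero_right, legendreMoment_zero_right]
        have h : Even (m + 1 + 1) ↔ Even m := by simp [Nat.even_add_one]
        simp only [h]
        split_ifs
        · push_cast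
          have h3 : (m : ℂ) + 1 ≠ 0 := by exact_mod_cast Nat.succ_ne_zero m
          have h4 : (m : ℂ) + 1 + 1 + 1 ≠ 0 := by exact_mod_cast Nat.succ_ne_zero (m + 2)
          field_simp
          ring
        · simp
      · have h1 := ih (m + 1) (by omega) l _ (dirDeriv_mem (η := η) hY)
        rw [polyEval_dirDeriv hY.1, show m + 1 + l + 2 = m + (l + 1) + 2 by ring] at h1
        rw [h1]
        have h3 := congrArg Complex.ofReal (legendreMoment_rec m l)
        push_cast at h3 ⊢
        linear_combination
          (-(4 * (Real.pi : ℂ) * radialMoment (m + (l + 1) + 2) * polyEval Y η)) * h3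

/-- The Funk–Hecke formula for powers. -/
theorem funkHecke_pow {η : R3} (hη : ‖η‖ = 1) (n : ℕ) {l : ℕ} {Y : MvPolynomial (Fin 3) ℂ}
    (hY : Y ∈ harmonicPolys l) :
    ∫ ω : Sph, polyEval Y ω * ((inner ℝ η (ω : R3) : ℝ) : ℂ) ^ n ∂surf =
      (4 * Real.pi * legendreMoment n l : ℝ) * polyEval Y η := by
  have hhom : (Y * linForm η ^ n).IsHomogeneous (n + l) := by
    have := hY.1.mul ((linForm_isHomogeneous η).pow n)
    rwa [one_mul, add_comm] at this
  have h := gaussInt_funkHecke hη n l Y hY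
  rw [gaussInt_eq_sphere hhom] at h
  simp only [polyEval_mul, polyEval_pow, polyEval_linForm] at h
  have h0 : (radialMoment (n + l + 2) : ℂ) ≠ 0 :=
    Complex.ofReal_ne_zero.2 (radialMoment_pos _).ne'
  refine mul_left_cancel₀ h0 ?_
  rw [h]
  push_cast
  ring

end

noncomputable section

/-! ### Zonal series -/

/-- If `φ(t) = ∑ cₙ (x t)ⁿ`, then `4π` times this sum is the eigenvalue on the spherical harmonics
of degree `l` of the integral operator on the sphere with kernel `φ(η · ω)`. -/
def zonal (c : ℕ → ℝ) (l : ℕ) (x : ℝ) : ℝ := ∑' n, c n * legendreMoment n l * x ^ n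

/-- The coefficients of `1 / (1 + y)`. -/
def coeffT (n : ℕ) : ℝ := (-1) ^ n

/-- The coefficients of `1 / (1 + y)²`. -/
def coeffW (n : ℕ) : ℝ := (-1) ^ n * (n + 1)

theorem hasSum_coeffT {y : ℝ} (hy : |y| < 1) : HasSum (fun n => coeffT n * y ^ n) (1 + y)⁻¹ := by
  have h := hasSum_geometric_of_abs_lt_one (r := -y) (by rwa [abs_neg])
  simp only [neg_pow y, sub_neg_eq_add] at h
  exact h

theorem hasSum_coeffW {y : ℝ} (hy : |y| < 1) :
    HasSum (fun n => coeffW n * y ^ n) ((1 + y) ^ 2)⁻¹ := by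
  have h := hasSum_choose_mul_geometric_of_norm_lt_one 1 (r := -y)
    (by rwa [norm_neg, Real.norm_eq_abs])
  rw [sub_neg_eq_add, one_add_one_eq_two, one_div] at h
  have e : (fun n => coeffW n * y ^ n) = fun n => ((n + 1).choose 1 : ℝ) * (-y) ^ n := by
    funext n
    rw [coeffW, neg_pow y, Nat.choose_one_right]
    push_cast
    ring
  rw [e]
  exact h

theorem summable_coeff_mul {c : ℕ → ℝ} (hc : ∀ n, |c n| ≤ n + 1) {x : ℝ} (hx : |x| < 1) :
    Summable fun n => |c n| * |x| ^ n := by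
  have h := (hasSum_choose_mul_geometric_of_norm_lt_one 1 (r := |x|)
    (by rwa [Real.norm_eq_abs, abs_abs])).summable
  refine h.of_nonneg_of_le (fun n => by positivity) fun n => ?_
  gcongr
  simpa using hc n

theorem exists_polyEval_le_sphere (Y : MvPolynomial (Fin 3) ℂ) :
    ∃ B : ℝ, ∀ ω : Sph, ‖polyEval Y ω‖ ≤ B := by
  obtain ⟨c, N, -, h⟩ := exists_polyEval_le Y
  exact ⟨c * Real.exp (N * 1), fun ω => by simpa using h ω⟩

theorem continuous_polyEval_sphere (Y : MvPolynomial (Fin 3) ℂ) :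
    Continuous fun ω : Sph => polyEval Y ω :=
  (continuous_polyEval Y).comp continuous_subtype_val

theorem integrable_of_continuous_sphere {f : Sph → ℂ} (hf : Continuous f) : Integrable f surf := by
  have : CompactSpace Sph := isCompact_iff_compactSpace.1 (isCompact_sphere 0 1)
  obtain ⟨B, hB⟩ := (isCompact_range hf).isBounded.exists_norm_le
  exact Integrable.of_bound hf.aestronglyMeasurable B (.of_forall fun ω => hB _ ⟨ω, rfl⟩)

theorem abs_inner_sphere_le {η : R3} (hη : ‖η‖ = 1) (ω : Sph) : |inner ℝ η (ω : R3)| ≤ 1 := by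
  refine (abs_real_inner_le_norm _ _).trans ?_
  simp [hη]

/-- The Funk–Hecke formula for kernels given by a power series. -/
theorem funkHecke {η : R3} (hη : ‖η‖ = 1) {l : ℕ} {Y : MvPolynomial (Fin 3) ℂ}
    (hY : Y ∈ harmonicPolys l) {c : ℕ → ℝ} (hc : ∀ n, |c n| ≤ n + 1) {x : ℝ} (hx : |x| < 1)
    {φ : ℝ → ℝ} (hφ : ∀ y, |y| < 1 → HasSum (fun n => c n * y ^ n) (φ y)) :
    ∫ ω : Sph, polyEval Y ω * (φ (x * inner ℝ η (ω : R3)) : ℂ) ∂surf =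
      (4 * Real.pi * zonal c l x : ℝ) * polyEval Y η := by
  obtain ⟨B, hB⟩ := exists_polyEval_le_sphere Y
  set F : ℕ → Sph → ℂ := fun n ω =>
    ((c n * x ^ n : ℝ) : ℂ) * (polyEval Y ω * ((inner ℝ η (ω : R3) : ℝ) : ℂ) ^ n) with hF
  have hFc : ∀ n, Continuous (F n) := fun n => by
    have h1 := continuous_polyEval_sphere Y
    have h2 : Continuous fun ω : Sph => ((inner ℝ η (ω : R3) : ℝ) : ℂ) := by fun_prop
    fun_prop
  have hFle : ∀ n ω, ‖F n ω‖ ≤ |c n| * |x| ^ n * B := fun n ω => by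
    rw [hF]
    simp only [norm_mul, norm_pow, Complex.norm_real, Real.norm_eq_abs]
    have h1 := pow_le_one₀ (n := n) (abs_nonneg _) (abs_inner_sphere_le hη ω)
    have h2 := mul_le_mul (hB ω) h1 (by positivity) ((norm_nonneg _).trans (hB ω))
    rw [mul_one] at h2
    gcongr
  have hs := hasSum_integral_of_summable_integral_norm (μ := surf) (F := F)
    (fun n => integrable_of_continuous_sphere (hFc n)) (by
      refine ((summable_coeff_mul hc hx).mul_right (B * surf.real Set.univ)).of_nonneg_of_le
        (fun n => integral_nonneg fun ω => norm_nonneg _) fun n => ?_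
      calc ∫ ω, ‖F n ω‖ ∂surf ≤ ∫ _, |c n| * |x| ^ n * B ∂surf :=
            integral_mono (integrable_of_continuous_sphere (hFc n)).norm (integrable_const _)
              (hFle n)
        _ = _ := by rw [integral_const, smul_eq_mul]; ring)
  have h1 : ∀ ω : Sph, ∑' n, F n ω = polyEval Y ω * (φ (x * inner ℝ η (ω : R3)) : ℂ) := fun ω => by
    have hlt : |x * inner ℝ η (ω : R3)| < 1 := by
      rw [abs_mul]
      exact (mul_le_of_le_one_right (abs_nonneg _) (abs_inner_sphere_le hη ω)).trans_lt hx
    have h2 := (Complex.hasSum_ofReal.2 (hφ _ hlt)).mul_left (polyEval Y ω)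
    rw [← h2.tsum_eq]
    refine tsum_congr fun n => ?_
    rw [hF]
    push_cast
    ring
  have h3 : ∀ n, ∫ ω, F n ω ∂surf =
      ((c n * legendreMoment n l * x ^ n : ℝ) : ℂ) * (4 * Real.pi * polyEval Y η) := fun n => by
    rw [hF]
    simp only [integral_const_mul, funkHecke_pow hη n hY]
    push_cast
    ring
  simp only [h1, h3] at hs
  rw [← hs.tsum_eq, tsum_mul_right, ← Complex.ofReal_tsum, zonal]
  push_cast
  ring

theorem legendreMoment_le_inv (n l : ℕ) : legendreMoment n l ≤ 1 / (n + 1) := by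
  rcases l with _ | l
  · rw [legendreMoment_zero_right]
    split_ifs
    · exact le_rfl
    · positivity
  · refine (legendreMoment_le n l).trans ?_
    gcongr
    norm_num

theorem abs_coeffT_mul_le (n l : ℕ) : |coeffT n| * legendreMoment n (l + 1) ≤ 1 / (n + 2) := by
  simpa [coeffT] using legendreMoment_le n l

theorem abs_coeffT_le (n : ℕ) : |coeffT n| ≤ n + 1 := by
  simp [coeffT]

theorem abs_coeffW_le (n : ℕ) : |coeffW n| ≤ n + 1 := by
  rw [coeffW, abs_mul, abs_pow, abs_neg, abs_one, one_pow, one_mul, abs_of_nonneg (by positivity)]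

theorem abs_coeff_mul_le {c : ℕ → ℝ} (hc : ∀ n, |c n| ≤ n + 1) (n l : ℕ) :
    |c n| * legendreMoment n l ≤ 1 := by
  calc |c n| * legendreMoment n l ≤ (n + 1) * (1 / (n + 1)) :=
        mul_le_mul (hc n) (legendreMoment_le_inv n l) (legendreMoment_nonneg n l) (by positivity)
    _ = 1 := by field_simp

theorem summable_zonal {c : ℕ → ℝ} (hc : ∀ n, |c n| ≤ n + 1) (l : ℕ) {x : ℝ} (hx : |x| < 1) :
    Summable fun n => c n * legendreMoment n l * x ^ n := by
  refine Summable.of_norm_bounded (summable_geometric_of_abs_lt_one (r := |x|) (by rwa [abs_abs]))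
    fun n => ?_
  rw [Real.norm_eq_abs, abs_mul, abs_mul, abs_pow, abs_of_nonneg (legendreMoment_nonneg n l)]
  exact mul_le_of_le_one_left (by positivity) (abs_coeff_mul_le hc n l)

/-- Only the powers of the parity of `l` contribute to a zonal series, and the constant term does
not if `l` is positive; comparing `xⁿ` with `xⁿ⁻¹` for even `l`, one obtains a bound by the odd
powers for every `l`. -/
theorem abs_zonal_le {c : ℕ → ℝ} (hc : ∀ n, |c n| ≤ n + 1) (l : ℕ) {g : ℕ → ℝ} (hg : Antitone g)
    (hgc : ∀ n, |c n| * legendreMoment n (l + 1) ≤ g n) {x : ℝ} (hx0 : 0 ≤ x) (hx : x < 1) :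
    Summable (fun k : ℕ => g (2 * k + 1) * x ^ (2 * k + 1)) ∧
    |zonal c (l + 1) x| ≤ ∑' k : ℕ, g (2 * k + 1) * x ^ (2 * k + 1) := by
  have hx' : |x| < 1 := by rwa [abs_of_nonneg hx0]
  have hg0 : ∀ n, 0 ≤ g n := fun n =>
    (mul_nonneg (abs_nonneg _) (legendreMoment_nonneg n (l + 1))).trans (hgc n)
  set f : ℕ → ℝ := fun n => c n * legendreMoment n (l + 1) * x ^ n with hf
  have hsum : Summable f := summable_zonal hc (l + 1) hx'
  have hfle : ∀ n, |f n| ≤ g n * x ^ n := fun n => by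
    rw [hf]
    simp only [abs_mul, abs_pow, abs_of_nonneg (legendreMoment_nonneg n (l + 1)),
      abs_of_nonneg hx0]
    exact mul_le_mul_of_nonneg_right (hgc n) (by positivity)
  have hG : Summable fun n => g n * x ^ n := by
    refine ((summable_geometric_of_lt_one hx0 hx).mul_left (g 0)).of_nonneg_of_le
      (fun n => mul_nonneg (hg0 n) (by positivity)) fun n => ?_
    exact mul_le_mul_of_nonneg_right (hg (Nat.zero_le n)) (by positivity)
  have hGodd : Summable fun k : ℕ => g (2 * k + 1) * x ^ (2 * k + 1) :=
    hG.comp_injective (i := fun k : ℕ => 2 * k + 1) fun a b h => by simpa using h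
  refine ⟨hGodd, ?_⟩
  have he : Summable fun k : ℕ => f (2 * k) :=
    hsum.comp_injective (i := fun k : ℕ => 2 * k) fun a b h => by simpa using h
  have ho : Summable fun k : ℕ => f (2 * k + 1) :=
    hsum.comp_injective (i := fun k : ℕ => 2 * k + 1) fun a b h => by simpa using h
  have hsplit : zonal c (l + 1) x = ∑' k, f (2 * k) + ∑' k, f (2 * k + 1) :=
    (tsum_even_add_odd he ho).symm
  have hvan : ∀ n, ¬Even (n + (l + 1)) → f n = 0 := fun n hn => by
    simp only [hf, legendreMoment_eq_zero hn, mul_zero, zero_mul]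
  rcases Nat.even_or_odd l with hl | hl
  · have h0 : ∀ k, f (2 * k) = 0 := fun k => hvan _ (by
      rw [Nat.not_even_iff_odd]; exact (even_two_mul k).add_odd hl.add_one)
    rw [hsplit]
    simp only [h0, tsum_zero, zero_add]
    exact tsum_of_norm_bounded (f := fun k => f (2 * k + 1)) hGodd.hasSum fun k => hfle _
  · have h0 : ∀ k, f (2 * k + 1) = 0 := fun k => hvan _ (by
      rw [Nat.not_even_iff_odd]; exact ((even_two_mul k).add_one).add_even hl.add_one)
    have h00 : f (2 * 0) = 0 := by simp [hf, legendreMoment_zero_succ]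
    rw [hsplit]
    simp only [h0, tsum_zero, add_zero]
    rw [he.tsum_eq_zero_add, h00, zero_add]
    refine tsum_of_norm_bounded (f := fun k => f (2 * (k + 1))) hGodd.hasSum
      fun k => (hfle _).trans ?_
    refine mul_le_mul (hg (by omega)) ?_ (by positivity) (hg0 _)
    exact pow_le_pow_of_le_one hx0 hx.le (by omega)

theorem hasSum_odd_pow {x : ℝ} (hx0 : 0 ≤ x) (hx : x < 1) :
    HasSum (fun k : ℕ => x ^ (2 * k + 1)) (x / (1 - x ^ 2)) := by
  have h := (hasSum_geometric_of_lt_one (sq_nonneg x) (by nlinarith)).mul_left x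
  rw [← div_eq_mul_inv] at h
  have e : (fun k : ℕ => x ^ (2 * k + 1)) = fun k => x * (x ^ 2) ^ k := by
    funext k
    ring
  rw [e]
  exact h

/-- A bound uniform in the positive angular momentum; it vanishes linearly at `x = 0`, which makes
the kernels of all sectors `l ≥ 1` integrable against the weights used in Schur's test. -/
theorem abs_zonal_le_odd {c : ℕ → ℝ} (hc : ∀ n, |c n| ≤ n + 1) (l : ℕ) {x : ℝ} (hx0 : 0 ≤ x)
    (hx : x < 1) : |zonal c (l + 1) x| ≤ x / (1 - x ^ 2) := by
  have h := (abs_zonal_le hc l (g := fun _ => 1) antitone_const (fun n => abs_coeff_mul_le hc n _)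
    hx0 hx).2
  simpa only [one_mul, (hasSum_odd_pow hx0 hx).tsum_eq] using h

theorem zonal_coeffW_zero {x : ℝ} (hx : |x| < 1) : zonal coeffW 0 x = 1 / (1 - x ^ 2) := by
  have h1 : ∀ k : ℕ, coeffW (2 * k) * legendreMoment (2 * k) 0 * x ^ (2 * k) = (x ^ 2) ^ k :=
    fun k => by
      rw [legendreMoment_zero_right, if_pos (even_two_mul k), coeffW, pow_mul x, pow_mul (-1 : ℝ)]
      push_cast
      field_simp
      norm_num
  have h2 : ∀ k : ℕ, coeffW (2 * k + 1) * legendreMoment (2 * k + 1) 0 * x ^ (2 * k + 1) = 0 :=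
    fun k => by
      rw [legendreMoment_eq_zero (by simp)]
      simp
  have hx2 : x ^ 2 < 1 := by rw [← sq_abs]; nlinarith [abs_nonneg x]
  have h3 := HasSum.even_add_odd (f := fun n => coeffW n * legendreMoment n 0 * x ^ n)
    (m := 1 / (1 - x ^ 2)) (m' := 0)
    (by simp only [h1]; rw [one_div]; exact hasSum_geometric_of_lt_one (sq_nonneg x) hx2)
    (by simp only [h2]; exact hasSum_zero)
  rw [add_zero] at h3
  exact h3.tsum_eq

/-- The bound for the zonal series of `1 / (1 + y)`, with equality in modulus for `l = 1`, as an
integral. -/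
theorem ofReal_abs_zonal_coeffT_le (l : ℕ) {x : ℝ} (hx0 : 0 ≤ x) (hx : x < 1) :
    ENNReal.ofReal |zonal coeffT (l + 1) x| ≤
      ∫⁻ t in Set.Ioc (0 : ℝ) 1, ENNReal.ofReal (x * t ^ 2 / (1 - x ^ 2 * t ^ 2)) := by
  obtain ⟨hs, hle⟩ := abs_zonal_le abs_coeffT_le l (g := fun n : ℕ => 1 / ((n : ℝ) + 2))
    (fun a b hab => by
      have : (a : ℝ) ≤ b := by exact_mod_cast hab
      dsimp only
      gcongr) (fun n => abs_coeffT_mul_le n l) hx0 hx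
  refine (ENNReal.ofReal_le_ofReal hle).trans ?_
  rw [ENNReal.ofReal_tsum_of_nonneg (fun k => by positivity) hs]
  have h1 : ∀ k : ℕ, ENNReal.ofReal (1 / (((2 * k + 1 : ℕ) : ℝ) + 2) * x ^ (2 * k + 1)) =
      ∫⁻ t in Set.Ioc (0 : ℝ) 1, ENNReal.ofReal (x ^ (2 * k + 1) * t ^ (2 * k + 2)) := fun k => by
    rw [← ofReal_integral_eq_lintegral_ofReal]
    · rw [integral_const_mul, ← intervalIntegral.integral_of_le zero_le_one, integral_pow]
      congr 1
      push_cast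
      simp
      ring
    · exact ((continuous_const.mul (continuous_pow _)).integrableOn_Icc).mono_set
        Set.Ioc_subset_Icc_self
    · filter_upwards [ae_restrict_mem measurableSet_Ioc] with t ht
      have := ht.1.le
      positivity
  simp only [h1]
  rw [← lintegral_tsum (fun k => by fun_prop)]
  refine setLIntegral_mono' measurableSet_Ioc fun t ht => ?_
  have ht0 := ht.1.le
  have hxt0 : 0 ≤ x * t := mul_nonneg hx0 ht0
  have hxt : x * t < 1 := (mul_le_of_le_one_right hx0 ht.2).trans_lt hx
  have h2 := (hasSum_odd_pow hxt0 hxt).mul_left t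
  have h3 : ∀ k : ℕ, x ^ (2 * k + 1) * t ^ (2 * k + 2) = t * (x * t) ^ (2 * k + 1) := fun k => by
    ring
  simp only [h3]
  rw [← ENNReal.ofReal_tsum_of_nonneg (fun k => by positivity) h2.summable, h2.tsum_eq]
  apply le_of_eq
  congr 1
  ring

end

noncomputable section

/-! ### The Efimov function -/

theorem lintegral_Ioi_of_hasDerivAt {g g' : ℝ → ℝ} {l : ℝ} (hg : ∀ x, HasDerivAt g (g' x) x)
    (h0 : ∀ x ∈ Set.Ioi (0 : ℝ), 0 ≤ g' x) (hl : Tendsto g atTop (𝓝 l)) :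
    ∫⁻ x in Set.Ioi (0 : ℝ), ENNReal.ofReal (g' x) = ENNReal.ofReal (l - g 0) := by
  have hc : ContinuousWithinAt g (Set.Ici 0) 0 := (hg 0).continuousAt.continuousWithinAt
  rw [← integral_Ioi_of_hasDerivAt_of_nonneg hc (fun x _ => hg x) h0 hl,
    ofReal_integral_eq_lintegral_ofReal
      (integrableOn_Ioi_deriv_of_nonneg hc (fun x _ => hg x) h0 hl)]
  filter_upwards [ae_restrict_mem measurableSet_Ioi] with x hx using h0 x hx

/-- The primitive in `s` used here is a difference of two arctangents. -/
theorem lintegral_radial_kernel {b r : ℝ} (hb0 : 0 ≤ b) (hb : b < 2) (hr : 0 < r) :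
    ∫⁻ s in Set.Ioi (0 : ℝ),
      ENNReal.ofReal (b * r * s / ((r ^ 2 + s ^ 2) ^ 2 - (b * r * s) ^ 2)) =
    ENNReal.ofReal (Real.arcsin (b / 2) / √(1 - (b / 2) ^ 2) / r) := by
  have hd0 : 0 < 1 - (b / 2) ^ 2 := by nlinarith
  set d := √(1 - (b / 2) ^ 2) with hd
  have hdp : 0 < d := Real.sqrt_pos.2 hd0
  have hd2 : d ^ 2 = 1 - (b / 2) ^ 2 := Real.sq_sqrt hd0.le
  have hq : ∀ s : ℝ, 0 < r ^ 2 + s ^ 2 - b * r * s := fun s => by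
    have : r ^ 2 + s ^ 2 - b * r * s = (r * d) ^ 2 + (s - b * r / 2) ^ 2 := by
      rw [mul_pow, hd2]; ring
    rw [this]; positivity
  have hq' : ∀ s : ℝ, 0 < r ^ 2 + s ^ 2 + b * r * s := fun s => by
    have : r ^ 2 + s ^ 2 + b * r * s = (r * d) ^ 2 + (s + b * r / 2) ^ 2 := by
      rw [mul_pow, hd2]; ring
    rw [this]; positivity
  set g : ℝ → ℝ := fun s =>
    (Real.arctan ((s - b * r / 2) / (r * d)) - Real.arctan ((s + b * r / 2) / (r * d))) /
      (2 * (r * d)) with hg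
  have hgd : ∀ s, HasDerivAt g (b * r * s / ((r ^ 2 + s ^ 2) ^ 2 - (b * r * s) ^ 2)) s := by
    intro s
    have h1 := (((hasDerivAt_id s).sub_const (b * r / 2)).div_const (r * d)).arctan
    have h2 := (((hasDerivAt_id s).add_const (b * r / 2)).div_const (r * d)).arctan
    refine ((h1.sub h2).div_const (2 * (r * d))).congr_deriv ?_
    simp only [id]
    have e1 : 1 + ((s - b * r / 2) / (r * d)) ^ 2 = (r ^ 2 + s ^ 2 - b * r * s) / (r * d) ^ 2 := by
      field_simp
      rw [hd2]; ring
    have e2 : 1 + ((s + b * r / 2) / (r * d)) ^ 2 = (r ^ 2 + s ^ 2 + b * r * s) / (r * d) ^ 2 := by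
      field_simp
      rw [hd2]; ring
    have e3 : (r ^ 2 + s ^ 2) ^ 2 - (b * r * s) ^ 2 =
        (r ^ 2 + s ^ 2 - b * r * s) * (r ^ 2 + s ^ 2 + b * r * s) := by ring
    have h3 := (hq s).ne'
    have h4 := (hq' s).ne'
    have h5 : b * r * s = ((r ^ 2 + s ^ 2 + b * r * s) - (r ^ 2 + s ^ 2 - b * r * s)) / 2 := by ring
    rw [e1, e2, e3]
    nth_rewrite 3 [h5]
    generalize r ^ 2 + s ^ 2 - b * r * s = u at h3
    generalize r ^ 2 + s ^ 2 + b * r * s = v at h4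
    field_simp
  have hlim : Tendsto g atTop (𝓝 ((Real.pi / 2 - Real.pi / 2) / (2 * (r * d)))) := by
    have h1 : Tendsto Real.arctan atTop (𝓝 (Real.pi / 2)) :=
      Real.tendsto_arctan_atTop.mono_right nhdsWithin_le_nhds
    refine ((h1.comp ?_).sub (h1.comp ?_)).div_const _
    · exact (tendsto_atTop_add_const_right _ (-(b * r / 2)) tendsto_id).atTop_div_const
        (by positivity)
    · exact (tendsto_atTop_add_const_right _ (b * r / 2) tendsto_id).atTop_div_const
        (by positivity)
  rw [lintegral_Ioi_of_hasDerivAt hgd _ hlim]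
  · congr 1
    have h5 : (b * r / 2) / (r * d) = (b / 2) / √(1 - (b / 2) ^ 2) := by
      rw [← hd]; field_simp
    have h6 : (-(b * r / 2)) / (r * d) = -((b / 2) / √(1 - (b / 2) ^ 2)) := by
      rw [neg_div, h5]
    simp only [hg, sub_self, zero_div, zero_sub, zero_add]
    rw [h5, h6, Real.arctan_neg, ← Real.arcsin_eq_arctan ⟨by linarith, by linarith⟩]
    field_simp
    ring
  · intro s hs
    have hs' : (0 : ℝ) < s := hs
    have e3 : (r ^ 2 + s ^ 2) ^ 2 - (b * r * s) ^ 2 =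
        (r ^ 2 + s ^ 2 - b * r * s) * (r ^ 2 + s ^ 2 + b * r * s) := by ring
    rw [e3]
    have h3 := hq s
    have h4 := hq' s
    positivity

theorem one_sub_sq_pos {c t : ℝ} (hc0 : 0 ≤ c) (hc : c < 1) (ht : t ∈ Set.Icc (0 : ℝ) 1) :
    0 < 1 - (c * t) ^ 2 := by
  have h1 : c * t < 1 := (mul_le_of_le_one_right hc0 ht.2).trans_lt hc
  have h2 : 0 ≤ c * t := mul_nonneg hc0 ht.1
  nlinarith

theorem continuousOn_arcsin_kernel {c : ℝ} (hc0 : 0 ≤ c) (hc : c < 1) :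
    ContinuousOn (fun t : ℝ => t * (Real.arcsin (c * t) / √(1 - (c * t) ^ 2))) (Set.Icc 0 1) := by
  refine continuousOn_id.mul (ContinuousOn.div ?_ (by fun_prop) fun t ht => ?_)
  · exact (Real.continuous_arcsin.comp (by fun_prop)).continuousOn
  · exact (Real.sqrt_pos.2 (one_sub_sq_pos hc0 hc ht)).ne'

theorem integral_arcsin_kernel {c : ℝ} (hc0 : 0 < c) (hc : c < 1) :
    ∫ t in (0 : ℝ)..1, t * (Real.arcsin (c * t) / √(1 - (c * t) ^ 2)) =
      (c - Real.arcsin c * √(1 - c ^ 2)) / c ^ 2 := by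
  set F : ℝ → ℝ := fun t => (c * t - Real.arcsin (c * t) * √(1 - (c * t) ^ 2)) / c ^ 2 with hF
  have hd : ∀ t ∈ Set.uIcc (0 : ℝ) 1,
      HasDerivAt F (t * (Real.arcsin (c * t) / √(1 - (c * t) ^ 2))) t := fun t ht => by
    rw [Set.uIcc_of_le zero_le_one] at ht
    have h0 := one_sub_sq_pos hc0.le hc ht
    have hs := Real.sqrt_pos.2 h0
    have h1 : HasDerivAt (fun t : ℝ => c * t) c t := by simpa using (hasDerivAt_id t).const_mul c
    have h2 : HasDerivAt (fun t : ℝ => Real.arcsin (c * t)) (1 / √(1 - (c * t) ^ 2) * c) t :=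
      (Real.hasDerivAt_arcsin (by nlinarith [mul_nonneg hc0.le ht.1])
        (by nlinarith [mul_nonneg hc0.le ht.1])).comp t h1
    have h3 := ((h1.pow 2).const_sub 1).sqrt h0.ne'
    refine ((h1.sub (h2.mul h3)).div_const (c ^ 2)).congr_deriv ?_
    simp only [Pi.pow_apply]
    generalize √(1 - (c * t) ^ 2) = q at hs
    field_simp
    push_cast
    ring
  rw [intervalIntegral.integral_eq_sub_of_hasDerivAt hd
    (ContinuousOn.intervalIntegrable (by
      rw [Set.uIcc_of_le zero_le_one]; exact continuousOn_arcsin_kernel hc0.le hc))]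
  simp [hF]

/-- The integral representation of `Λ` in which the bound for the kernel of `T_λ` arises. -/
theorem efimov_eq {m : ℝ} (hm : 0 < m) :
    efimov m = 2 / Real.pi / √(1 - (1 / (m + 1)) ^ 2) *
      ∫ t in (0 : ℝ)..1, t * (Real.arcsin (1 / (m + 1) * t) / √(1 - (1 / (m + 1) * t) ^ 2)) := by
  have hc0 : 0 < 1 / (m + 1) := by positivity
  have hc1 : 1 / (m + 1) < 1 := by rw [div_lt_one (by linarith)]; linarith
  rw [integral_arcsin_kernel hc0 hc1, efimov]
  have h1 : √(1 - (1 / (m + 1)) ^ 2) = √(m * (m + 2)) / (m + 1) := by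
    rw [← Real.sqrt_sq (by linarith : 0 ≤ m + 1), ← Real.sqrt_div (by positivity),
      Real.sqrt_sq (by linarith : 0 ≤ m + 1)]
    congr 1
    field_simp
    ring
  have h2 : 0 < √(m * (m + 2)) := Real.sqrt_pos.2 (by positivity)
  rw [h1]
  field_simp

theorem arcsin_mul_sqrt_lt {c : ℝ} (hc0 : 0 < c) (hc : c < 1) :
    Real.arcsin c * √(1 - c ^ 2) < c := by
  have h1 : 0 < Real.arcsin c := Real.arcsin_pos.2 hc0
  have h2 := Real.lt_tan h1 (Real.arcsin_lt_pi_div_two.2 hc)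
  rw [Real.tan_arcsin, lt_div_iff₀ (Real.sqrt_pos.2 (by nlinarith))] at h2
  exact h2

/-- In the integral representation the integrand and the prefactor increase with `1 / (m + 1)`. -/
theorem efimov_strictAntiOn : StrictAntiOn efimov (Set.Ioi 0) := by
  intro a ha b hb hab
  have ha' : (0 : ℝ) < a := ha
  have hb' : (0 : ℝ) < b := hb
  rw [efimov_eq ha', efimov_eq hb']
  have hca : 1 / (a + 1) < 1 := by rw [div_lt_one (by linarith)]; linarith
  have hcb0 : 0 < 1 / (b + 1) := by positivity
  have hba : 1 / (b + 1) < 1 / (a + 1) := one_div_lt_one_div_of_lt (by linarith) (by linarith)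
  set c := 1 / (a + 1)
  set e := 1 / (b + 1)
  have hpos : 0 < ∫ t in (0 : ℝ)..1, t * (Real.arcsin (e * t) / √(1 - (e * t) ^ 2)) := by
    rw [integral_arcsin_kernel hcb0 (hba.trans hca)]
    have := arcsin_mul_sqrt_lt hcb0 (hba.trans hca)
    exact div_pos (by linarith) (by positivity)
  have hmono : ∫ t in (0 : ℝ)..1, t * (Real.arcsin (e * t) / √(1 - (e * t) ^ 2)) ≤
      ∫ t in (0 : ℝ)..1, t * (Real.arcsin (c * t) / √(1 - (c * t) ^ 2)) := by
    refine intervalIntegral.integral_mono_on zero_le_one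
      (ContinuousOn.intervalIntegrable (by
        rw [Set.uIcc_of_le zero_le_one]
        exact continuousOn_arcsin_kernel hcb0.le (hba.trans hca)))
      (ContinuousOn.intervalIntegrable (by
        rw [Set.uIcc_of_le zero_le_one]
        exact continuousOn_arcsin_kernel (hcb0.trans hba).le hca)) fun t ht => ?_
    have h1 : e * t ≤ c * t := mul_le_mul_of_nonneg_right hba.le ht.1
    have h2 := one_sub_sq_pos (hcb0.trans hba).le hca ht
    have h3 : (e * t) ^ 2 ≤ (c * t) ^ 2 := pow_le_pow_left₀ (mul_nonneg hcb0.le ht.1) h1 2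
    refine mul_le_mul_of_nonneg_left ?_ ht.1
    refine div_le_div₀ (Real.arcsin_nonneg.2 (mul_nonneg (hcb0.trans hba).le ht.1))
      (Real.monotone_arcsin h1) (Real.sqrt_pos.2 h2) (Real.sqrt_le_sqrt (by linarith))
  have hsq : √(1 - c ^ 2) < √(1 - e ^ 2) :=
    Real.sqrt_lt_sqrt (by nlinarith [hcb0.trans hba]) (by nlinarith)
  have hsq0 : 0 < √(1 - c ^ 2) := Real.sqrt_pos.2 (by nlinarith [hcb0.trans hba])
  have hpi := Real.pi_pos
  refine mul_lt_mul (div_lt_div_of_pos_left (by positivity) hsq0 hsq) hmono hpos (by positivity)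

/-- The set whose infimum is `m*` is not empty, so that `m*` is not a default value. -/
theorem exists_efimov_eq_one : ∃ m, 0 < m ∧ efimov m = 1 := by
  have hpi := Real.pi_pos
  have hcont : ContinuousOn efimov (Set.Icc (1 / 40) 1) := by
    unfold efimov
    refine ContinuousOn.mul (by fun_prop) (ContinuousOn.sub ?_ ?_)
    · refine continuousOn_const.div (by fun_prop) fun m hm => ?_
      have : 0 < m := lt_of_lt_of_le (by norm_num) hm.1
      exact (Real.sqrt_pos.2 (by positivity)).ne'
    · refine Real.continuous_arcsin.comp_continuousOn (continuousOn_const.div (by fun_prop) ?_)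
      intro m hm
      have : 0 < m := lt_of_lt_of_le (by norm_num) hm.1
      positivity
  have h1 : efimov 1 ≤ 1 := by
    have h2 : Real.arcsin (1 / (1 + 1)) = Real.pi / 6 := by
      have : (1 / (1 + 1) : ℝ) = Real.sin (Real.pi / 6) := by rw [Real.sin_pi_div_six]; norm_num
      rw [this, Real.arcsin_sin (by linarith) (by linarith)]
    have h3 : 1 / √(1 * (1 + 2) : ℝ) ≤ 7 / 10 := by
      rw [div_le_iff₀ (Real.sqrt_pos.2 (by norm_num))]
      have : (10 / 7 : ℝ) ≤ √(1 * (1 + 2)) := Real.le_sqrt_of_sq_le (by norm_num)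
      linarith
    rw [efimov, h2, div_mul_eq_mul_div, div_mul_eq_mul_div, div_le_one hpi]
    have := Real.pi_gt_three
    nlinarith
  have h2 : 1 ≤ efimov (1 / 40) := by
    have h3 : 4 ≤ 1 / √(1 / 40 * (1 / 40 + 2) : ℝ) := by
      rw [le_div_iff₀ (Real.sqrt_pos.2 (by norm_num))]
      have : √(1 / 40 * (1 / 40 + 2) : ℝ) ≤ 1 / 4 := Real.sqrt_le_iff.2 (by norm_num)
      linarith
    have h4 := Real.arcsin_le_pi_div_two (1 / (1 / 40 + 1))
    have h5 := Real.pi_le_four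
    rw [efimov, div_mul_eq_mul_div, div_mul_eq_mul_div, le_div_iff₀ hpi]
    nlinarith
  obtain ⟨m, hm, h⟩ := intermediate_value_Icc' (by norm_num) hcont ⟨h1, h2⟩
  exact ⟨m, lt_of_lt_of_le (by norm_num) hm.1, h⟩

theorem efimov_lt_one {m : ℝ} (hm : mStar < m) : efimov m < 1 := by
  obtain ⟨a, ⟨ha0, ha⟩, ham⟩ := exists_lt_of_csInf_lt exists_efimov_eq_one hm
  rw [← ha]
  exact efimov_strictAntiOn ha0 (ha0.trans ham) ham

end

noncomputable section

/-! ### Schur's test -/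

section Schur
variable {X : Type*} [MeasurableSpace X] {ρ : Measure X}

theorem lintegral_sqrt_mul_sq_le {A B : X → ENNReal} (hA : AEMeasurable A ρ)
    (hB : AEMeasurable B ρ) :
    (∫⁻ x, (A x * B x) ^ (1 / 2 : ℝ) ∂ρ) ^ 2 ≤ (∫⁻ x, A x ∂ρ) * ∫⁻ x, B x ∂ρ := by
  have h := ENNReal.lintegral_mul_le_Lp_mul_Lq ρ Real.HolderConjugate.two_two
    (hA.pow_const (1 / 2 : ℝ)) (hB.pow_const (1 / 2 : ℝ))
  have h1 : ∀ a : ENNReal, (a ^ (1 / 2 : ℝ)) ^ (2 : ℝ) = a := fun a => by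
    rw [← ENNReal.rpow_mul]; norm_num
  simp only [Pi.mul_apply, h1] at h
  simp only [← ENNReal.mul_rpow_of_nonneg _ _ (by norm_num : (0 : ℝ) ≤ 1 / 2)] at h
  calc _ ≤ (((∫⁻ x, A x ∂ρ) * ∫⁻ x, B x ∂ρ) ^ (1 / 2 : ℝ)) ^ 2 := by gcongr
    _ = _ := by rw [← ENNReal.rpow_two, h1]

/-- A kernel that satisfies the hypotheses of Schur's test with the positive weight `h`. -/
structure SchurBound (ρ : Measure X) (k : X → X → ℝ) (h : X → ℝ) (C : ℝ) : Prop where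
  nonneg : 0 ≤ C
  measurable_kernel : Measurable (Function.uncurry k)
  measurable_weight : Measurable h
  weight_pos : ∀ᵐ x ∂ρ, 0 < h x
  right : ∀ᵐ x ∂ρ, ∫⁻ y, ENNReal.ofReal (|k x y| * h y) ∂ρ ≤ ENNReal.ofReal (C * h x)
  left : ∀ᵐ y ∂ρ, ∫⁻ x, ENNReal.ofReal (|k x y| * h x) ∂ρ ≤ ENNReal.ofReal (C * h y)

variable {k : X → X → ℝ} {h : X → ℝ} {C : ℝ}

/-- Schur's test. -/
theorem SchurBound.lintegral_sq_le [SFinite ρ] (hk : SchurBound ρ k h C) {u : X → ENNReal}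
    (hu : Measurable u) :
    ∫⁻ x, (∫⁻ y, ENNReal.ofReal |k x y| * u y ∂ρ) ^ 2 ∂ρ ≤
      ENNReal.ofReal C ^ 2 * ∫⁻ y, u y ^ 2 ∂ρ := by
  have hm := hk.measurable_kernel
  have hm' : Measurable fun z : X × X => ENNReal.ofReal |k z.1 z.2| :=
    ENNReal.measurable_ofReal.comp (measurable_abs.comp hm)
  have hh := hk.measurable_weight
  set B : X → X → ENNReal := fun x y =>
    ENNReal.ofReal |k x y| * (u y ^ 2 * (ENNReal.ofReal (h y))⁻¹) with hB
  have hBm : Measurable (Function.uncurry B) := by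
    exact hm'.mul (((hu.pow_const 2).mul (ENNReal.measurable_ofReal.comp hh).inv).comp
      measurable_snd)
  have hBr : ∀ x, Measurable fun y => B x y := fun x => hBm.comp measurable_prodMk_left
  have hkl : ∀ y, Measurable fun x => ENNReal.ofReal (|k x y| * h x) := fun y =>
    ENNReal.measurable_ofReal.comp ((measurable_abs.comp (hm.comp measurable_prodMk_right)).mul hh)
  have h1 : ∀ᵐ x ∂ρ, (∫⁻ y, ENNReal.ofReal |k x y| * u y ∂ρ) ^ 2 ≤
      ENNReal.ofReal (C * h x) * ∫⁻ y, B x y ∂ρ := by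
    filter_upwards [hk.right] with x hx
    have hA : Measurable fun y => ENNReal.ofReal (|k x y| * h y) :=
      ENNReal.measurable_ofReal.comp
        ((measurable_abs.comp (hm.comp measurable_prodMk_left)).mul hh)
    have e : ∫⁻ y, ENNReal.ofReal |k x y| * u y ∂ρ =
        ∫⁻ y, (ENNReal.ofReal (|k x y| * h y) * B x y) ^ (1 / 2 : ℝ) ∂ρ := by
      refine lintegral_congr_ae ?_
      filter_upwards [hk.weight_pos] with y hy
      have h0 : ENNReal.ofReal (h y) ≠ 0 := by simpa using hy
      have e1 : ENNReal.ofReal (|k x y| * h y) * B x y =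
          (ENNReal.ofReal |k x y| * u y) ^ (2 : ℝ) := by
        rw [ENNReal.ofReal_mul (abs_nonneg _), hB, ENNReal.rpow_two]
        calc _ = (ENNReal.ofReal |k x y| * u y) ^ 2 *
              (ENNReal.ofReal (h y) * (ENNReal.ofReal (h y))⁻¹) := by ring
          _ = _ := by rw [ENNReal.mul_inv_cancel h0 ENNReal.ofReal_ne_top, mul_one]
      rw [e1, ← ENNReal.rpow_mul]
      norm_num
    rw [e]
    refine (lintegral_sqrt_mul_sq_le hA.aemeasurable (hBr x).aemeasurable).trans ?_
    gcongr
  calc _ ≤ ∫⁻ x, ENNReal.ofReal (C * h x) * ∫⁻ y, B x y ∂ρ ∂ρ := lintegral_mono_ae h1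
    _ = ∫⁻ x, ∫⁻ y, ENNReal.ofReal (C * h x) * B x y ∂ρ ∂ρ := by
      refine lintegral_congr fun x => ?_
      rw [lintegral_const_mul _ (hBr x)]
    _ = ∫⁻ y, ∫⁻ x, ENNReal.ofReal (C * h x) * B x y ∂ρ ∂ρ := by
      refine lintegral_lintegral_swap ?_
      exact (((ENNReal.measurable_ofReal.comp (hh.const_mul C)).comp measurable_fst).mul
        hBm).aemeasurable
    _ ≤ ∫⁻ y, ENNReal.ofReal C ^ 2 * u y ^ 2 ∂ρ := by
      refine lintegral_mono_ae ?_
      filter_upwards [hk.left, hk.weight_pos] with y hy hpos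
      have h0 : ENNReal.ofReal (h y) ≠ 0 := by simpa using hpos
      have e2 : ∀ x, ENNReal.ofReal (C * h x) * B x y =
          (ENNReal.ofReal C * (u y ^ 2 * (ENNReal.ofReal (h y))⁻¹)) *
            ENNReal.ofReal (|k x y| * h x) := fun x => by
        rw [ENNReal.ofReal_mul hk.nonneg, ENNReal.ofReal_mul (abs_nonneg _), hB]
        ring
      simp only [e2]
      rw [lintegral_const_mul _ (hkl y)]
      calc _ ≤ (ENNReal.ofReal C * (u y ^ 2 * (ENNReal.ofReal (h y))⁻¹)) *
            ENNReal.ofReal (C * h y) := by gcongr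
        _ = ENNReal.ofReal C ^ 2 * u y ^ 2 *
            (ENNReal.ofReal (h y) * (ENNReal.ofReal (h y))⁻¹) := by
          rw [ENNReal.ofReal_mul hk.nonneg]; ring
        _ = _ := by rw [ENNReal.mul_inv_cancel h0 ENNReal.ofReal_ne_top, mul_one]
    _ = _ := lintegral_const_mul _ (hu.pow_const 2)

variable {E : Type*} [NormedAddCommGroup E]

theorem lintegral_enorm_sq_lt_top (u : Lp E 2 ρ) : ∫⁻ x, ‖u x‖ₑ ^ 2 ∂ρ < ⊤ := by
  have h1 := (eLpNorm_lt_top_iff_lintegral_rpow_enorm_lt_top two_ne_zero ENNReal.ofNat_ne_top).1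
    (Lp.memLp u).2
  simpa using h1

theorem ofReal_norm_sq_eq_lintegral (u : Lp E 2 ρ) :
    ENNReal.ofReal (‖u‖ ^ 2) = ∫⁻ x, ‖u x‖ₑ ^ 2 ∂ρ := by
  rw [ENNReal.ofReal_pow (norm_nonneg _), Lp.norm_def, ENNReal.ofReal_toReal (Lp.eLpNorm_ne_top u),
    eLpNorm_eq_lintegral_rpow_enorm_toReal two_ne_zero ENNReal.ofNat_ne_top]
  simp only [ENNReal.toReal_ofNat, ENNReal.rpow_two]
  rw [← ENNReal.rpow_two, ← ENNReal.rpow_mul]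
  norm_num

theorem memLp_two_of_lintegral {f : X → E} (hf : AEStronglyMeasurable f ρ)
    (h : ∫⁻ x, ‖f x‖ₑ ^ 2 ∂ρ < ⊤) : MemLp f 2 ρ := by
  refine ⟨hf, (eLpNorm_lt_top_iff_lintegral_rpow_enorm_lt_top two_ne_zero
    ENNReal.ofNat_ne_top).2 ?_⟩
  simpa using h

variable [InnerProductSpace ℂ E]

theorem enorm_kernel_smul (a : ℝ) (v : E) : ‖(a : ℂ) • v‖ₑ = ENNReal.ofReal |a| * ‖v‖ₑ := by
  rw [enorm_smul, ← Real.norm_eq_abs, ← Complex.norm_real, ofReal_norm]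

theorem SchurBound.ae_integrable [SFinite ρ] (hk : SchurBound ρ k h C) (u : Lp E 2 ρ) :
    ∀ᵐ x ∂ρ, Integrable (fun y => (k x y : ℂ) • u y) ρ := by
  have h1 := hk.lintegral_sq_le (Lp.stronglyMeasurable u).enorm
  have h2 : ∫⁻ x, (∫⁻ y, ENNReal.ofReal |k x y| * ‖u y‖ₑ ∂ρ) ^ 2 ∂ρ < ⊤ :=
    h1.trans_lt (ENNReal.mul_lt_top (by simp) (lintegral_enorm_sq_lt_top u))
  have hm : Measurable fun x => (∫⁻ y, ENNReal.ofReal |k x y| * ‖u y‖ₑ ∂ρ) ^ 2 := by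
    refine Measurable.pow_const (Measurable.lintegral_prod_right' (f := fun z : X × X =>
      ENNReal.ofReal |k z.1 z.2| * ‖u z.2‖ₑ) ?_) 2
    exact (ENNReal.measurable_ofReal.comp (measurable_abs.comp hk.measurable_kernel)).mul
      ((Lp.stronglyMeasurable u).enorm.comp measurable_snd)
  filter_upwards [ae_lt_top hm h2.ne] with x hx
  refine ⟨?_, ?_⟩
  · exact (Complex.measurable_ofReal.comp
      (hk.measurable_kernel.comp measurable_prodMk_left)).aestronglyMeasurable.smul
      (Lp.stronglyMeasurable u).aestronglyMeasurable
  · rw [hasFiniteIntegral_iff_enorm]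
    simp only [enorm_kernel_smul]
    by_contra hcon
    rw [not_lt, top_le_iff] at hcon
    simp [hcon] at hx

theorem SchurBound.memLp [SFinite ρ] (hk : SchurBound ρ k h C) (u : Lp E 2 ρ) :
    MemLp (fun x => ∫ y, (k x y : ℂ) • u y ∂ρ) 2 ρ ∧
    ∫⁻ x, ‖∫ y, (k x y : ℂ) • u y ∂ρ‖ₑ ^ 2 ∂ρ ≤ ENNReal.ofReal C ^ 2 * ∫⁻ y, ‖u y‖ₑ ^ 2 ∂ρ := by
  have h1 : ∫⁻ x, ‖∫ y, (k x y : ℂ) • u y ∂ρ‖ₑ ^ 2 ∂ρ ≤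
      ENNReal.ofReal C ^ 2 * ∫⁻ y, ‖u y‖ₑ ^ 2 ∂ρ := by
    refine le_trans (lintegral_mono fun x => ?_)
      (hk.lintegral_sq_le (Lp.stronglyMeasurable u).enorm)
    simp only [← enorm_kernel_smul]
    gcongr
    exact enorm_integral_le_lintegral_enorm _
  refine ⟨memLp_two_of_lintegral ?_ (h1.trans_lt
    (ENNReal.mul_lt_top (by simp) (lintegral_enorm_sq_lt_top u))), h1⟩
  have h2 : StronglyMeasurable fun z : X × X => (k z.1 z.2 : ℂ) • u z.2 :=
    (Complex.measurable_ofReal.comp hk.measurable_kernel).stronglyMeasurable.smul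
      ((Lp.stronglyMeasurable u).comp_measurable measurable_snd)
  exact h2.integral_prod_right'.aestronglyMeasurable

/-- The bounded operator on `L²` defined by a kernel that satisfies Schur's test. -/
def SchurBound.op [SFinite ρ] (hk : SchurBound ρ k h C) : Lp E 2 ρ →L[ℂ] Lp E 2 ρ :=
  LinearMap.mkContinuous
    { toFun := fun u => (hk.memLp u).1.toLp _
      map_add' := fun u v => by
        refine Lp.ext ?_
        filter_upwards [(hk.memLp (u + v)).1.coeFn_toLp,
          Lp.coeFn_add ((hk.memLp u).1.toLp _) ((hk.memLp v).1.toLp _),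
          (hk.memLp u).1.coeFn_toLp, (hk.memLp v).1.coeFn_toLp, hk.ae_integrable u,
          hk.ae_integrable v] with x h1 h2 h3 h4 h5 h6
        rw [h1, h2, Pi.add_apply, h3, h4, ← integral_add h5 h6]
        refine integral_congr_ae ?_
        filter_upwards [Lp.coeFn_add u v] with y hy
        rw [hy, Pi.add_apply, smul_add]
      map_smul' := fun a u => by
        refine Lp.ext ?_
        filter_upwards [(hk.memLp (a • u)).1.coeFn_toLp,
          Lp.coeFn_smul a ((hk.memLp u).1.toLp _),
          (hk.memLp u).1.coeFn_toLp] with x h1 h2 h3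
        rw [h1, RingHom.id_apply, h2, Pi.smul_apply, h3, ← integral_smul]
        refine integral_congr_ae ?_
        filter_upwards [Lp.coeFn_smul a u] with y hy
        rw [hy, Pi.smul_apply, smul_comm] } C fun u => by
    refine (sq_le_sq₀ (norm_nonneg _) (mul_nonneg hk.nonneg (norm_nonneg _))).1 ?_
    refine (ENNReal.ofReal_le_ofReal_iff (by positivity)).1 ?_
    rw [mul_pow, ENNReal.ofReal_mul (by positivity), ENNReal.ofReal_pow hk.nonneg,
      ofReal_norm_sq_eq_lintegral u]
    refine le_trans (le_of_eq ?_) (hk.memLp u).2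
    rw [LinearMap.coe_mk, AddHom.coe_mk, ofReal_norm_sq_eq_lintegral]
    refine lintegral_congr_ae ?_
    filter_upwards [(hk.memLp u).1.coeFn_toLp] with x hx
    rw [hx]

theorem SchurBound.op_apply [SFinite ρ] (hk : SchurBound ρ k h C) (u : Lp E 2 ρ) :
    hk.op u =ᵐ[ρ] fun x => ∫ y, (k x y : ℂ) • u y ∂ρ :=
  (hk.memLp u).1.coeFn_toLp

theorem SchurBound.norm_op_le [SFinite ρ] (hk : SchurBound ρ k h C) :
    ‖(hk.op : Lp E 2 ρ →L[ℂ] Lp E 2 ρ)‖ ≤ C :=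
  LinearMap.mkContinuous_norm_le _ hk.nonneg _

/-- A symmetric real kernel defines a symmetric operator. -/
theorem SchurBound.op_symm [CompleteSpace E] [SFinite ρ] (hk : SchurBound ρ k h C)
    (hsymm : ∀ x y, k x y = k y x)
    (u v : Lp E 2 ρ) : inner ℂ (hk.op u) v = inner ℂ u (hk.op v) := by
  have hu := Lp.stronglyMeasurable u
  have hv := Lp.stronglyMeasurable v
  set G : X × X → ℂ := fun z => (k z.1 z.2 : ℂ) * inner ℂ (u z.2) (v z.1) with hG
  have hkm : Measurable fun z : X × X => (k z.1 z.2 : ℂ) :=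
    Complex.measurable_ofReal.comp hk.measurable_kernel
  have hGm : StronglyMeasurable G :=
    hkm.stronglyMeasurable.mul ((hu.comp_measurable measurable_snd).inner
      (hv.comp_measurable measurable_fst))
  have hkx : ∀ x, Measurable fun y => ENNReal.ofReal |k x y| * ‖u y‖ₑ := fun x =>
    (ENNReal.measurable_ofReal.comp (measurable_abs.comp
      (hk.measurable_kernel.comp measurable_prodMk_left))).mul hu.enorm
  have hGi : Integrable G (ρ.prod ρ) := by
    refine ⟨hGm.aestronglyMeasurable, ?_⟩
    rw [hasFiniteIntegral_iff_enorm, lintegral_prod _ hGm.enorm.aemeasurable]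
    have h1 : ∀ x, ∫⁻ y, ‖G (x, y)‖ₑ ∂ρ ≤
        ‖v x‖ₑ * ∫⁻ y, ENNReal.ofReal |k x y| * ‖u y‖ₑ ∂ρ := fun x => by
      rw [← lintegral_const_mul _ (hkx x)]
      refine lintegral_mono fun y => ?_
      rw [hG, enorm_mul, ← ofReal_norm, Complex.norm_real, Real.norm_eq_abs]
      calc _ ≤ ENNReal.ofReal |k x y| * (‖u y‖ₑ * ‖v x‖ₑ) := by
            gcongr
            rw [← ofReal_norm, ← ofReal_norm, ← ofReal_norm, ← ENNReal.ofReal_mul (norm_nonneg _)]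
            exact ENNReal.ofReal_le_ofReal (norm_inner_le_norm _ _)
        _ = _ := by ring
    set U : X → ENNReal := fun x => ∫⁻ y, ENNReal.ofReal |k x y| * ‖u y‖ₑ ∂ρ with hU
    have hUm : Measurable U := by
      refine Measurable.lintegral_prod_right' (f := fun z : X × X =>
        ENNReal.ofReal |k z.1 z.2| * ‖u z.2‖ₑ) ?_
      exact (ENNReal.measurable_ofReal.comp (measurable_abs.comp hk.measurable_kernel)).mul
        (hu.enorm.comp measurable_snd)
    have h2 := lintegral_sqrt_mul_sq_le (ρ := ρ) (hv.enorm.pow_const 2).aemeasurable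
      (hUm.pow_const 2).aemeasurable
    have h3 : ∀ x, (‖v x‖ₑ ^ 2 * U x ^ 2) ^ (1 / 2 : ℝ) = ‖v x‖ₑ * U x := fun x => by
      rw [← mul_pow, ← ENNReal.rpow_two, ← ENNReal.rpow_mul]
      norm_num
    simp only [h3] at h2
    have h4 : (∫⁻ x, ‖v x‖ₑ ^ 2 ∂ρ) * ∫⁻ x, U x ^ 2 ∂ρ < ⊤ :=
      ENNReal.mul_lt_top (lintegral_enorm_sq_lt_top v) ((hk.lintegral_sq_le hu.enorm).trans_lt
        (ENNReal.mul_lt_top (by simp) (lintegral_enorm_sq_lt_top u)))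
    refine (lintegral_mono h1).trans_lt ?_
    by_contra hcon
    rw [not_lt, top_le_iff] at hcon
    rw [hcon] at h2
    simp at h2
    exact h4.ne h2
  rw [L2.inner_def, L2.inner_def]
  have e1 : ∀ᵐ x ∂ρ, inner ℂ (hk.op u x) (v x) = ∫ y, G (x, y) ∂ρ := by
    filter_upwards [hk.op_apply u, hk.ae_integrable u] with x hx hi
    rw [hx, ← inner_conj_symm, ← integral_inner hi, ← integral_conj]
    refine integral_congr_ae (.of_forall fun y => ?_)
    simp only [hG]
    rw [inner_conj_symm, inner_smul_left, Complex.conj_ofReal]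
  have e2 : ∀ᵐ y ∂ρ, inner ℂ (u y) (hk.op v y) = ∫ x, G (x, y) ∂ρ := by
    filter_upwards [hk.op_apply v, hk.ae_integrable v] with y hy hi
    rw [hy, ← integral_inner hi]
    refine integral_congr_ae (.of_forall fun x => ?_)
    simp only [hG]
    rw [inner_smul_right, hsymm]
  rw [integral_congr_ae e1, integral_congr_ae e2]
  exact integral_integral_swap hGi

end Schur

end

noncomputable section

/-! ### The kernels of `T_λ` and `W_λ` in a sector -/

namespace Params
variable (P : Params)

/-- The energy scale `√(ν r² + λ)` at momentum of modulus `r`. -/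
def wt (r : ℝ) : ℝ := √(P.nu * r ^ 2 + P.lam)

/-- The angle-independent part `r² + s² + λ` of the denominator. -/
def amp (r s : ℝ) : ℝ := r ^ 2 + s ^ 2 + P.lam

/-- The relative size `μ r s / (r² + s² + λ)` of the angular part of the denominator. -/
def ratio (r s : ℝ) : ℝ := P.mu * r * s / P.amp r s

/-- The kernel of `ξ̂ ↦ ∫ ξ̂(q) / (p² + q² + μ p·q + λ) dq` on radial functions, in the sector of
angular symmetry `l` and with respect to `s² ds`. -/
def lamT (l : ℕ) (r s : ℝ) : ℝ := 4 * Real.pi / P.amp r s * zonal coeffT l (P.ratio r s)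

/-- The kernel of `ξ̂ ↦ ∫ ξ̂(q) / (p² + q² + μ p·q + λ)² dq` on radial functions, in the sector of
angular symmetry `l` and with respect to `s² ds`. -/
def lamW (l : ℕ) (r s : ℝ) : ℝ := 4 * Real.pi / P.amp r s ^ 2 * zonal coeffW l (P.ratio r s)

theorem amp_pos (r s : ℝ) : 0 < P.amp r s := by
  have := P.lam_pos
  unfold amp; positivity

theorem wt_pos (r : ℝ) : 0 < P.wt r := by
  have := P.lam_pos
  have := P.nu_pos
  exact Real.sqrt_pos.2 (by positivity)

theorem wt_sq (r : ℝ) : P.wt r ^ 2 = P.nu * r ^ 2 + P.lam := by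
  have := P.lam_pos
  have := P.nu_pos
  exact Real.sq_sqrt (by positivity)

theorem continuous_wt : Continuous P.wt := by
  unfold wt; fun_prop

theorem nu_le_one : P.nu ≤ 1 := by
  unfold nu; nlinarith [sq_nonneg P.mu]

theorem nu_eq : P.nu = 1 - (P.mu / 2) ^ 2 := by
  unfold nu; ring

theorem sqrt_lam_le_wt (r : ℝ) : √P.lam ≤ P.wt r :=
  Real.sqrt_le_sqrt (by have := P.nu_pos; nlinarith [sq_nonneg r])

theorem sqrt_nu_mul_le_wt {r : ℝ} (hr : 0 ≤ r) : √P.nu * r ≤ P.wt r := by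
  have := P.lam_pos
  have h := P.nu_pos
  rw [← Real.sqrt_sq hr, ← Real.sqrt_mul h.le, Real.sqrt_sq hr]
  exact Real.sqrt_le_sqrt (by linarith)

theorem wt_mul_le_amp (r s : ℝ) : P.wt r * r ≤ P.amp r s := by
  have h1 := P.wt_sq r
  have h2 := P.nu_le_one
  have := P.lam_pos
  unfold amp
  nlinarith [sq_nonneg (P.wt r - r), sq_nonneg r, sq_nonneg s]

theorem amp_comm (r s : ℝ) : P.amp r s = P.amp s r := by
  unfold amp; ring

theorem ratio_comm (r s : ℝ) : P.ratio r s = P.ratio s r := by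
  unfold ratio
  rw [P.amp_comm]; ring

theorem lamT_comm (l : ℕ) (r s : ℝ) : P.lamT l r s = P.lamT l s r := by
  unfold lamT
  rw [P.amp_comm, P.ratio_comm]

theorem lamW_comm (l : ℕ) (r s : ℝ) : P.lamW l r s = P.lamW l s r := by
  unfold lamW
  rw [P.amp_comm, P.ratio_comm]

theorem abs_ratio_le (r s : ℝ) : |P.ratio r s| ≤ P.mu / 2 := by
  have h := P.amp_pos r s
  have := P.mu_pos
  have := P.lam_pos
  unfold ratio
  rw [abs_div, abs_of_pos h, div_le_iff₀ h, mul_assoc, abs_mul, abs_of_pos P.mu_pos]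
  have h2 : 2 * |r * s| ≤ P.amp r s := by
    unfold amp
    rw [abs_mul]
    nlinarith [sq_abs r, sq_abs s, sq_nonneg (|r| - |s|)]
  nlinarith

theorem abs_ratio_lt (r s : ℝ) : |P.ratio r s| < 1 :=
  (P.abs_ratio_le r s).trans_lt (by linarith [P.mu_lt_two])

theorem ratio_nonneg {r s : ℝ} (hr : 0 ≤ r) (hs : 0 ≤ s) : 0 ≤ P.ratio r s := by
  have := P.amp_pos r s
  have := P.mu_pos
  unfold ratio; positivity

theorem nu_le_one_sub_ratio_sq (r s : ℝ) : P.nu ≤ 1 - P.ratio r s ^ 2 := by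
  have := sq_le_sq.2 ((P.abs_ratio_le r s).trans (le_abs_self _))
  rw [P.nu_eq]; linarith

theorem den_smul_smul {η ω : R3} (hη : ‖η‖ = 1) (hω : ‖ω‖ = 1) (r s : ℝ) :
    P.den (r • η) (s • ω) = P.amp r s * (1 + P.ratio r s * inner ℝ η ω) := by
  have h := (P.amp_pos r s).ne'
  have e : P.amp r s * P.ratio r s = P.mu * r * s := by
    unfold ratio; field_simp
  rw [mul_add, ← mul_assoc, e, mul_one]
  unfold den amp
  rw [norm_smul, norm_smul, hη, hω, inner_smul_left, inner_smul_right]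
  simp
  ring

theorem integral_sphere_div_den {η : R3} (hη : ‖η‖ = 1) {l : ℕ} {Y : MvPolynomial (Fin 3) ℂ}
    (hY : Y ∈ harmonicPolys l) (r s : ℝ) :
    ∫ ω : Sph, polyEval Y ω / (P.den (r • η) (s • (ω : R3)) : ℂ) ∂surf =
      (P.lamT l r s : ℂ) * polyEval Y η := by
  have h1 := funkHecke hη hY abs_coeffT_le (P.abs_ratio_lt r s)
    (fun y hy => hasSum_coeffT hy)
  have h2 : ∀ ω : Sph, polyEval Y ω / (P.den (r • η) (s • (ω : R3)) : ℂ) =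
      ((P.amp r s)⁻¹ : ℂ) * (polyEval Y ω *
        (((1 + P.ratio r s * inner ℝ η (ω : R3))⁻¹ : ℝ) : ℂ)) := fun ω => by
    rw [P.den_smul_smul hη (by simp)]
    push_cast
    rw [div_eq_mul_inv, mul_inv]
    ring
  simp only [h2]
  rw [integral_const_mul, h1]
  unfold lamT
  push_cast
  ring

theorem integral_sphere_div_den_sq {η : R3} (hη : ‖η‖ = 1) {l : ℕ} {Y : MvPolynomial (Fin 3) ℂ}
    (hY : Y ∈ harmonicPolys l) (r s : ℝ) :
    ∫ ω : Sph, polyEval Y ω / (P.den (r • η) (s • (ω : R3)) : ℂ) ^ 2 ∂surf =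
      (P.lamW l r s : ℂ) * polyEval Y η := by
  have h1 := funkHecke hη hY abs_coeffW_le (P.abs_ratio_lt r s)
    (fun y hy => hasSum_coeffW hy)
  have h2 : ∀ ω : Sph, polyEval Y ω / (P.den (r • η) (s • (ω : R3)) : ℂ) ^ 2 =
      ((P.amp r s ^ 2)⁻¹ : ℂ) * (polyEval Y ω *
        ((((1 + P.ratio r s * inner ℝ η (ω : R3)) ^ 2)⁻¹ : ℝ) : ℂ)) := fun ω => by
    rw [P.den_smul_smul hη (by simp)]
    push_cast
    rw [div_eq_mul_inv, mul_pow, mul_inv]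
    ring
  simp only [h2]
  rw [integral_const_mul, h1]
  unfold lamW
  push_cast
  ring

theorem measurable_zonal_ratio {c : ℕ → ℝ} (hc : ∀ n, |c n| ≤ n + 1) (l : ℕ) :
    Measurable fun z : ℝ × ℝ => zonal c l (P.ratio z.1 z.2) := by
  have hr : Measurable fun z : ℝ × ℝ => P.ratio z.1 z.2 := by
    unfold ratio amp
    fun_prop
  refine measurable_of_tendsto_metrizable (f := fun N z =>
    ∑ n ∈ Finset.range N, c n * legendreMoment n l * P.ratio z.1 z.2 ^ n)
    (fun N => Finset.measurable_sum _ fun n _ => (hr.pow_const n).const_mul _) ?_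
  rw [tendsto_pi_nhds]
  intro z
  exact (summable_zonal hc l (P.abs_ratio_lt z.1 z.2)).hasSum.tendsto_sum_nat

theorem measurable_lamT (l : ℕ) : Measurable fun z : ℝ × ℝ => P.lamT l z.1 z.2 := by
  unfold lamT
  have := P.measurable_zonal_ratio abs_coeffT_le l
  refine Measurable.mul ?_ this
  unfold amp
  fun_prop

theorem measurable_lamW (l : ℕ) : Measurable fun z : ℝ × ℝ => P.lamW l z.1 z.2 := by
  unfold lamW
  have := P.measurable_zonal_ratio abs_coeffW_le l
  refine Measurable.mul ?_ this
  unfold amp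
  fun_prop

/-- For every `l ≥ 1` the kernel of `W_λ` is dominated by `μ / 2` times the positive kernel of the
sector `l = 0`. -/
theorem abs_lamW_succ_le (l : ℕ) {r s : ℝ} (hr : 0 ≤ r) (hs : 0 ≤ s) :
    |P.lamW (l + 1) r s| ≤ P.mu / 2 * P.lamW 0 r s := by
  have h := P.amp_pos r s
  have h1 := P.nu_le_one_sub_ratio_sq r s
  have h2 := P.nu_pos
  have h3 : 0 < 1 - P.ratio r s ^ 2 := by linarith
  have h4 := P.ratio_nonneg hr hs
  have h5 := (le_abs_self _).trans (P.abs_ratio_lt r s).le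
  unfold lamW
  rw [abs_mul, abs_of_pos (by positivity), zonal_coeffW_zero (P.abs_ratio_lt r s)]
  calc _ ≤ 4 * Real.pi / P.amp r s ^ 2 * (P.ratio r s / (1 - P.ratio r s ^ 2)) := by
        gcongr
        exact abs_zonal_le_odd abs_coeffW_le l h4 ((le_abs_self _).trans_lt (P.abs_ratio_lt r s))
    _ ≤ 4 * Real.pi / P.amp r s ^ 2 * (P.mu / 2 / (1 - P.ratio r s ^ 2)) := by
        gcongr
        exact (le_abs_self _).trans (P.abs_ratio_le r s)
    _ = _ := by ring

theorem abs_lamT_succ_le (l : ℕ) {r s : ℝ} (hr : 0 ≤ r) (hs : 0 ≤ s) :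
    |P.lamT (l + 1) r s| ≤ 4 * Real.pi * P.mu / P.nu * (r * s / P.amp r s ^ 2) := by
  have h := P.amp_pos r s
  have h1 := P.nu_le_one_sub_ratio_sq r s
  have h2 := P.nu_pos
  have h4 := P.ratio_nonneg hr hs
  unfold lamT
  rw [abs_mul, abs_of_pos (by positivity)]
  calc _ ≤ 4 * Real.pi / P.amp r s * (P.ratio r s / (1 - P.ratio r s ^ 2)) := by
        gcongr
        exact abs_zonal_le_odd abs_coeffT_le l h4 ((le_abs_self _).trans_lt (P.abs_ratio_lt r s))
    _ ≤ 4 * Real.pi / P.amp r s * (P.ratio r s / P.nu) := by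
        gcongr
    _ = _ := by
        unfold ratio
        field_simp

/-- The total mass of the kernel of `W_λ` at `r`, obtained from the sector `l = 0`, where it is the
integral of `1 / den²` over `ℝ³`. -/
theorem lintegral_lamW_zero {r : ℝ} :
    ∫⁻ s, ENNReal.ofReal (P.lamW 0 r s) ∂radialMeasure = ENNReal.ofReal (Real.pi ^ 2 / P.wt r) := by
  set η : R3 := EuclideanSpace.single 0 1 with hη'
  have hη : ‖η‖ = 1 := by simp [hη']
  obtain ⟨h1, h2⟩ := P.integral_den (r • η)
  have h3 : ‖r • η‖ ^ 2 = r ^ 2 := by rw [norm_smul, hη]; simp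
  rw [h3] at h2
  change _ = Real.pi ^ 2 / P.wt r at h2
  rw [← h2, ofReal_integral_eq_lintegral_ofReal h1 (.of_forall fun q => by positivity),
    lintegral_polar]
  · refine lintegral_congr fun s => ?_
    have hc : Continuous fun ω : Sph => (P.den (r • η) (s • (ω : R3)) ^ 2)⁻¹ := by
      refine Continuous.inv₀ ?_ fun ω => (pow_pos (P.den_pos _ _) 2).ne'
      unfold den
      fun_prop
    have hi : Integrable (fun ω : Sph => (P.den (r • η) (s • (ω : R3)) ^ 2)⁻¹) surf := by
      have := (integrable_of_continuous_sphere (Complex.continuous_ofReal.comp hc)).re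
      exact this
    rw [← ofReal_integral_eq_lintegral_ofReal hi (.of_forall fun q => by positivity)]
    congr 1
    have h4 := P.integral_sphere_div_den_sq hη (l := 0) (Y := 1)
      ⟨MvPolynomial.isHomogeneous_one _ _, by simp⟩ r s
    have h5 : ∀ ω : Sph, polyEval 1 (ω : R3) / (P.den (r • η) (s • (ω : R3)) : ℂ) ^ 2 =
        (((P.den (r • η) (s • (ω : R3)) ^ 2)⁻¹ : ℝ) : ℂ) := fun ω => by
      simp
    simp only [h5] at h4
    rw [integral_complex_ofReal] at h4
    simp only [polyEval_one, mul_one] at h4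
    exact_mod_cast h4.symm
  · have : Continuous fun q : R3 => P.den (r • η) q := by
      unfold den; fun_prop
    exact ((this.measurable.pow_const 2).inv).ennreal_ofReal

end Params

end

noncomputable section

/-! ### Schur bounds for the kernels -/

theorem lintegral_inv_sq_add_sq {r : ℝ} (hr : 0 < r) :
    ∫⁻ s in Set.Ioi (0 : ℝ), ENNReal.ofReal (1 / (r ^ 2 + s ^ 2)) =
      ENNReal.ofReal (Real.pi / 2 / r) := by
  have h1 : ∀ s : ℝ, HasDerivAt (fun s => Real.arctan (s / r) / r) (1 / (r ^ 2 + s ^ 2)) s := by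
    intro s
    refine (((hasDerivAt_id s).div_const r).arctan.div_const r).congr_deriv ?_
    simp only [id]
    field_simp
  have h2 : Tendsto (fun s => Real.arctan (s / r) / r) atTop (𝓝 (Real.pi / 2 / r)) :=
    ((Real.tendsto_arctan_atTop.mono_right nhdsWithin_le_nhds).comp
      (tendsto_id.atTop_div_const hr)).div_const r
  rw [lintegral_Ioi_of_hasDerivAt h1 (fun s _ => by positivity) h2]
  simp

namespace Params
variable (P : Params)

theorem mu_half_eq : P.mu / 2 = 1 / (P.mass + 1) := by
  have := P.mass_pos
  unfold mu; field_simp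

/-- The origin of the condition `Λ(m) < 1`. The kernel is bounded by dropping `λ` and by an integral
over `t ∈ (0, 1]`; with the integrals exchanged, the one over `s` is elementary and the one over `t`
is the integral representation of `Λ`. -/
theorem lintegral_lamT_le (l : ℕ) {r : ℝ} (hr : 0 < r) :
    ∫⁻ s in Set.Ioi (0 : ℝ), ENNReal.ofReal |P.lamT (l + 1) r s| ≤
      ENNReal.ofReal (2 * Real.pi ^ 2 * √P.nu * efimov P.mass / r) := by
  have hmu := P.mu_pos
  have hmu2 := P.mu_lt_two
  have hnu := P.nu_pos
  have hpos : ∀ s ∈ Set.Ioi (0 : ℝ), ∀ t ∈ Set.Ioc (0 : ℝ) 1,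
      0 < (r ^ 2 + s ^ 2) ^ 2 - (P.mu * t * r * s) ^ 2 := by
    intro s hs t ht
    have hs : 0 < s := hs
    have h1 : P.mu * t < 2 := by nlinarith [ht.1, ht.2]
    have h2 : P.mu * t * (r * s) < r ^ 2 + s ^ 2 := by nlinarith [sq_nonneg (r - s), mul_pos hr hs]
    have h3 : 0 < P.mu * t * r * s := by have := ht.1; positivity
    nlinarith
  have key : ∀ s ∈ Set.Ioi (0 : ℝ), ENNReal.ofReal |P.lamT (l + 1) r s| ≤
      ∫⁻ t in Set.Ioc (0 : ℝ) 1, ENNReal.ofReal (4 * Real.pi * t) *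
        ENNReal.ofReal (P.mu * t * r * s / ((r ^ 2 + s ^ 2) ^ 2 - (P.mu * t * r * s) ^ 2)) := by
    intro s hs
    have hs' : 0 < s := hs
    have ha := P.amp_pos r s
    have hx0 := P.ratio_nonneg hr.le hs'.le
    have hx1 := (le_abs_self _).trans_lt (P.abs_ratio_lt r s)
    unfold lamT
    rw [abs_mul, abs_of_pos (by positivity), ENNReal.ofReal_mul (by positivity)]
    refine (mul_le_mul_right (ofReal_abs_zonal_coeffT_le l hx0 hx1) _).trans ?_
    rw [← lintegral_const_mul' _ _ ENNReal.ofReal_ne_top]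
    refine lintegral_mono_ae ((ae_restrict_iff' measurableSet_Ioc).2 (.of_forall fun t ht => ?_))
    have ht0 := ht.1
    rw [← ENNReal.ofReal_mul (by positivity), ← ENNReal.ofReal_mul (by positivity)]
    refine ENNReal.ofReal_le_ofReal ?_
    have h1 := hpos s hs t ht
    have h2 : (r ^ 2 + s ^ 2) ^ 2 ≤ P.amp r s ^ 2 := by
      have := P.lam_pos
      unfold amp
      exact pow_le_pow_left₀ (by positivity) (by linarith) 2
    have e : 4 * Real.pi / P.amp r s * (P.ratio r s * t ^ 2 / (1 - P.ratio r s ^ 2 * t ^ 2)) =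
        4 * Real.pi * t * (P.mu * t * r * s / (P.amp r s ^ 2 - (P.mu * t * r * s) ^ 2)) := by
      have h3 : (0 : ℝ) < P.amp r s ^ 2 - (P.mu * t * r * s) ^ 2 := by linarith
      have h4 : 1 - P.ratio r s ^ 2 * t ^ 2 =
          (P.amp r s ^ 2 - (P.mu * t * r * s) ^ 2) / P.amp r s ^ 2 := by
        unfold ratio; field_simp
      rw [h4]
      unfold ratio
      field_simp
    rw [e]
    gcongr
  have hmeas : Measurable (Function.uncurry fun (s t : ℝ) => ENNReal.ofReal (4 * Real.pi * t) *
      ENNReal.ofReal (P.mu * t * r * s / ((r ^ 2 + s ^ 2) ^ 2 - (P.mu * t * r * s) ^ 2))) := by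
    unfold Function.uncurry
    fun_prop
  refine (lintegral_mono_ae ((ae_restrict_iff' measurableSet_Ioi).2 (.of_forall key))).trans ?_
  rw [lintegral_lintegral_swap hmeas.aemeasurable]
  have h5 : ∀ t ∈ Set.Ioc (0 : ℝ) 1, ∫⁻ s in Set.Ioi (0 : ℝ), ENNReal.ofReal (4 * Real.pi * t) *
      ENNReal.ofReal (P.mu * t * r * s / ((r ^ 2 + s ^ 2) ^ 2 - (P.mu * t * r * s) ^ 2)) =
      ENNReal.ofReal (4 * Real.pi / r * (t * (Real.arcsin (1 / (P.mass + 1) * t) /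
        √(1 - (1 / (P.mass + 1) * t) ^ 2)))) := by
    intro t ht
    have ht0 := ht.1
    rw [lintegral_const_mul' _ _ ENNReal.ofReal_ne_top,
      lintegral_radial_kernel (b := P.mu * t) (by positivity) (by nlinarith [ht.2]) hr,
      ← ENNReal.ofReal_mul (by positivity), ← P.mu_half_eq]
    congr 1
    have : P.mu * t / 2 = P.mu / 2 * t := by ring
    rw [this]
    ring
  rw [setLIntegral_congr_fun measurableSet_Ioc h5]
  have hc0 : 0 ≤ 1 / (P.mass + 1) := by rw [← P.mu_half_eq]; positivity
  have hc1 : 1 / (P.mass + 1) < 1 := by rw [← P.mu_half_eq]; linarith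
  have hI : IntegrableOn (fun t : ℝ => 4 * Real.pi / r * (t * (Real.arcsin (1 / (P.mass + 1) * t) /
        √(1 - (1 / (P.mass + 1) * t) ^ 2)))) (Set.Ioc 0 1) :=
    (((continuousOn_arcsin_kernel hc0 hc1).integrableOn_Icc).mono_set
      Set.Ioc_subset_Icc_self).const_mul _
  rw [← ofReal_integral_eq_lintegral_ofReal hI]
  · refine ENNReal.ofReal_le_ofReal (le_of_eq ?_)
    rw [integral_const_mul, ← intervalIntegral.integral_of_le zero_le_one, efimov_eq P.mass_pos,
      ← P.mu_half_eq, ← P.nu_eq]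
    have : 0 < √P.nu := Real.sqrt_pos.2 hnu
    set I := ∫ t in (0 : ℝ)..1, t * (Real.arcsin (P.mu / 2 * t) / √(1 - (P.mu / 2 * t) ^ 2))
    field_simp
    ring
  · refine (ae_restrict_iff' measurableSet_Ioc).2 (.of_forall fun t ht => ?_)
    have ht0 := ht.1
    have : 0 ≤ Real.arcsin (1 / (P.mass + 1) * t) := Real.arcsin_nonneg.2 (by positivity)
    simp only [Pi.zero_apply]
    positivity

/-- The kernel of the integral part of `W_λ` between the weighted spaces. -/
def kerW (l : ℕ) (r s : ℝ) : ℝ := √(P.wt r) * √(P.wt s) * P.lamW l r s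

/-- The kernel of the integral part of `T_λ` between the weighted spaces. -/
def kerT (l : ℕ) (r s : ℝ) : ℝ := P.lamT l r s / (√(P.wt r) * √(P.wt s))

/-- The kernel of the integral part of `T_λ`, as an operator from `H^{3/2}_ℓ` to `H^{1/2}_ℓ`. -/
def kerS (l : ℕ) (r s : ℝ) : ℝ := √(P.wt r) * P.lamT l r s / (P.wt s * √(P.wt s))

theorem sqrt_wt_pos (r : ℝ) : 0 < √(P.wt r) := Real.sqrt_pos.2 (P.wt_pos r)

theorem kerW_comm (l : ℕ) (r s : ℝ) : P.kerW l r s = P.kerW l s r := by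
  unfold kerW
  rw [P.lamW_comm]; ring

theorem kerT_comm (l : ℕ) (r s : ℝ) : P.kerT l r s = P.kerT l s r := by
  unfold kerT
  rw [P.lamT_comm]; ring

/-- Schur's test for the weight `w^{-1/2}`, where `w = √(ν r² + λ)`: the total mass of the kernel of
the sector `l = 0` is `π² / w(r)`. -/
theorem schurBound_kerW (l : ℕ) :
    SchurBound radialMeasure (P.kerW (l + 1)) (fun r => 1 / √(P.wt r))
      (P.mu / 2 * Real.pi ^ 2) := by
  have hmu := P.mu_pos
  have hw := P.continuous_wt.measurable
  have right : ∀ᵐ r ∂radialMeasure, ∫⁻ s, ENNReal.ofReal (|P.kerW (l + 1) r s| * (1 / √(P.wt s)))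
      ∂radialMeasure ≤ ENNReal.ofReal (P.mu / 2 * Real.pi ^ 2 * (1 / √(P.wt r))) := by
    filter_upwards [ae_radial_pos] with r hr
    have h1 : ∀ᵐ s ∂radialMeasure, ENNReal.ofReal (|P.kerW (l + 1) r s| * (1 / √(P.wt s))) ≤
        ENNReal.ofReal (√(P.wt r) * (P.mu / 2)) * ENNReal.ofReal (P.lamW 0 r s) := by
      filter_upwards [ae_radial_pos] with s hs
      rw [← ENNReal.ofReal_mul (by positivity)]
      refine ENNReal.ofReal_le_ofReal ?_
      have h2 := P.sqrt_wt_pos s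
      have h3 := P.sqrt_wt_pos r
      unfold kerW
      rw [abs_mul, abs_of_pos (by positivity)]
      have : √(P.wt r) * √(P.wt s) * |P.lamW (l + 1) r s| * (1 / √(P.wt s)) =
          √(P.wt r) * |P.lamW (l + 1) r s| := by field_simp
      rw [this, mul_assoc]
      gcongr
      exact P.abs_lamW_succ_le l hr.le hs.le
    refine (lintegral_mono_ae h1).trans ?_
    rw [lintegral_const_mul' _ _ ENNReal.ofReal_ne_top, P.lintegral_lamW_zero,
      ← ENNReal.ofReal_mul (by positivity)]
    refine ENNReal.ofReal_le_ofReal (le_of_eq ?_)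
    have h2 := P.sqrt_wt_pos r
    nth_rw 2 [← Real.sq_sqrt (P.wt_pos r).le]
    field_simp
  refine ⟨by positivity, ?_, by fun_prop, .of_forall fun r => ?_, right, ?_⟩
  · unfold Function.uncurry kerW
    have := P.measurable_lamW (l + 1)
    fun_prop
  · have := P.sqrt_wt_pos r
    positivity
  · filter_upwards [right] with r hr
    refine (le_of_eq (lintegral_congr fun s => ?_)).trans hr
    rw [P.kerW_comm]

/-- Schur's test for the weight `r^{-3/2}`: as `w(s) ≥ √ν s`, the weight and the factors `√w` cancel
against the measure `s² ds`, and the integral of `|lamT|` with respect to `ds` remains. The constant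
is less than `2π²` if and only if `Λ(m) < 1`. -/
theorem schurBound_kerT (l : ℕ) (he : 0 ≤ efimov P.mass) :
    SchurBound radialMeasure (P.kerT (l + 1)) (fun r => 1 / (r * √r))
      (2 * Real.pi ^ 2 * efimov P.mass) := by
  have hnu := P.nu_pos
  have hw := P.continuous_wt.measurable
  have hq : ∀ r : ℝ, 0 < r → √(√P.nu) * √r ≤ √(P.wt r) := fun r hr => by
    rw [← Real.sqrt_mul (Real.sqrt_nonneg _)]
    exact Real.sqrt_le_sqrt (P.sqrt_nu_mul_le_wt hr.le)
  have hn : 0 < √(√P.nu) := Real.sqrt_pos.2 (Real.sqrt_pos.2 hnu)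
  have hm : Measurable (Function.uncurry (P.kerT (l + 1))) := by
    unfold Function.uncurry kerT
    have := P.measurable_lamT (l + 1)
    fun_prop
  have right : ∀ᵐ r ∂radialMeasure, ∫⁻ s, ENNReal.ofReal (|P.kerT (l + 1) r s| * (1 / (s * √s)))
      ∂radialMeasure ≤ ENNReal.ofReal (2 * Real.pi ^ 2 * efimov P.mass * (1 / (r * √r))) := by
    filter_upwards [ae_radial_pos] with r hr
    have hsr : 0 < √r := Real.sqrt_pos.2 hr
    rw [lintegral_radial]
    swap
    · have h0 : Measurable fun s => |P.kerT (l + 1) r s| :=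
        measurable_norm.comp (hm.of_uncurry_left (x := r))
      exact (h0.mul (by fun_prop)).ennreal_ofReal
    have h1 : ∀ s ∈ Set.Ioi (0 : ℝ), ENNReal.ofReal (s ^ 2) *
        ENNReal.ofReal (|P.kerT (l + 1) r s| * (1 / (s * √s))) ≤
        ENNReal.ofReal (1 / (√P.nu * √r)) * ENNReal.ofReal |P.lamT (l + 1) r s| := by
      intro s hs
      have hs : 0 < s := hs
      have hss : 0 < √s := Real.sqrt_pos.2 hs
      rw [← ENNReal.ofReal_mul (by positivity), ← ENNReal.ofReal_mul (by positivity)]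
      refine ENNReal.ofReal_le_ofReal ?_
      have h2 := P.sqrt_wt_pos s
      have h3 := P.sqrt_wt_pos r
      unfold kerT
      rw [abs_div, abs_of_pos (by positivity : 0 < √(P.wt r) * √(P.wt s))]
      have h4 : √P.nu * √r * √s ≤ √(P.wt r) * √(P.wt s) := by
        calc √P.nu * √r * √s = (√(√P.nu) * √r) * (√(√P.nu) * √s) := by
              nth_rw 1 [← Real.mul_self_sqrt (Real.sqrt_nonneg P.nu)]
              ring
          _ ≤ _ := mul_le_mul (hq r hr) (hq s hs) (by positivity) h3.le
      calc s ^ 2 * (|P.lamT (l + 1) r s| / (√(P.wt r) * √(P.wt s)) * (1 / (s * √s)))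
          = |P.lamT (l + 1) r s| * √s / (√(P.wt r) * √(P.wt s)) := by
            have h5 : s ^ 2 * (1 / (s * √s)) = √s := by
              rw [mul_one_div, div_eq_iff (by positivity)]
              nlinarith [Real.mul_self_sqrt hs.le]
            rw [mul_left_comm, h5]; ring
        _ ≤ |P.lamT (l + 1) r s| * √s / (√P.nu * √r * √s) := by
            gcongr
        _ = _ := by field_simp
    refine (setLIntegral_mono' measurableSet_Ioi h1).trans ?_
    rw [lintegral_const_mul' _ _ ENNReal.ofReal_ne_top]
    refine (mul_le_mul_right (P.lintegral_lamT_le l hr) _).trans ?_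
    rw [← ENNReal.ofReal_mul (by positivity)]
    refine ENNReal.ofReal_le_ofReal (le_of_eq ?_)
    have := Real.sqrt_pos.2 hnu
    field_simp
  refine ⟨by positivity, hm, by fun_prop, ?_, right, ?_⟩
  · filter_upwards [ae_radial_pos] with r hr
    positivity
  · filter_upwards [right] with r hr
    refine (le_of_eq (lintegral_congr fun s => ?_)).trans hr
    rw [P.kerT_comm]

/-- Schur's test for the weight `√w / r²`. Only the finiteness of the constant matters; it rests on
the linear vanishing of the kernel at `r = 0` and at `s = 0` for `l ≥ 1`. -/
theorem schurBound_kerS (l : ℕ) :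
    SchurBound radialMeasure (P.kerS (l + 1)) (fun r => √(P.wt r) / r ^ 2)
      (4 * Real.pi * P.mu / P.nu * (Real.pi / 2 / P.nu)) := by
  have hmu := P.mu_pos
  have hnu := P.nu_pos
  have hlam := P.lam_pos
  have hw := P.continuous_wt.measurable
  have hsn : 0 < √P.nu := Real.sqrt_pos.2 hnu
  have hm : Measurable (Function.uncurry (P.kerS (l + 1))) := by
    unfold Function.uncurry kerS
    have := P.measurable_lamT (l + 1)
    fun_prop
  set c := 4 * Real.pi * P.mu / P.nu with hc
  have hc0 : 0 < c := by positivity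
  have hamp : ∀ r s : ℝ, r ^ 2 + s ^ 2 ≤ P.amp r s := fun r s => by
    unfold amp; linarith
  refine ⟨by positivity, hm, by fun_prop, ?_, ?_, ?_⟩
  · filter_upwards [ae_radial_pos] with r hr
    have := P.sqrt_wt_pos r
    positivity
  · filter_upwards [ae_radial_pos] with r hr
    rw [lintegral_radial]
    swap
    · have h0 : Measurable fun s => |P.kerS (l + 1) r s| :=
        measurable_norm.comp (hm.of_uncurry_left (x := r))
      exact (h0.mul (by fun_prop)).ennreal_ofReal
    have h3 := P.sqrt_wt_pos r
    have h1 : ∀ s ∈ Set.Ioi (0 : ℝ), ENNReal.ofReal (s ^ 2) *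
        ENNReal.ofReal (|P.kerS (l + 1) r s| * (√(P.wt s) / s ^ 2)) ≤
        ENNReal.ofReal (√(P.wt r) * c / P.nu / r) * ENNReal.ofReal (1 / (r ^ 2 + s ^ 2)) := by
      intro s hs
      have hs : 0 < s := hs
      rw [← ENNReal.ofReal_mul (by positivity), ← ENNReal.ofReal_mul (by positivity)]
      refine ENNReal.ofReal_le_ofReal ?_
      have h2 := P.sqrt_wt_pos s
      have h2' := P.wt_pos s
      unfold kerS
      rw [abs_div, abs_mul, abs_of_pos h3, abs_of_pos (by positivity : 0 < P.wt s * √(P.wt s))]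
      have ha := P.amp_pos r s
      have h5 : P.nu * s ≤ P.wt s := by
        refine le_trans ?_ (P.sqrt_nu_mul_le_wt hs.le)
        gcongr
        refine Real.le_sqrt_of_sq_le ?_
        have := P.nu_le_one
        nlinarith
      have h6 : r ^ 2 * (r ^ 2 + s ^ 2) ≤ P.amp r s ^ 2 := by
        have := hamp r s
        nlinarith [sq_nonneg r, sq_nonneg s]
      calc s ^ 2 * (√(P.wt r) * |P.lamT (l + 1) r s| / (P.wt s * √(P.wt s)) * (√(P.wt s) / s ^ 2))
          = √(P.wt r) * |P.lamT (l + 1) r s| / P.wt s := by field_simp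
        _ ≤ √(P.wt r) * (c * (r * s / P.amp r s ^ 2)) / P.wt s := by
            gcongr
            exact P.abs_lamT_succ_le l hr.le hs.le
        _ ≤ √(P.wt r) * (c * (r * s / (r ^ 2 * (r ^ 2 + s ^ 2)))) / (P.nu * s) := by
            gcongr
        _ = _ := by field_simp
    refine (setLIntegral_mono' measurableSet_Ioi h1).trans ?_
    rw [lintegral_const_mul' _ _ ENNReal.ofReal_ne_top, lintegral_inv_sq_add_sq hr,
      ← ENNReal.ofReal_mul (by positivity)]
    refine ENNReal.ofReal_le_ofReal (le_of_eq ?_)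
    field_simp
  · filter_upwards [ae_radial_pos] with s hs
    rw [lintegral_radial]
    swap
    · have h0 : Measurable fun r => |P.kerS (l + 1) r s| :=
        measurable_norm.comp (hm.of_uncurry_right (y := s))
      exact (h0.mul (by fun_prop)).ennreal_ofReal
    have h2 := P.sqrt_wt_pos s
    have h2' := P.wt_pos s
    have h1 : ∀ r ∈ Set.Ioi (0 : ℝ), ENNReal.ofReal (r ^ 2) *
        ENNReal.ofReal (|P.kerS (l + 1) r s| * (√(P.wt r) / r ^ 2)) ≤
        ENNReal.ofReal (c * s / (P.wt s * √(P.wt s))) * ENNReal.ofReal (1 / (s ^ 2 + r ^ 2)) := by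
      intro r hr
      have hr : 0 < r := hr
      rw [← ENNReal.ofReal_mul (by positivity), ← ENNReal.ofReal_mul (by positivity)]
      refine ENNReal.ofReal_le_ofReal ?_
      have h3 := P.sqrt_wt_pos r
      have h3' := P.wt_pos r
      unfold kerS
      rw [abs_div, abs_mul, abs_of_pos h3, abs_of_pos (by positivity : 0 < P.wt s * √(P.wt s))]
      have ha := P.amp_pos r s
      have h5 := P.wt_mul_le_amp r s
      have h6 : s ^ 2 + r ^ 2 ≤ P.amp r s := by rw [add_comm]; exact hamp r s
      calc r ^ 2 * (√(P.wt r) * |P.lamT (l + 1) r s| / (P.wt s * √(P.wt s)) * (√(P.wt r) / r ^ 2))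
          = P.wt r * |P.lamT (l + 1) r s| / (P.wt s * √(P.wt s)) := by
            field_simp
            rw [Real.sq_sqrt h3'.le, mul_comm]
        _ ≤ P.wt r * (c * (r * s / P.amp r s ^ 2)) / (P.wt s * √(P.wt s)) := by
            gcongr
            exact P.abs_lamT_succ_le l hr.le hs.le
        _ = c * s * (P.wt r * r) / P.amp r s ^ 2 / (P.wt s * √(P.wt s)) := by ring
        _ ≤ c * s * P.amp r s / P.amp r s ^ 2 / (P.wt s * √(P.wt s)) := by gcongr
        _ = c * s / (P.wt s * √(P.wt s)) * (1 / P.amp r s) := by field_simp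
        _ ≤ _ := by gcongr
    refine (setLIntegral_mono' measurableSet_Ioi h1).trans ?_
    rw [lintegral_const_mul' _ _ ENNReal.ofReal_ne_top, lintegral_inv_sq_add_sq hs,
      ← ENNReal.ofReal_mul (by positivity)]
    refine ENNReal.ofReal_le_ofReal ?_
    have h7 : P.nu * s ^ 2 ≤ P.wt s ^ 2 := by rw [P.wt_sq]; linarith
    have h8 : √(P.wt s) ^ 2 = P.wt s := Real.sq_sqrt h2'.le
    calc c * s / (P.wt s * √(P.wt s)) * (Real.pi / 2 / s)
        = c * (Real.pi / 2) * (√(P.wt s) / (P.wt s ^ 2)) := by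
          field_simp
          rw [h8]
      _ ≤ c * (Real.pi / 2) * (√(P.wt s) / (P.nu * s ^ 2)) := by gcongr
      _ = _ := by field_simp

end Params

end

noncomputable section

/-! ### Expansion in spherical harmonics -/

/-- Spherical harmonics of degree `l` that are orthonormal in `L²` of the unit sphere and span all
of them, given by harmonic polynomials. -/
structure HarmonicFrame (l : ℕ) where
  card : ℕ
  poly : Fin card → MvPolynomial (Fin 3) ℂ
  mem : ∀ j, poly j ∈ harmonicPolys l
  orthonormal : ∀ i j, ∫ ω : Sph, conj (polyEval (poly i) ω) * polyEval (poly j) ω ∂surf =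
    if i = j then 1 else 0
  spans : ∀ Y ∈ harmonicPolys l, ∃ c : Fin card → ℂ,
    ∀ᵐ ω : Sph ∂surf, polyEval Y ω = ∑ j, c j * polyEval (poly j) ω

/-- The restriction of polynomials to the unit sphere, as elements of `L²`. -/
def sphereLp : MvPolynomial (Fin 3) ℂ →ₗ[ℂ] Lp ℂ 2 surf where
  toFun Y := (MemLp.of_bound (continuous_polyEval_sphere Y).aestronglyMeasurable
    (exists_polyEval_le_sphere Y).choose
    (.of_forall (exists_polyEval_le_sphere Y).choose_spec)).toLp _
  map_add' Y Z := by
    simp only [polyEval_add]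
    rfl
  map_smul' c Y := by
    simp only [polyEval_smul]
    rfl

theorem coeFn_sphereLp (Y : MvPolynomial (Fin 3) ℂ) :
    sphereLp Y =ᵐ[surf] fun ω : Sph => polyEval Y ω :=
  MemLp.coeFn_toLp (MemLp.of_bound (continuous_polyEval_sphere Y).aestronglyMeasurable
    (exists_polyEval_le_sphere Y).choose
    (.of_forall (exists_polyEval_le_sphere Y).choose_spec))

theorem finite_harmonicPolys (l : ℕ) : Module.Finite ℂ (harmonicPolys l) := by
  have h1 : Module.Finite ℂ (MvPolynomial.homogeneousSubmodule (Fin 3) ℂ l) :=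
    Module.Finite.iff_fg.2 (MvPolynomial.homogeneousSubmodule_fg _ _ l)
  have h2 : harmonicPolys l ≤ MvPolynomial.homogeneousSubmodule (Fin 3) ℂ l := fun Y hY => hY.1
  exact Submodule.finiteDimensional_of_le h2

/-- An orthonormal basis of the space of restrictions to the sphere, which is finite dimensional,
lifted to harmonic polynomials. -/
theorem nonempty_harmonicFrame (l : ℕ) : Nonempty (HarmonicFrame l) := by
  have := finite_harmonicPolys l
  set V : Submodule ℂ (Lp ℂ 2 surf) := (harmonicPolys l).map sphereLp with hV
  set e := stdOrthonormalBasis ℂ V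
  have h1 : ∀ j, ∃ Y ∈ harmonicPolys l, sphereLp Y = e j := fun j => (e j).2
  choose b hb hbe using h1
  refine ⟨⟨_, b, hb, fun i j => ?_, fun Y hY => ?_⟩⟩
  · have h2 := orthonormal_iff_ite.1 e.orthonormal i j
    rw [Submodule.coe_inner, ← hbe, ← hbe, L2.inner_def] at h2
    rw [← h2]
    refine integral_congr_ae ?_
    filter_upwards [coeFn_sphereLp (b i), coeFn_sphereLp (b j)] with ω h3 h4
    rw [h3, h4, RCLike.inner_apply, mul_comm]
  · have h2 : sphereLp Y ∈ V := ⟨Y, hY, rfl⟩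
    obtain ⟨c, h3⟩ : ∃ c : Fin _ → ℂ, sphereLp Y = ∑ j, c j • sphereLp (b j) := by
      refine ⟨fun j => e.repr ⟨_, h2⟩ j, ?_⟩
      have h4 := congrArg Subtype.val (e.sum_repr ⟨_, h2⟩)
      simp only [Submodule.coe_sum, Submodule.coe_smul, ← hbe] at h4
      exact h4.symm
    simp only [← map_smul, ← map_sum] at h3
    refine ⟨c, ?_⟩
    filter_upwards [coeFn_sphereLp Y, coeFn_sphereLp (∑ j, c j • b j)] with ω h5 h6
    rw [← h5, h3, h6, polyEval_sum]
    simp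

variable {l : ℕ} (B : HarmonicFrame l)

namespace HarmonicFrame

/-- The space of coefficient vectors. -/
abbrev Coeff : Type := EuclideanSpace ℂ (Fin B.card)

/-- The combination of the spherical harmonics with coefficients `x`. -/
def comb (x : B.Coeff) (q : R3) : ℂ := ∑ j, x j * polyEval (B.poly j) q

/-- The function on `ℝ³` with radial coefficients `g`. -/
def synth (g : ℝ → B.Coeff) (p : R3) : ℂ := B.comb (g ‖p‖) (‖p‖⁻¹ • p)

theorem continuous_comb (x : B.Coeff) : Continuous (B.comb x) :=
  continuous_finsetSum _ fun _ _ => continuous_const.mul (continuous_polyEval _)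

theorem comb_add (x y : B.Coeff) (q : R3) : B.comb (x + y) q = B.comb x q + B.comb y q := by
  simp [comb, add_mul, Finset.sum_add_distrib]

theorem comb_smul (c : ℂ) (x : B.Coeff) (q : R3) : B.comb (c • x) q = c * B.comb x q := by
  simp [comb, Finset.mul_sum, mul_assoc]

/-- Parseval's identity on the sphere. -/
theorem integral_conj_comb_mul (x y : B.Coeff) :
    ∫ ω : Sph, conj (B.comb x ω) * B.comb y ω ∂surf = inner ℂ x y := by
  have h1 : ∀ ω : Sph, conj (B.comb x ω) * B.comb y ω = ∑ i, ∑ j, conj (x i) * y j *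
      (conj (polyEval (B.poly i) ω) * polyEval (B.poly j) ω) := fun ω => by
    simp only [comb, map_sum, map_mul, Finset.sum_mul_sum]
    refine Finset.sum_congr rfl fun i _ => Finset.sum_congr rfl fun j _ => ?_
    ring
  have h2 : ∀ i j, Integrable (fun ω : Sph => conj (x i) * y j *
      (conj (polyEval (B.poly i) ω) * polyEval (B.poly j) ω)) surf := fun i j =>
    (integrable_of_continuous_sphere ((Complex.continuous_conj.comp
      (continuous_polyEval_sphere _)).mul (continuous_polyEval_sphere _))).const_mul _
  simp only [h1]
  rw [integral_finsetSum _ fun i _ => integrable_finsetSum _ fun j _ => h2 i j]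
  simp only [integral_finsetSum _ fun j _ => h2 _ j, integral_const_mul, B.orthonormal,
    PiLp.inner_apply, RCLike.inner_apply]
  refine Finset.sum_congr rfl fun i _ => ?_
  simp [mul_comm]

theorem lintegral_enorm_comb_sq (x : B.Coeff) :
    ∫⁻ ω : Sph, ‖B.comb x ω‖ₑ ^ 2 ∂surf = ‖x‖ₑ ^ 2 := by
  have hc : Continuous fun ω : Sph => B.comb x ω :=
    (B.continuous_comb x).comp continuous_subtype_val
  have h1 := B.integral_conj_comb_mul x x
  simp only [Complex.conj_mul', inner_self_eq_norm_sq_to_K] at h1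
  have h2 : ∫ ω : Sph, ‖B.comb x ω‖ ^ 2 ∂surf = ‖x‖ ^ 2 := by
    rw [← Complex.ofReal_inj, ← integral_complex_ofReal]
    push_cast
    exact h1
  have hi : Integrable (fun ω : Sph => ‖B.comb x ω‖ ^ 2) surf := by
    have := (integrable_of_continuous_sphere (Complex.continuous_ofReal.comp (hc.norm.pow 2))).re
    exact this
  have h3 := ofReal_integral_eq_lintegral_ofReal hi (.of_forall fun ω => by positivity)
  rw [h2] at h3
  simp only [ENNReal.ofReal_pow (norm_nonneg _), ofReal_norm] at h3
  exact h3.symm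

variable {B}

theorem measurable_synth {g : ℝ → B.Coeff} (hg : Measurable g) : Measurable (B.synth g) := by
  unfold synth comb
  refine Finset.measurable_sum _ fun j _ => ?_
  have h1 : Measurable fun p : R3 => g ‖p‖ j :=
    (measurable_pi_iff.1 ((PiLp.continuous_ofLp 2 _).measurable.comp
      (hg.comp measurable_norm))) j
  have h2 : Measurable fun p : R3 => ‖p‖⁻¹ • p := by fun_prop
  exact h1.mul ((continuous_polyEval _).measurable.comp h2)

theorem synth_congr {g h : ℝ → B.Coeff} (H : g =ᵐ[radialMeasure] h) :
    B.synth g =ᵐ[volume] B.synth h := by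
  filter_upwards [ae_norm_of_ae_radial H] with p hp
  unfold synth
  rw [hp]

theorem synth_smul_sphere (g : ℝ → B.Coeff) {r : ℝ} (hr : 0 < r) (ω : Sph) :
    B.synth g (r • (ω : R3)) = B.comb (g r) ω := by
  have h : ‖r • (ω : R3)‖ = r := by simp [norm_smul, abs_of_pos hr]
  unfold synth
  rw [h, inv_smul_smul₀ hr.ne']

theorem lintegral_synth {g : ℝ → B.Coeff} (hg : Measurable g) {φ : ℝ → ENNReal}
    (hφ : Measurable φ) :
    ∫⁻ p : R3, φ ‖p‖ * ‖B.synth g p‖ₑ ^ 2 = ∫⁻ r, φ r * ‖g r‖ₑ ^ 2 ∂radialMeasure := by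
  have hm : Measurable fun p : R3 => φ ‖p‖ * ‖B.synth g p‖ₑ ^ 2 :=
    (hφ.comp measurable_norm).mul ((measurable_synth hg).enorm.pow_const 2)
  rw [lintegral_polar hm]
  refine lintegral_congr_ae ?_
  filter_upwards [ae_radial_pos] with r hr
  rw [← B.lintegral_enorm_comb_sq, ← lintegral_const_mul]
  · refine lintegral_congr fun ω => ?_
    rw [synth_smul_sphere g hr]
    simp [norm_smul, abs_of_pos hr]
  · exact (((B.continuous_comb _).comp continuous_subtype_val).measurable.enorm).pow_const 2

theorem integral_conj_synth_mul {g h : ℝ → B.Coeff}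
    (hi : Integrable fun p => conj (B.synth g p) * B.synth h p) :
    ∫ p, conj (B.synth g p) * B.synth h p = ∫ r, inner ℂ (g r) (h r) ∂radialMeasure := by
  rw [integral_polar hi]
  refine integral_congr_ae ?_
  filter_upwards [ae_radial_pos] with r hr
  simp only [synth_smul_sphere _ hr, integral_conj_comb_mul]

/-- An integral operator on `ℝ³` whose kernel acts on spherical harmonics by multiplication with
`k` acts on radial coefficients with the kernel `k`. -/
theorem integral_synth_mul {g : ℝ → B.Coeff} {d : R3 → ℂ} (hd : Continuous d) {k : ℝ → ℂ} {η : R3}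
    (hk : ∀ j s, ∫ ω : Sph, polyEval (B.poly j) ω * d (s • (ω : R3)) ∂surf =
      k s * polyEval (B.poly j) η)
    (hi : Integrable fun q => B.synth g q * d q)
    (hki : Integrable (fun s => k s • g s) radialMeasure) :
    ∫ q, B.synth g q * d q = B.comb (∫ s, k s • g s ∂radialMeasure) η := by
  rw [integral_polar hi]
  have h1 : ∀ᵐ s ∂radialMeasure, ∫ ω : Sph, B.synth g (s • (ω : R3)) * d (s • (ω : R3)) ∂surf =
      ∑ j, (k s • g s) j * polyEval (B.poly j) η := by
    filter_upwards [ae_radial_pos] with s hs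
    have h2 : ∀ j, Integrable (fun ω : Sph => g s j *
        (polyEval (B.poly j) ω * d (s • (ω : R3)))) surf := fun j =>
      (integrable_of_continuous_sphere ((continuous_polyEval_sphere _).mul
        (hd.comp (by fun_prop)))).const_mul _
    simp only [synth_smul_sphere _ hs, comb, Finset.sum_mul, mul_assoc]
    rw [integral_finsetSum _ fun j _ => h2 j]
    refine Finset.sum_congr rfl fun j _ => ?_
    rw [integral_const_mul, hk]
    simp
    ring
  rw [integral_congr_ae h1]
  have h3 : ∀ j, Integrable (fun s => (k s • g s) j) radialMeasure := fun j =>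
    (EuclideanSpace.proj (𝕜 := ℂ) j : B.Coeff →L[ℂ] ℂ).integrable_comp hki
  rw [integral_finsetSum _ fun j _ => (h3 j).mul_const _]
  unfold comb
  refine Finset.sum_congr rfl fun j _ => ?_
  rw [integral_mul_const]
  congr 1
  exact (EuclideanSpace.proj (𝕜 := ℂ) j : B.Coeff →L[ℂ] ℂ).integral_comp_comm hki

end HarmonicFrame

/-- A property of almost every direction holds at almost every point. -/
theorem ae_direction_of_ae_sphere {Q : R3 → Prop} (h : ∀ᵐ ω : Sph ∂surf, Q ω)
    (hm : MeasurableSet {q | Q q}) : ∀ᵐ p : R3, Q (‖p‖⁻¹ • p) := by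
  have hm' : MeasurableSet {p : R3 | Q (‖p‖⁻¹ • p)} := by
    have : Measurable fun p : R3 => ‖p‖⁻¹ • p := by fun_prop
    exact this hm
  have hn := lintegral_polar (F := {p : R3 | Q (‖p‖⁻¹ • p)}ᶜ.indicator 1)
    (measurable_one.indicator hm'.compl)
  rw [lintegral_indicator_one hm'.compl] at hn
  rw [ae_iff]
  refine hn.trans ?_
  rw [lintegral_congr_ae (g := fun _ => 0), lintegral_zero]
  filter_upwards [ae_radial_pos] with r hr
  rw [lintegral_congr_ae (g := fun _ => 0), lintegral_zero]
  filter_upwards [h] with ω hω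
  have h1 : ‖r • (ω : R3)‖ = r := by simp [norm_smul, abs_of_pos hr]
  simp [h1, inv_smul_smul₀ hr.ne', hω]

theorem polyEval_inv_norm_smul (Y : MvPolynomial (Fin 3) ℂ) (p : R3) :
    MvPolynomial.eval (fun i => ((‖p‖⁻¹ * p i : ℝ) : ℂ)) Y = polyEval Y (‖p‖⁻¹ • p) := rfl

/-- Functions of angular symmetry `l` are, up to null sets, those with measurable radial
coefficients. -/
theorem HarmonicFrame.exists_synth {f : R3 → ℂ} (hf : f ∈ sectorFunctions l) :
    ∃ g : ℝ → B.Coeff, Measurable g ∧ f =ᵐ[volume] B.synth g := by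
  unfold sectorFunctions at hf
  induction hf using Submodule.span_induction with
  | mem f hf =>
    obtain ⟨g, hg, Y, hY, rfl⟩ := hf
    obtain ⟨c, hc⟩ := B.spans Y hY
    refine ⟨fun r => g r • WithLp.toLp 2 c, hg.smul_const _, ?_⟩
    have h1 := ae_direction_of_ae_sphere (Q := fun q => polyEval Y q =
      ∑ j, c j * polyEval (B.poly j) q) hc
      (measurableSet_eq_fun (continuous_polyEval _).measurable
        (continuous_finsetSum _ fun j _ =>
          continuous_const.mul (continuous_polyEval _)).measurable)
    filter_upwards [h1] with p hp
    rw [polyEval_inv_norm_smul, hp]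
    simp [HarmonicFrame.synth, HarmonicFrame.comb, Finset.mul_sum, mul_assoc]
  | zero => exact ⟨0, measurable_zero, .of_forall fun p => by
      simp [HarmonicFrame.synth, HarmonicFrame.comb]⟩
  | add f₁ f₂ _ _ h₁ h₂ =>
    obtain ⟨g₁, hg₁, h₁⟩ := h₁
    obtain ⟨g₂, hg₂, h₂⟩ := h₂
    refine ⟨g₁ + g₂, hg₁.add hg₂, ?_⟩
    filter_upwards [h₁, h₂] with p hp₁ hp₂
    rw [Pi.add_apply, hp₁, hp₂]
    simp [HarmonicFrame.synth, HarmonicFrame.comb_add]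
  | smul c f _ h =>
    obtain ⟨g, hg, h⟩ := h
    refine ⟨c • g, hg.const_smul c, ?_⟩
    filter_upwards [h] with p hp
    rw [Pi.smul_apply, hp]
    simp [HarmonicFrame.synth, HarmonicFrame.comb_smul]

theorem HarmonicFrame.synth_mem_sectorFunctions {g : ℝ → B.Coeff} (hg : Measurable g) :
    B.synth g ∈ sectorFunctions l := by
  have h : B.synth g = ∑ j, fun p => g ‖p‖ j * MvPolynomial.eval
      (fun i => ((‖p‖⁻¹ * p i : ℝ) : ℂ)) (B.poly j) := by
    ext p
    simp only [Finset.sum_apply, polyEval_inv_norm_smul]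
    rfl
  rw [h]
  refine Submodule.sum_mem _ fun j _ => Submodule.subset_span ⟨fun r => g r j, ?_, _, B.mem j, rfl⟩
  exact (measurable_pi_iff.1 ((PiLp.continuous_ofLp 2 _).measurable.comp hg)) j

end

noncomputable section

/-! ### Fourier transforms of Sobolev distributions -/

/-- Every function that is square integrable with the weight of `H^s` is the Fourier transform of an
element of `H^s`. -/
theorem exists_hasMomentum {f : R3 → ℂ} (hf : AEStronglyMeasurable f volume) {s : ℝ}
    (h : Integrable (fun p : R3 => (1 + ‖(2 * Real.pi)⁻¹ • p‖ ^ 2) ^ s * ‖f p‖ ^ 2) volume) :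
    ∃ ξ : 𝓢'(R3, ℂ), HasMomentum ξ f ∧ TemperedDistribution.MemSobolev s 2 ξ := by
  have hc : (2 * Real.pi) ≠ 0 := by positivity
  have hc' : (2 * Real.pi)⁻¹ ≠ 0 := inv_ne_zero hc
  -- the weighted function at `k = p / 2π`, normalised so that its Plancherel constant is one
  set a : ℝ := (2 * Real.pi) ^ (3 / 2 : ℝ) with ha
  set G₀ : R3 → ℂ := fun k =>
    ((a * (1 + ‖k‖ ^ 2) ^ (s / 2) : ℝ) : ℂ) * f ((2 * Real.pi) • k) with hG₀
  have hwc : ∀ t : ℝ, Continuous fun k : R3 => (1 + ‖k‖ ^ 2) ^ t := fun t =>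
    Continuous.rpow_const (by fun_prop) fun k => Or.inl (by positivity)
  have hfm : AEStronglyMeasurable (fun k : R3 => f ((2 * Real.pi) • k)) volume :=
    hf.comp_quasiMeasurePreserving (Measure.quasiMeasurePreserving_smul volume hc)
  have hG₀m : AEStronglyMeasurable G₀ volume :=
    (Complex.continuous_ofReal.comp (continuous_const.mul (hwc _))).aestronglyMeasurable.mul hfm
  have hG₂ : MemLp G₀ 2 volume := by
    rw [memLp_two_iff_integrable_sq_norm hG₀m]
    refine ((h.comp_smul hc).const_mul (a ^ 2)).congr (.of_forall fun k => ?_)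
    simp only [hG₀]
    rw [inv_smul_smul₀ hc, norm_mul, Complex.norm_real, mul_pow, Real.norm_eq_abs, sq_abs, mul_pow,
      ← Real.rpow_natCast ((1 + ‖k‖ ^ 2) ^ (s / 2)), ← Real.rpow_mul (by positivity)]
    norm_num
    ring
  set G := hG₂.toLp G₀ with hG
  have hGae : G =ᵐ[volume] G₀ := hG₂.coeFn_toLp
  set u : 𝓢'(R3, ℂ) := TemperedDistribution.smulLeftCLM ℂ
    (fun x : R3 => (((1 + ‖x‖ ^ 2) ^ (-s / 2) : ℝ) : ℂ)) (Lp.toTemperedDistribution G) with hu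
  have hinv : ∀ (t : ℝ) (k : R3), (((1 + ‖k‖ ^ 2) ^ (-t / 2) : ℝ) : ℂ) *
      (((1 + ‖k‖ ^ 2) ^ (t / 2) : ℝ) : ℂ) = 1 := fun t k => by
    rw [← Complex.ofReal_mul, ← Real.rpow_add (by positivity), neg_div, neg_add_cancel,
      Real.rpow_zero, Complex.ofReal_one]
  have hprod : ∀ (φ : 𝓢(R3, ℂ)), Integrable (fun k => φ k * f ((2 * Real.pi) • k)) volume := by
    intro φ
    set ψ := SchwartzMap.smulLeftCLM ℂ
      (fun x : R3 => (((1 + ‖x‖ ^ 2) ^ (-s / 2) : ℝ) : ℂ)) φ with hψ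
    have h1 : Integrable (fun k => ψ k * G₀ k) volume := (ψ.memLp 2).integrable_mul hG₂
    refine (h1.const_mul (a : ℂ)⁻¹).congr (.of_forall fun k => ?_)
    have ha0 : (a : ℂ) ≠ 0 := by
      rw [Complex.ofReal_ne_zero]; positivity
    simp only [hψ, hG₀]
    rw [SchwartzMap.smulLeftCLM_apply_apply (by fun_prop), smul_eq_mul, Complex.ofReal_mul]
    linear_combination ((a : ℂ)⁻¹ * a * φ k * f ((2 * Real.pi) • k)) * hinv s k +
      φ k * f ((2 * Real.pi) • k) * inv_mul_cancel₀ ha0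
  have hφ : ∀ (φ : 𝓢(R3, ℂ)), u φ = a * ∫ k, φ k * f ((2 * Real.pi) • k) := by
    intro φ
    rw [hu, TemperedDistribution.smulLeftCLM_apply_apply, Lp.toTemperedDistribution_apply,
      ← integral_const_mul]
    refine integral_congr_ae ?_
    filter_upwards [hGae] with k hk
    rw [hk, SchwartzMap.smulLeftCLM_apply_apply (by fun_prop), smul_eq_mul, smul_eq_mul]
    simp only [hG₀]
    rw [Complex.ofReal_mul]
    linear_combination (φ k * a * f ((2 * Real.pi) • k)) * hinv s k
  have hscale : ∀ (φ : 𝓢(R3, ℂ)), (a : ℂ) * ∫ k, φ k * f ((2 * Real.pi) • k) =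
      ((2 * Real.pi) ^ (-(3 / 2) : ℝ) : ℝ) * ∫ p : R3, φ ((2 * Real.pi)⁻¹ • p) * f p := by
    intro φ
    have h1 := Measure.integral_comp_smul (volume : Measure R3)
      (fun p => φ ((2 * Real.pi)⁻¹ • p) * f p) (2 * Real.pi)
    simp only [inv_smul_smul₀ hc] at h1
    rw [h1, Complex.real_smul, ← mul_assoc, ← Complex.ofReal_mul]
    congr 2
    rw [abs_of_pos (by positivity), finrank_euclideanSpace, Fintype.card_fin, ha,
      ← Real.rpow_natCast, ← Real.rpow_neg (by positivity), ← Real.rpow_add (by positivity)]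
    norm_num
  have hint : ∀ φ : 𝓢(R3, ℂ), Integrable (fun p => φ ((2 * Real.pi)⁻¹ • p) * f p) volume := by
    intro φ
    refine ((hprod φ).comp_smul hc').congr (.of_forall fun p => ?_)
    simp only [smul_inv_smul₀ hc]
  have hloc : LocallyIntegrable f volume := by
    have h1 : LocallyIntegrable (fun p : R3 => G₀ ((2 * Real.pi)⁻¹ • p)) volume := by
      have hm : MemLp (fun p : R3 => G₀ ((2 * Real.pi)⁻¹ • p)) 2 volume := by
        have hm₁ : AEStronglyMeasurable (fun p : R3 => G₀ ((2 * Real.pi)⁻¹ • p)) volume :=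
          hG₀m.comp_quasiMeasurePreserving (Measure.quasiMeasurePreserving_smul volume hc')
        rw [memLp_two_iff_integrable_sq_norm hm₁]
        exact ((memLp_two_iff_integrable_sq_norm hG₀m).1 hG₂).comp_smul hc'
      exact hm.locallyIntegrable (by norm_num)
    have h2 : Continuous fun p : R3 =>
        ((a⁻¹ * (1 + ‖(2 * Real.pi)⁻¹ • p‖ ^ 2) ^ (-s / 2) : ℝ) : ℂ) :=
      Complex.continuous_ofReal.comp (continuous_const.mul ((hwc _).comp (continuous_const_smul _)))
    have h3 := h1.continuous_smul h2
    refine h3.congr (.of_forall fun p => ?_)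
    have ha0 : (a : ℂ) ≠ 0 := by
      rw [Complex.ofReal_ne_zero]; positivity
    simp only [hG₀, smul_inv_smul₀ hc, smul_eq_mul]
    rw [Complex.ofReal_mul, Complex.ofReal_mul, Complex.ofReal_inv]
    linear_combination ((a : ℂ)⁻¹ * a * f p) * hinv s ((2 * Real.pi)⁻¹ • p) +
      f p * inv_mul_cancel₀ ha0
  refine ⟨𝓕⁻ u, ⟨hloc, hint, fun φ => ?_⟩, ?_⟩
  · rw [← hscale, ← hφ]
    simp
  · rw [TemperedDistribution.memSobolev_iff_exists_smulLeftCLM_fourier]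
    refine ⟨G, ?_⟩
    ext φ
    rw [TemperedDistribution.smulLeftCLM_apply_apply, FourierTransform.fourier_fourierInv_eq, hφ,
      Lp.toTemperedDistribution_apply, ← integral_const_mul]
    refine integral_congr_ae ?_
    filter_upwards [hGae] with k hk
    rw [hk, SchwartzMap.smulLeftCLM_apply_apply (by fun_prop), smul_eq_mul, smul_eq_mul]
    simp only [hG₀]
    rw [Complex.ofReal_mul]
    ring

end

noncomputable section

/-! ### Sobolev sectors as spaces of radial coefficients -/

theorem rpow_le_of_comparable {a b x y : ℝ} (ha : 0 < a) (hb : 0 < b) (hx : 0 < x)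
    (h₁ : a * x ≤ y) (h₂ : y ≤ b * x) (s : ℝ) : y ^ s ≤ (a ^ s + b ^ s) * x ^ s := by
  have hy : 0 < y := (mul_pos ha hx).trans_le h₁
  rw [add_mul, ← Real.mul_rpow ha.le hx.le, ← Real.mul_rpow hb.le hx.le]
  rcases le_total 0 s with hs | hs
  · have := Real.rpow_le_rpow hy.le h₂ hs
    have := Real.rpow_nonneg (mul_pos ha hx).le s
    linarith
  · have := Real.rpow_le_rpow_of_nonpos (mul_pos ha hx) h₁ hs
    have := Real.rpow_nonneg (mul_pos hb hx).le s
    linarith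

namespace Params
variable (P : Params)

/-- The weight `1 + |k|²`, `k = p / 2π`, of the Sobolev norm is equivalent to `w(p)² = ν p² + λ`. -/
theorem exists_weight_comparable : ∃ a b : ℝ, 0 < a ∧ 0 < b ∧ ∀ p : R3,
    a * P.wt ‖p‖ ^ 2 ≤ 1 + ‖(2 * Real.pi)⁻¹ • p‖ ^ 2 ∧
    1 + ‖(2 * Real.pi)⁻¹ • p‖ ^ 2 ≤ b * P.wt ‖p‖ ^ 2 := by
  have hn := P.nu_pos
  have hl := P.lam_pos
  set c : ℝ := ((2 * Real.pi)⁻¹) ^ 2 with hc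
  have hc0 : 0 < c := by positivity
  have e : ∀ p : R3, ‖(2 * Real.pi)⁻¹ • p‖ ^ 2 = c * ‖p‖ ^ 2 := fun p => by
    rw [norm_smul, mul_pow, Real.norm_eq_abs, sq_abs]
  refine ⟨(P.lam + P.nu / c)⁻¹, 1 / P.lam + c / P.nu, by positivity, by positivity, fun p => ?_⟩
  have hp : 0 ≤ ‖p‖ ^ 2 := by positivity
  rw [e, P.wt_sq]
  constructor
  · rw [inv_mul_le_iff₀ (by positivity)]
    have : (P.lam + P.nu / c) * (1 + c * ‖p‖ ^ 2) =
        P.nu * ‖p‖ ^ 2 + P.lam + (P.nu / c + P.lam * c * ‖p‖ ^ 2) := by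
      field_simp; ring
    rw [this]
    have : 0 ≤ P.nu / c + P.lam * c * ‖p‖ ^ 2 := by positivity
    linarith
  · have : (1 / P.lam + c / P.nu) * (P.nu * ‖p‖ ^ 2 + P.lam) =
        1 + c * ‖p‖ ^ 2 + (P.nu * ‖p‖ ^ 2 / P.lam + c * P.lam / P.nu) := by
      field_simp; ring
    rw [this]
    have : 0 ≤ P.nu * ‖p‖ ^ 2 / P.lam + c * P.lam / P.nu := by positivity
    linarith

theorem wt_sq_rpow (r s : ℝ) : (P.wt r ^ 2) ^ s = (P.wt r ^ s) ^ 2 := by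
  rw [← Real.rpow_natCast, ← Real.rpow_natCast, ← Real.rpow_mul (P.wt_pos r).le,
    ← Real.rpow_mul (P.wt_pos r).le, mul_comm]

theorem exists_sobolevWeight_le (s : ℝ) : ∃ C : ℝ, ∀ p : R3,
    (1 + ‖(2 * Real.pi)⁻¹ • p‖ ^ 2) ^ s ≤ C * (P.wt ‖p‖ ^ s) ^ 2 := by
  obtain ⟨a, b, ha, hb, h⟩ := P.exists_weight_comparable
  refine ⟨a ^ s + b ^ s, fun p => ?_⟩
  rw [← wt_sq_rpow]
  exact rpow_le_of_comparable ha hb (pow_pos (P.wt_pos _) 2) (h p).1 (h p).2 s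

theorem exists_wt_rpow_le (s : ℝ) : ∃ C : ℝ, ∀ p : R3,
    (P.wt ‖p‖ ^ s) ^ 2 ≤ C * (1 + ‖(2 * Real.pi)⁻¹ • p‖ ^ 2) ^ s := by
  obtain ⟨a, b, ha, hb, h⟩ := P.exists_weight_comparable
  refine ⟨b⁻¹ ^ s + a⁻¹ ^ s, fun p => ?_⟩
  rw [← wt_sq_rpow]
  refine rpow_le_of_comparable (inv_pos.2 hb) (inv_pos.2 ha) (by positivity) ?_ ?_ s
  · rw [inv_mul_le_iff₀ hb]
    exact (h p).2
  · rw [le_inv_mul_iff₀ ha]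
    exact (h p).1

theorem continuous_wt_rpow (s : ℝ) : Continuous fun r => P.wt r ^ s :=
  P.continuous_wt.rpow_const fun r => Or.inl (P.wt_pos r).ne'

theorem wt_rpow_mul (r s t : ℝ) : P.wt r ^ s * P.wt r ^ t = P.wt r ^ (s + t) :=
  (Real.rpow_add (P.wt_pos r) s t).symm

theorem wt_rpow_neg_mul (r s : ℝ) :
    ((P.wt r ^ (-s) : ℝ) : ℂ) * ((P.wt r ^ s : ℝ) : ℂ) = 1 := by
  rw [← Complex.ofReal_mul, wt_rpow_mul]
  simp

end Params

namespace HarmonicFrame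
variable {l : ℕ} {B : HarmonicFrame l}

theorem synth_smul (c : ℝ → ℂ) (g : ℝ → B.Coeff) (p : R3) :
    B.synth (fun r => c r • g r) p = c ‖p‖ * B.synth g p := by
  simp [synth, comb_smul]

theorem memLp_synth {g : ℝ → B.Coeff} (hg : Measurable g) :
    MemLp (B.synth g) 2 volume ↔ MemLp g 2 radialMeasure := by
  have h := lintegral_synth hg (φ := fun _ => 1) measurable_const
  simp only [one_mul] at h
  rw [memLp_two_iff_integrable_sq_norm (measurable_synth hg).aestronglyMeasurable,
    memLp_two_iff_integrable_sq_norm hg.aestronglyMeasurable]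
  have h1 : ∀ {α : Type} {F : Type} [MeasurableSpace α] [NormedAddCommGroup F] {m : Measure α}
      {f : α → F}, AEStronglyMeasurable f m →
      (Integrable (fun x => ‖f x‖ ^ 2) m ↔ ∫⁻ x, ‖f x‖ₑ ^ 2 ∂m < ⊤) := by
    intro α F _ _ m f hf
    have hm : AEStronglyMeasurable (fun x => ‖f x‖ ^ 2) m := hf.norm.pow 2
    simp only [Integrable, hm, true_and, hasFiniteIntegral_iff_enorm, enorm_pow, enorm_norm]
  rw [h1 (measurable_synth hg).aestronglyMeasurable, h1 hg.aestronglyMeasurable, h]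

variable (B) in
/-- The Hilbert space of square integrable radial coefficients. -/
abbrev Space : Type := Lp B.Coeff 2 radialMeasure

theorem measurable_coe (u : B.Space) : Measurable u := (Lp.stronglyMeasurable u).measurable

/-- The function on `ℝ³` with radial coefficients `u / w^s`, where `w = √(ν r² + λ)`; for
`u ∈ L²` these are the Fourier transforms of the elements of `H^s_l`. -/
def fld (P : Params) (s : ℝ) (u : B.Space) : R3 → ℂ :=
  B.synth fun r => ((P.wt r ^ (-s) : ℝ) : ℂ) • u r

variable {P : Params} {s : ℝ}

theorem fld_apply (u : B.Space) (p : R3) :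
    fld P s u p = ((P.wt ‖p‖ ^ (-s) : ℝ) : ℂ) * B.synth u p := by
  simp only [fld, synth_smul]

theorem measurable_wt_rpow_smul {g : ℝ → B.Coeff} (hg : Measurable g) (t : ℝ) :
    Measurable fun r => ((P.wt r ^ t : ℝ) : ℂ) • g r :=
  (Complex.measurable_ofReal.comp (P.continuous_wt_rpow t).measurable).smul hg

theorem measurable_fld (u : B.Space) : Measurable (fld P s u) :=
  measurable_synth (measurable_wt_rpow_smul (measurable_coe u) _)

theorem fld_mem_sectorFunctions (u : B.Space) : fld P s u ∈ sectorFunctions l :=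
  synth_mem_sectorFunctions B (measurable_wt_rpow_smul (measurable_coe u) _)

theorem fld_ae_eq {u : B.Space} {g : ℝ → B.Coeff}
    (h : (fun r => ((P.wt r ^ (-s) : ℝ) : ℂ) • u r) =ᵐ[radialMeasure] g) :
    fld P s u =ᵐ[volume] B.synth g := synth_congr h

theorem memLp_synth_coe (u : B.Space) : MemLp (B.synth u) 2 volume :=
  (memLp_synth (measurable_coe u)).2 (Lp.memLp u)

theorem exists_hasMomentum_fld (P : Params) (s : ℝ) (u : B.Space) :
    ∃ ξ ∈ sobolevSector s l, HasMomentum ξ (fld P s u) := by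
  obtain ⟨C, hC⟩ := P.exists_sobolevWeight_le s
  have h2 := (memLp_two_iff_integrable_sq_norm
    (memLp_synth_coe u).1).1 (memLp_synth_coe u)
  obtain ⟨ξ, h1, h3⟩ := exists_hasMomentum (f := fld P s u) (s := s)
    (measurable_fld u).aestronglyMeasurable <| by
      refine (h2.const_mul C).mono' ?_ (.of_forall fun p => ?_)
      · refine Measurable.aestronglyMeasurable ?_
        exact Measurable.mul (by fun_prop) ((measurable_fld u).norm.pow_const 2)
      · rw [Real.norm_of_nonneg (by positivity), fld_apply, norm_mul, mul_pow, Complex.norm_real,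
          Real.norm_eq_abs, sq_abs]
        have h4 : (P.wt ‖p‖ ^ s) ^ 2 * (P.wt ‖p‖ ^ (-s)) ^ 2 = 1 := by
          rw [← mul_pow, P.wt_rpow_mul]
          simp
        calc _ ≤ C * (P.wt ‖p‖ ^ s) ^ 2 * ((P.wt ‖p‖ ^ (-s)) ^ 2 * ‖B.synth u p‖ ^ 2) := by
              gcongr
              exact hC p
          _ = C * ((P.wt ‖p‖ ^ s) ^ 2 * (P.wt ‖p‖ ^ (-s)) ^ 2) * ‖B.synth u p‖ ^ 2 := by ring
          _ = _ := by rw [h4, mul_one]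
  exact ⟨ξ, ⟨h3, _, fld_mem_sectorFunctions u, h1⟩, h1⟩

/-- Every element of `H^s_l` is obtained from square integrable radial coefficients. -/
theorem exists_fld_of_mem (P : Params) {ξ : 𝓢'(R3, ℂ)} (hξ : ξ ∈ sobolevSector s l) :
    ∃ u : B.Space, HasMomentum ξ (fld P s u) := by
  obtain ⟨hs, f, hf, hξf⟩ := hξ
  obtain ⟨g, hg, hfg⟩ := exists_synth (B := B) hf
  have hg' := hξf.congr hfg
  obtain ⟨C, hC⟩ := P.exists_wt_rpow_le s
  set v : ℝ → B.Coeff := fun r => ((P.wt r ^ s : ℝ) : ℂ) • g r with hv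
  have hvm : Measurable v := measurable_wt_rpow_smul hg s
  have h2 : MemLp v 2 radialMeasure := by
    rw [← memLp_synth hvm, memLp_two_iff_integrable_sq_norm
      (measurable_synth hvm).aestronglyMeasurable]
    refine ((hg'.integrable_weight hs).const_mul C).mono'
      ((measurable_synth hvm).norm.pow_const 2).aestronglyMeasurable (.of_forall fun p => ?_)
    rw [hv, synth_smul, Real.norm_of_nonneg (by positivity), norm_mul, mul_pow, Complex.norm_real,
      Real.norm_eq_abs, sq_abs, ← mul_assoc]
    gcongr
    exact hC p
  refine ⟨h2.toLp v, hg'.congr (fld_ae_eq ?_).symm⟩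
  filter_upwards [h2.coeFn_toLp] with r hr
  rw [hr, hv]
  simp only [smul_smul, P.wt_rpow_neg_mul, one_smul]

/-- The pairing of `H^{-s}_l` with `H^s_l` is the scalar product of radial coefficients. -/
theorem integral_conj_fld_mul (u v : B.Space) :
    Integrable (fun p => conj (fld P (-s) u p) * fld P s v p) ∧
    ∫ p, conj (fld P (-s) u p) * fld P s v p = inner ℂ u v := by
  have h1 : (fun p => conj (fld P (-s) u p) * fld P s v p) =
      fun p => conj (B.synth u p) * B.synth v p := by
    ext p
    rw [fld_apply, fld_apply, map_mul, Complex.conj_ofReal, neg_neg]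
    linear_combination (conj (B.synth u p) * B.synth v p) * P.wt_rpow_neg_mul ‖p‖ s
  have h2 : Integrable fun p => conj (B.synth u p) * B.synth v p :=
    (memLp_synth_coe u).star.integrable_mul (memLp_synth_coe v)
  rw [h1]
  exact ⟨h2, by rw [integral_conj_synth_mul h2, L2.inner_def]⟩

theorem fld_add (u v : B.Space) : fld P s (u + v) =ᵐ[volume] fld P s u + fld P s v := by
  refine (fld_ae_eq (g := fun r => ((P.wt r ^ (-s) : ℝ) : ℂ) • (u r + v r)) ?_).trans
    (.of_forall fun p => ?_)
  · filter_upwards [Lp.coeFn_add u v] with r hr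
    rw [hr, Pi.add_apply]
  · simp only [Pi.add_apply, fld, synth, smul_add, comb_add]

theorem fld_smul (c : ℂ) (u : B.Space) : fld P s (c • u) =ᵐ[volume] c • fld P s u := by
  refine (fld_ae_eq (g := fun r => ((P.wt r ^ (-s) : ℝ) : ℂ) • (c • u r)) ?_).trans
    (.of_forall fun p => ?_)
  · filter_upwards [Lp.coeFn_smul c u] with r hr
    rw [hr, Pi.smul_apply]
  · simp only [Pi.smul_apply, fld, synth, comb_smul, smul_eq_mul]
    ring

theorem eq_of_fld_ae_eq {u v : B.Space} (h : fld P s u =ᵐ[volume] fld P s v) : u = v := by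
  have h1 : fld P s (u - v) =ᵐ[volume] 0 := by
    have h2 := fld_add (P := P) (s := s) (u - v) v
    rw [sub_add_cancel] at h2
    filter_upwards [h, h2] with p h3 h4
    rw [h3, Pi.add_apply] at h4
    simpa using h4
  refine sub_eq_zero.1 (inner_self_eq_zero (𝕜 := ℂ).1 ?_)
  rw [← (integral_conj_fld_mul (P := P) (s := s) (u - v) (u - v)).2, ← integral_zero R3 ℂ]
  refine integral_congr_ae ?_
  filter_upwards [h1] with p hp
  rw [hp]
  simp

variable (B P s) in
/-- The identification of `L²` radial coefficients with `H^s_l(ℝ³)`. -/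
def sectorEquiv : B.Space ≃ₗ[ℂ] sobolevSector s l :=
  LinearEquiv.ofBijective
    { toFun := fun u => ⟨_, (exists_hasMomentum_fld P s u).choose_spec.1⟩
      map_add' := fun u v => Subtype.ext
        ((exists_hasMomentum_fld P s (u + v)).choose_spec.2.eq_of_ae_eq
          ((exists_hasMomentum_fld P s u).choose_spec.2.add
            (exists_hasMomentum_fld P s v).choose_spec.2) (fld_add u v))
      map_smul' := fun c u => Subtype.ext
        ((exists_hasMomentum_fld P s (c • u)).choose_spec.2.eq_of_ae_eq
          ((exists_hasMomentum_fld P s u).choose_spec.2.smul c) (fld_smul c u)) }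
    ⟨fun u v h => by
      have h1 := (exists_hasMomentum_fld P s u).choose_spec.2
      have h2 := (exists_hasMomentum_fld P s v).choose_spec.2
      have h3 := congrArg Subtype.val h
      simp only [LinearMap.coe_mk, AddHom.coe_mk] at h3
      rw [h3] at h1
      exact eq_of_fld_ae_eq (h1.ae_eq h2),
    fun ξ => by
      obtain ⟨u, hu⟩ := exists_fld_of_mem (B := B) P ξ.2
      exact ⟨u, Subtype.ext ((exists_hasMomentum_fld P s u).choose_spec.2.eq_of_ae_eq hu .rfl)⟩⟩

theorem hasMomentum_sectorEquiv (u : B.Space) :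
    HasMomentum (sectorEquiv B P s u : 𝓢'(R3, ℂ)) (fld P s u) :=
  (exists_hasMomentum_fld P s u).choose_spec.2

end HarmonicFrame

end

noncomputable section

/-! ### Uniqueness of values and multiplication by the weight -/

theorem Params.IsT.unique {P : Params} {ξ τ σ : 𝓢'(R3, ℂ)} (h : P.IsT ξ τ) (h' : P.IsT ξ σ) :
    τ = σ := by
  obtain ⟨f, hf, -, hτ⟩ := h
  obtain ⟨g, hg, -, hσ⟩ := h'
  have hfg := hf.ae_eq hg
  refine hτ.eq_of_ae_eq hσ ?_
  filter_upwards [hfg] with p hp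
  unfold Params.tFun
  rw [hp]
  congr 1
  refine integral_congr_ae ?_
  filter_upwards [hfg] with q hq
  rw [hq]

theorem Params.wFun_congr {P : Params} {f g : R3 → ℂ} (h : f =ᵐ[volume] g) :
    P.wFun f =ᵐ[volume] P.wFun g := by
  filter_upwards [h] with p hp
  unfold Params.wFun
  rw [hp]
  congr 2
  refine integral_congr_ae ?_
  filter_upwards [h] with q hq
  rw [hq]

theorem Params.IsW.unique {P : Params} {ξ τ σ : 𝓢'(R3, ℂ)} (h : P.IsW ξ τ) (h' : P.IsW ξ σ) :
    τ = σ := by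
  obtain ⟨f, hf, -, hτ⟩ := h
  obtain ⟨g, hg, -, hσ⟩ := h'
  exact hτ.eq_of_ae_eq hσ (Params.wFun_congr (hf.ae_eq hg))

theorem efimov_nonneg {m : ℝ} (hm : 0 < m) : 0 ≤ efimov m := by
  rw [efimov_eq hm]
  refine mul_nonneg (by positivity) (intervalIntegral.integral_nonneg zero_le_one fun t ht => ?_)
  have h1 := ht.1
  have : 0 ≤ Real.arcsin (1 / (m + 1) * t) := Real.arcsin_nonneg.2 (by positivity)
  positivity

/-- A bounded multiple of the identity plus a bounded perturbation is coercive. -/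
theorem re_inner_add_ge {K : Type*} [NormedAddCommGroup K] [InnerProductSpace ℂ K] {A : K →L[ℂ] K}
    {a c : ℝ} (hA : ‖A‖ ≤ c) (u : K) :
    (a - c) * ‖u‖ ^ 2 ≤ (inner ℂ u ((a : ℂ) • u + A u)).re := by
  rw [inner_add_right, inner_smul_right, inner_self_eq_norm_sq_to_K, Complex.add_re]
  have h1 : ((a : ℂ) * ((‖u‖ : ℝ) : ℂ) ^ 2).re = a * ‖u‖ ^ 2 := by
    rw [← Complex.ofReal_pow, ← Complex.ofReal_mul, Complex.ofReal_re]
  have h2 : |(inner ℂ u (A u)).re| ≤ c * ‖u‖ ^ 2 :=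
    calc |(inner ℂ u (A u)).re| ≤ ‖inner ℂ u (A u)‖ := Complex.abs_re_le_norm _
      _ ≤ ‖u‖ * ‖A u‖ := norm_inner_le_norm _ _
      _ ≤ ‖u‖ * (c * ‖u‖) := by
          gcongr
          exact (A.le_opNorm u).trans (by gcongr)
      _ = _ := by ring
  have h3 := neg_abs_le (inner ℂ u (A u)).re
  change _ ≤ ((a : ℂ) * ((‖u‖ : ℝ) : ℂ) ^ 2).re + _
  rw [h1]
  linarith

namespace HarmonicFrame
variable {l : ℕ} {B : HarmonicFrame l} {P : Params} {s : ℝ}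

section Multiplication

theorem memLp_inv_wt_smul (P : Params) (u : B.Space) :
    MemLp (fun r => ((P.wt r ^ (-1 : ℝ) : ℝ) : ℂ) • u r) 2 radialMeasure := by
  refine (Lp.memLp u).of_le_mul (c := (√P.lam)⁻¹)
    (measurable_wt_rpow_smul (measurable_coe u) _).aestronglyMeasurable (.of_forall fun r => ?_)
  have h := Real.sqrt_pos.2 P.lam_pos
  have h1 := P.sqrt_lam_le_wt r
  rw [norm_smul, Complex.norm_real, Real.norm_of_nonneg (Real.rpow_nonneg (P.wt_pos r).le _),
    Real.rpow_neg_one]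
  gcongr

variable (B P) in
/-- Multiplication by `1 / √(ν r² + λ)`. -/
def invWt : B.Space →L[ℂ] B.Space :=
  LinearMap.mkContinuous
    { toFun := fun u => (memLp_inv_wt_smul P u).toLp _
      map_add' := fun u v => by
        refine Lp.ext ?_
        filter_upwards [(memLp_inv_wt_smul P (u + v)).coeFn_toLp,
          (memLp_inv_wt_smul P u).coeFn_toLp,
          (memLp_inv_wt_smul P v).coeFn_toLp, Lp.coeFn_add u v,
          Lp.coeFn_add ((memLp_inv_wt_smul P u).toLp _) ((memLp_inv_wt_smul P v).toLp _)]
          with r h1 h2 h3 h4 h5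
        rw [h1, h5, Pi.add_apply, h2, h3, h4, Pi.add_apply, smul_add]
      map_smul' := fun c u => by
        refine Lp.ext ?_
        filter_upwards [(memLp_inv_wt_smul P (c • u)).coeFn_toLp,
          (memLp_inv_wt_smul P u).coeFn_toLp, Lp.coeFn_smul c u,
          Lp.coeFn_smul c ((memLp_inv_wt_smul P u).toLp _)] with r h1 h2 h3 h4
        rw [h1, RingHom.id_apply, h4, Pi.smul_apply, h2, h3, Pi.smul_apply, smul_comm] }
    (√P.lam)⁻¹ fun u => by
    refine Lp.norm_le_mul_norm_of_ae_le_mul ?_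
    filter_upwards [(memLp_inv_wt_smul P u).coeFn_toLp] with r hr
    rw [LinearMap.coe_mk, AddHom.coe_mk, hr, norm_smul, Complex.norm_real,
      Real.norm_of_nonneg (Real.rpow_nonneg (P.wt_pos r).le _), Real.rpow_neg_one]
    have h := Real.sqrt_pos.2 P.lam_pos
    have h1 := P.sqrt_lam_le_wt r
    gcongr

theorem invWt_apply (u : B.Space) :
    invWt B P u =ᵐ[radialMeasure] fun r => ((P.wt r ^ (-1 : ℝ) : ℝ) : ℂ) • u r :=
  (memLp_inv_wt_smul P u).coeFn_toLp

theorem norm_invWt_le : ‖invWt B P‖ ≤ (√P.lam)⁻¹ :=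
  LinearMap.mkContinuous_norm_le _ (by positivity) _

theorem invWt_symm (u v : B.Space) : inner ℂ (invWt B P u) v = inner ℂ u (invWt B P v) := by
  rw [L2.inner_def, L2.inner_def]
  refine integral_congr_ae ?_
  filter_upwards [invWt_apply u, invWt_apply v] with r h1 h2
  rw [h1, h2, inner_smul_left, inner_smul_right, Complex.conj_ofReal]

theorem fld_invWt (u : B.Space) : fld P s (invWt B P u) =ᵐ[volume] fld P (s + 1) u := by
  refine fld_ae_eq ?_
  filter_upwards [invWt_apply u] with r hr
  rw [hr, smul_smul, ← Complex.ofReal_mul, P.wt_rpow_mul]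
  congr 4
  ring

theorem invWt_injective : Function.Injective (invWt B P) := fun u v h =>
  eq_of_fld_ae_eq (P := P) (s := 0 + 1)
    ((fld_invWt u).symm.trans (by rw [h]; exact fld_invWt v))

theorem sectorEquiv_invWt (u : B.Space) :
    (sectorEquiv B P s (invWt B P u) : 𝓢'(R3, ℂ)) = sectorEquiv B P (s + 1) u :=
  (hasMomentum_sectorEquiv _).eq_of_ae_eq (hasMomentum_sectorEquiv _) (fld_invWt u)

end Multiplication

end HarmonicFrame

end

noncomputable section

/-! ### `T_λ` and `W_λ` in terms of radial coefficients -/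

namespace Params
variable (P : Params)

theorem wt_sq_le_den (p q : R3) : P.wt ‖q‖ ^ 2 ≤ P.den p q := by
  rw [P.den_comm, P.den_eq, P.wt_sq]
  have := sq_nonneg ‖p + (P.mu / 2) • q‖
  linarith

theorem continuous_den_right (p : R3) : Continuous fun q => P.den p q := by
  unfold den; fun_prop

theorem continuous_inv_den (p : R3) : Continuous fun q => ((P.den p q : ℂ))⁻¹ :=
  (Complex.continuous_ofReal.comp (P.continuous_den_right p)).inv₀ fun q =>
    Complex.ofReal_ne_zero.2 (P.den_pos p q).ne'

theorem continuous_inv_den_sq (p : R3) : Continuous fun q => ((P.den p q : ℂ) ^ 2)⁻¹ :=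
  ((Complex.continuous_ofReal.comp (P.continuous_den_right p)).pow 2).inv₀ fun q =>
    pow_ne_zero 2 (Complex.ofReal_ne_zero.2 (P.den_pos p q).ne')

theorem memLp_of_le_inv_den {f : R3 → ℂ} (hf : Continuous f) (p : R3) {C : ℝ}
    (h : ∀ q, ‖f q‖ ^ 2 ≤ C * (P.den p q ^ 2)⁻¹) : MemLp f 2 volume := by
  rw [memLp_two_iff_integrable_sq_norm hf.aestronglyMeasurable]
  refine ((P.integral_den p).1.const_mul C).mono' (hf.norm.pow 2).aestronglyMeasurable
    (.of_forall fun q => ?_)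
  rw [Real.norm_of_nonneg (by positivity)]
  exact h q

theorem continuous_sqrt_wt_norm : Continuous fun q : R3 => ((√(P.wt ‖q‖) : ℝ) : ℂ) :=
  Complex.continuous_ofReal.comp (P.continuous_wt.comp continuous_norm).sqrt

end Params

namespace HarmonicFrame
variable {l : ℕ} {B : HarmonicFrame l} {P : Params}

theorem fld_half (u : B.Space) (p : R3) :
    fld P (1 / 2) u p = ((√(P.wt ‖p‖) : ℝ) : ℂ)⁻¹ * B.synth u p := by
  rw [fld_apply, Real.rpow_neg (P.wt_pos _).le, ← Real.sqrt_eq_rpow, Complex.ofReal_inv]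

theorem fld_neg_half (u : B.Space) (p : R3) :
    fld P (-(1 / 2)) u p = ((√(P.wt ‖p‖) : ℝ) : ℂ) * B.synth u p := by
  rw [fld_apply, neg_neg, ← Real.sqrt_eq_rpow]

theorem ofReal_sqrt_wt_ne_zero (P : Params) (r : ℝ) : ((√(P.wt r) : ℝ) : ℂ) ≠ 0 :=
  Complex.ofReal_ne_zero.2 (P.sqrt_wt_pos r).ne'

theorem integrable_fld_half_div_den (u : B.Space) (p : R3) :
    Integrable (fun q => fld P (1 / 2) u q * (P.den p q : ℂ)⁻¹) := by
  have h1 : MemLp (fun q : R3 => ((√(P.wt ‖q‖) : ℝ) : ℂ)⁻¹ * (P.den p q : ℂ)⁻¹) 2 volume := by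
    refine P.memLp_of_le_inv_den ((P.continuous_sqrt_wt_norm.inv₀ fun q =>
      ofReal_sqrt_wt_ne_zero P _).mul (P.continuous_inv_den p)) p (C := (√P.lam)⁻¹) fun q => ?_
    have h2 := P.sqrt_lam_le_wt ‖q‖
    have h3 := Real.sqrt_pos.2 P.lam_pos
    rw [norm_mul, norm_inv, norm_inv, Complex.norm_real, Complex.norm_real,
      Real.norm_of_nonneg (Real.sqrt_nonneg _), Real.norm_of_nonneg (P.den_pos p q).le, mul_pow,
      inv_pow, inv_pow, Real.sq_sqrt (P.wt_pos _).le]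
    gcongr
  refine (h1.integrable_mul (memLp_synth_coe u)).congr (.of_forall fun q => ?_)
  simp only [fld_half, Pi.mul_apply]
  ring

theorem integrable_fld_neg_half_div_den_sq (u : B.Space) (p : R3) :
    Integrable (fun q => fld P (-(1 / 2)) u q * ((P.den p q : ℂ) ^ 2)⁻¹) := by
  have h1 : MemLp (fun q : R3 => ((√(P.wt ‖q‖) : ℝ) : ℂ) * ((P.den p q : ℂ) ^ 2)⁻¹) 2 volume := by
    refine P.memLp_of_le_inv_den (P.continuous_sqrt_wt_norm.mul (P.continuous_inv_den_sq p)) p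
      (C := (√P.lam ^ 3)⁻¹) fun q => ?_
    have h2 := P.sqrt_lam_le_wt ‖q‖
    have h3 := Real.sqrt_pos.2 P.lam_pos
    have h4 := P.wt_sq_le_den p q
    have h5 := P.wt_pos ‖q‖
    have h6 := P.den_pos p q
    rw [norm_mul, norm_inv, norm_pow, Complex.norm_real, Complex.norm_real,
      Real.norm_of_nonneg (Real.sqrt_nonneg _), Real.norm_of_nonneg h6.le, mul_pow,
      inv_pow, Real.sq_sqrt h5.le]
    calc P.wt ‖q‖ * ((P.den p q ^ 2) ^ 2)⁻¹
        = P.wt ‖q‖ * (P.den p q ^ 2)⁻¹ * (P.den p q ^ 2)⁻¹ := by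
          rw [sq (P.den p q ^ 2), mul_inv, mul_assoc]
      _ ≤ P.wt ‖q‖ * ((P.wt ‖q‖ ^ 2) ^ 2)⁻¹ * (P.den p q ^ 2)⁻¹ := by gcongr
      _ = (P.wt ‖q‖ ^ 3)⁻¹ * (P.den p q ^ 2)⁻¹ := by
          congr 1
          field_simp
      _ ≤ _ := by gcongr
  refine (h1.integrable_mul (memLp_synth_coe u)).congr (.of_forall fun q => ?_)
  simp only [fld_neg_half, Pi.mul_apply]
  ring

end HarmonicFrame

namespace HarmonicFrame
variable {l : ℕ} {B : HarmonicFrame (l + 1)} {P : Params}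

variable (B P)

/-- `T_λ`, as an operator from `H^{1/2}` to `H^{-1/2}`, in terms of radial coefficients. -/
def opT : B.Space →L[ℂ] B.Space :=
  ((2 * Real.pi ^ 2 : ℝ) : ℂ) • ContinuousLinearMap.id ℂ _ +
    (P.schurBound_kerT l (efimov_nonneg P.mass_pos)).op

/-- `T_λ`, as an operator from `H^{3/2}` to `H^{1/2}`, in terms of radial coefficients. -/
def opS : B.Space →L[ℂ] B.Space :=
  ((2 * Real.pi ^ 2 : ℝ) : ℂ) • ContinuousLinearMap.id ℂ _ + (P.schurBound_kerS l).op

/-- `W_λ`, as an operator from `H^{-1/2}` to `H^{1/2}`, in terms of radial coefficients. -/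
def opW : B.Space →L[ℂ] B.Space :=
  ((2 * Real.pi ^ 2 : ℝ) : ℂ) • ContinuousLinearMap.id ℂ _ + (-2 : ℂ) • (P.schurBound_kerW l).op

variable {B P}

theorem opT_apply (u : B.Space) : opT B P u =ᵐ[radialMeasure] fun r =>
    ((2 * Real.pi ^ 2 : ℝ) : ℂ) • u r + ∫ s, (P.kerT (l + 1) r s : ℂ) • u s ∂radialMeasure := by
  set A := (P.schurBound_kerT l (efimov_nonneg P.mass_pos)).op (E := B.Coeff) with hA
  have h : opT B P u = ((2 * Real.pi ^ 2 : ℝ) : ℂ) • u + A u := rfl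
  rw [h]
  filter_upwards [Lp.coeFn_add (((2 * Real.pi ^ 2 : ℝ) : ℂ) • u) (A u),
    Lp.coeFn_smul ((2 * Real.pi ^ 2 : ℝ) : ℂ) u,
    (P.schurBound_kerT l (efimov_nonneg P.mass_pos)).op_apply u] with r h1 h2 h3
  rw [h1, Pi.add_apply, h2, hA, h3, Pi.smul_apply]

theorem opS_apply (u : B.Space) : opS B P u =ᵐ[radialMeasure] fun r =>
    ((2 * Real.pi ^ 2 : ℝ) : ℂ) • u r + ∫ s, (P.kerS (l + 1) r s : ℂ) • u s ∂radialMeasure := by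
  set A := (P.schurBound_kerS l).op (E := B.Coeff) with hA
  have h : opS B P u = ((2 * Real.pi ^ 2 : ℝ) : ℂ) • u + A u := rfl
  rw [h]
  filter_upwards [Lp.coeFn_add (((2 * Real.pi ^ 2 : ℝ) : ℂ) • u) (A u),
    Lp.coeFn_smul ((2 * Real.pi ^ 2 : ℝ) : ℂ) u, (P.schurBound_kerS l).op_apply u] with r h1 h2 h3
  rw [h1, Pi.add_apply, h2, hA, h3, Pi.smul_apply]

theorem opW_apply (u : B.Space) : opW B P u =ᵐ[radialMeasure] fun r =>
    ((2 * Real.pi ^ 2 : ℝ) : ℂ) • u r +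
      (-2 : ℂ) • ∫ s, (P.kerW (l + 1) r s : ℂ) • u s ∂radialMeasure := by
  set A := (P.schurBound_kerW l).op (E := B.Coeff) with hA
  have h : opW B P u = ((2 * Real.pi ^ 2 : ℝ) : ℂ) • u + (-2 : ℂ) • A u := rfl
  rw [h]
  filter_upwards [Lp.coeFn_add (((2 * Real.pi ^ 2 : ℝ) : ℂ) • u) ((-2 : ℂ) • A u),
    Lp.coeFn_smul ((2 * Real.pi ^ 2 : ℝ) : ℂ) u, Lp.coeFn_smul (-2 : ℂ) (A u),
    (P.schurBound_kerW l).op_apply u] with r h1 h2 h3 h4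
  rw [h1, Pi.add_apply, h2, h3, Pi.smul_apply, Pi.smul_apply, hA, h4]

theorem opT_symm (u v : B.Space) : inner ℂ (opT B P u) v = inner ℂ u (opT B P v) := by
  have h := (P.schurBound_kerT l (efimov_nonneg P.mass_pos)).op_symm (P.kerT_comm (l + 1)) u v
  simp only [opT, add_apply, smul_apply,
    ContinuousLinearMap.id_apply, inner_add_left, inner_add_right, inner_smul_left,
    inner_smul_right, Complex.conj_ofReal, h]

/-- The constant depends neither on `λ` nor on the sector. -/
theorem opT_coercive (u : B.Space) :
    2 * Real.pi ^ 2 * (1 - efimov P.mass) * ‖u‖ ^ 2 ≤ (inner ℂ u (opT B P u)).re := by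
  have h := re_inner_add_ge (a := 2 * Real.pi ^ 2)
    ((P.schurBound_kerT l (efimov_nonneg P.mass_pos)).norm_op_le (E := B.Coeff)) u
  refine le_trans (le_of_eq ?_) h
  ring

theorem opW_coercive (u : B.Space) :
    2 * Real.pi ^ 2 * (1 - P.mu / 2) * ‖u‖ ^ 2 ≤ (inner ℂ u (opW B P u)).re := by
  have h1 : ‖(-2 : ℂ) • (P.schurBound_kerW l).op (E := B.Coeff)‖ ≤
      2 * (P.mu / 2 * Real.pi ^ 2) := by
    rw [norm_smul]
    have := (P.schurBound_kerW l).norm_op_le (E := B.Coeff)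
    simpa using this
  refine le_trans (le_of_eq ?_) (re_inner_add_ge (a := 2 * Real.pi ^ 2) h1 u)
  ring

/-- `T_λ` on `H^{3/2}`: the factors `√w` that separate the kernels `kerT` and `kerS` are the ones
that separate the coefficients in the two scales. -/
theorem opT_invWt (u : B.Space) : opT B P (invWt B P u) = invWt B P (opS B P u) := by
  refine Lp.ext ?_
  have h0 : ∀ᵐ r ∂radialMeasure, ∫ s, (P.kerT (l + 1) r s : ℂ) • invWt B P u s ∂radialMeasure =
      ((P.wt r ^ (-1 : ℝ) : ℝ) : ℂ) • ∫ s, (P.kerS (l + 1) r s : ℂ) • u s ∂radialMeasure := by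
    refine .of_forall fun r => ?_
    rw [← integral_smul]
    refine integral_congr_ae ?_
    filter_upwards [invWt_apply (P := P) u] with s hs
    rw [hs, smul_smul, smul_smul, ← Complex.ofReal_mul, ← Complex.ofReal_mul]
    congr 2
    have h1 := P.sqrt_wt_pos r
    have h2 := P.wt_pos r
    have h3 := P.sqrt_wt_pos s
    have h4 := P.wt_pos s
    have h5 : √(P.wt r) ^ 2 = P.wt r := Real.sq_sqrt h2.le
    rw [Real.rpow_neg_one, Real.rpow_neg_one]
    unfold Params.kerT Params.kerS
    field_simp
    rw [h5]
  filter_upwards [opT_apply (P := P) (invWt B P u), invWt_apply (P := P) u,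
    invWt_apply (P := P) (opS B P u), opS_apply (P := P) u, h0] with r h1 h2 h3 h4 h5
  rw [h1, h2, h3, h4, h5, smul_add, smul_comm]

/-- `T_λ` acts on radial coefficients as `opT`, by the Funk–Hecke formula. -/
theorem tFun_fld (u : B.Space) :
    P.tFun (fld P (1 / 2) u) =ᵐ[volume] fld P (-(1 / 2)) (opT B P u) := by
  have h1 := (P.schurBound_kerT l (efimov_nonneg P.mass_pos)).ae_integrable u
  filter_upwards [ae_norm_of_ae_radial ae_radial_pos, ae_norm_of_ae_radial h1,
    ae_norm_of_ae_radial (opT_apply (P := P) u)] with p hp hi hT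
  set r := ‖p‖ with hr
  set η : R3 := r⁻¹ • p with hη
  have hη1 : ‖η‖ = 1 := by
    rw [hη, norm_smul, norm_inv, Real.norm_of_nonneg hp.le, ← hr, inv_mul_cancel₀ hp.ne']
  have hpη : r • η = p := by rw [hη, smul_inv_smul₀ hp.ne']
  have h2 : ∀ s, (P.lamT (l + 1) r s : ℂ) • (((P.wt s ^ (-(1 / 2) : ℝ) : ℝ) : ℂ) • u s) =
      ((√(P.wt r) : ℝ) : ℂ) • ((P.kerT (l + 1) r s : ℂ) • u s) := fun s => by
    rw [smul_smul, smul_smul, ← Complex.ofReal_mul, ← Complex.ofReal_mul]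
    congr 2
    have h3 := P.sqrt_wt_pos r
    have h4 := P.sqrt_wt_pos s
    rw [Real.rpow_neg (P.wt_pos _).le, ← Real.sqrt_eq_rpow]
    unfold Params.kerT
    field_simp
  have h3 := integral_synth_mul (B := B) (g := fun s => ((P.wt s ^ (-(1 / 2) : ℝ) : ℝ) : ℂ) • u s)
    (P.continuous_inv_den p) (k := fun s => (P.lamT (l + 1) r s : ℂ)) (η := η)
    (fun j s => by
      rw [← P.integral_sphere_div_den hη1 (B.mem j) r s, hpη]
      simp only [div_eq_mul_inv])
    (integrable_fld_half_div_den u p)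
    ((hi.smul ((√(P.wt r) : ℝ) : ℂ)).congr (.of_forall fun s => (h2 s).symm))
  simp only [h2] at h3
  rw [integral_smul, comb_smul] at h3
  have h4 : ∫ q, fld P (1 / 2) u q / (P.den p q : ℂ) =
      ((√(P.wt r) : ℝ) : ℂ) * B.comb (∫ s, (P.kerT (l + 1) r s : ℂ) • u s ∂radialMeasure) η := by
    rw [← h3]
    rfl
  unfold Params.tFun
  rw [h4, fld_neg_half, fld_half]
  unfold synth
  rw [← hr, ← hη, hT, comb_add, comb_smul]
  change ((2 * Real.pi ^ 2 * P.wt r : ℝ) : ℂ) * (((√(P.wt r) : ℝ) : ℂ)⁻¹ * B.comb (u r) η) + _ = _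
  have h5 := ofReal_sqrt_wt_ne_zero P r
  have h6 : ((P.wt r : ℝ) : ℂ) = ((√(P.wt r) : ℝ) : ℂ) ^ 2 := by
    rw [← Complex.ofReal_pow, Real.sq_sqrt (P.wt_pos r).le]
  rw [Complex.ofReal_mul (2 * Real.pi ^ 2) (P.wt r), h6]
  field_simp

/-- `W_λ` acts on radial coefficients as `opW`, by the Funk–Hecke formula. -/
theorem wFun_fld (u : B.Space) :
    P.wFun (fld P (-(1 / 2)) u) =ᵐ[volume] fld P (1 / 2) (opW B P u) := by
  have h1 := (P.schurBound_kerW l).ae_integrable u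
  filter_upwards [ae_norm_of_ae_radial ae_radial_pos, ae_norm_of_ae_radial h1,
    ae_norm_of_ae_radial (opW_apply (P := P) u)] with p hp hi hT
  set r := ‖p‖ with hr
  set η : R3 := r⁻¹ • p with hη
  have hη1 : ‖η‖ = 1 := by
    rw [hη, norm_smul, norm_inv, Real.norm_of_nonneg hp.le, ← hr, inv_mul_cancel₀ hp.ne']
  have hpη : r • η = p := by rw [hη, smul_inv_smul₀ hp.ne']
  have h2 : ∀ s, (P.lamW (l + 1) r s : ℂ) • (((P.wt s ^ (-(-(1 / 2)) : ℝ) : ℝ) : ℂ) • u s) =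
      ((√(P.wt r) : ℝ) : ℂ)⁻¹ • ((P.kerW (l + 1) r s : ℂ) • u s) := fun s => by
    rw [smul_smul, smul_smul, ← Complex.ofReal_inv, ← Complex.ofReal_mul, ← Complex.ofReal_mul]
    congr 2
    have h3 := P.sqrt_wt_pos r
    rw [neg_neg, ← Real.sqrt_eq_rpow]
    unfold Params.kerW
    field_simp
  have h3 := integral_synth_mul (B := B)
    (g := fun s => ((P.wt s ^ (-(-(1 / 2)) : ℝ) : ℝ) : ℂ) • u s)
    (P.continuous_inv_den_sq p) (k := fun s => (P.lamW (l + 1) r s : ℂ)) (η := η)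
    (fun j s => by
      rw [← P.integral_sphere_div_den_sq hη1 (B.mem j) r s, hpη]
      simp only [div_eq_mul_inv])
    (integrable_fld_neg_half_div_den_sq u p)
    ((hi.smul ((√(P.wt r) : ℝ) : ℂ)⁻¹).congr (.of_forall fun s => (h2 s).symm))
  simp only [h2] at h3
  rw [integral_smul, comb_smul] at h3
  have h4 : ∫ q, fld P (-(1 / 2)) u q / (P.den p q : ℂ) ^ 2 =
      ((√(P.wt r) : ℝ) : ℂ)⁻¹ * B.comb (∫ s, (P.kerW (l + 1) r s : ℂ) • u s ∂radialMeasure) η := by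
    rw [← h3]
    rfl
  unfold Params.wFun
  rw [h4, fld_neg_half, fld_half]
  unfold synth
  rw [← hr, ← hη, hT, comb_add, comb_smul, comb_smul]
  change ((2 * Real.pi ^ 2 / P.wt r : ℝ) : ℂ) * (((√(P.wt r) : ℝ) : ℂ) * B.comb (u r) η) - _ = _
  have h5 := ofReal_sqrt_wt_ne_zero P r
  have h6 : ((P.wt r : ℝ) : ℂ) = ((√(P.wt r) : ℝ) : ℂ) ^ 2 := by
    rw [← Complex.ofReal_pow, Real.sq_sqrt (P.wt_pos r).le]
  rw [Complex.ofReal_div (2 * Real.pi ^ 2) (P.wt r), h6]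
  field_simp
  ring

theorem isT_sectorEquiv (u : B.Space) :
    P.IsT (sectorEquiv B P (1 / 2) u : 𝓢'(R3, ℂ)) (sectorEquiv B P (-(1 / 2)) (opT B P u)) :=
  ⟨_, hasMomentum_sectorEquiv u, .of_forall fun p => integrable_fld_half_div_den u p,
    (hasMomentum_sectorEquiv _).congr (tFun_fld u).symm⟩

theorem isW_sectorEquiv (u : B.Space) :
    P.IsW (sectorEquiv B P (-(1 / 2)) u : 𝓢'(R3, ℂ)) (sectorEquiv B P (1 / 2) (opW B P u)) :=
  ⟨_, hasMomentum_sectorEquiv u, .of_forall fun p => integrable_fld_neg_half_div_den_sq u p,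
    (hasMomentum_sectorEquiv _).congr (wFun_fld u).symm⟩

variable (B P) in
/-- The charge with given radial coefficients. -/
def charge : B.Space ≃ₗ[ℂ] ChargeSpace P (l + 1) := sectorEquiv B P (-(1 / 2))

theorem momentum_charge (u : B.Space) :
    momentum (charge B P u).toDist =ᵐ[volume] fld P (-(1 / 2)) u :=
  (hasMomentum_sectorEquiv u).momentum.ae_eq (hasMomentum_sectorEquiv u)

theorem inner_charge (u v : B.Space) :
    inner ℂ (charge B P u) (charge B P v) = inner ℂ u (opW B P v) := by
  rw [ChargeSpace.inner_eq, ChargeSpace.wInner,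
    ← (integral_conj_fld_mul (P := P) (s := 1 / 2) u (opW B P v)).2]
  refine integral_congr_ae ?_
  filter_upwards [momentum_charge (P := P) u,
    Params.wFun_congr (momentum_charge (P := P) v), wFun_fld (P := P) v] with p h1 h2 h3
  rw [h1, h2, h3]

variable (B P) in
/-- The space of charges with the operators `W_λ`, `T_λ`, in terms of radial coefficients. -/
def model : ChargeModel B.Space (ChargeSpace P (l + 1)) where
  Θ := charge B P
  W := opW B P
  T := opT B P
  D := invWt B P
  S := opS B P
  inner_Θ := inner_charge
  W_coercive := ⟨2 * Real.pi ^ 2 * (1 - P.mu / 2), by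
    have := P.mu_lt_two
    have : 0 < 1 - P.mu / 2 := by linarith
    positivity, opW_coercive⟩
  T_symm := opT_symm
  D_symm := invWt_symm
  D_inj := invWt_injective
  T_D := opT_invWt

end HarmonicFrame

end

noncomputable section

/-! ### The auxiliary operator and its maximal extension -/

namespace HarmonicFrame
variable {l : ℕ} {B : HarmonicFrame (l + 1)} {P : Params} {α : ℝ}

theorem sectorEquiv_invWt_of_eq {s t : ℝ} (h : s + 1 = t) (u : B.Space) :
    (sectorEquiv B P s (invWt B P u) : 𝓢'(R3, ℂ)) = sectorEquiv B P t u := by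
  subst h
  exact sectorEquiv_invWt u

/-- The inclusion of `H^{1/2}` into `H^{-1/2}` is multiplication of radial coefficients by `1 / w`.
-/
theorem sectorEquiv_half (u : B.Space) :
    (sectorEquiv B P (1 / 2) u : 𝓢'(R3, ℂ)) = (charge B P (invWt B P u)).toDist :=
  (sectorEquiv_invWt_of_eq (by norm_num) u).symm

theorem mem_sobolevSector_half {ξ : ChargeSpace P (l + 1)} :
    ξ.toDist ∈ sobolevSector (1 / 2) (l + 1) ↔ ∃ u, ξ = charge B P (invWt B P u) := by
  constructor
  · intro h
    obtain ⟨u, hu⟩ := (sectorEquiv B P (1 / 2)).surjective ⟨_, h⟩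
    refine ⟨u, ChargeSpace.toDist_injective ?_⟩
    rw [← sectorEquiv_half, hu]
  · rintro ⟨u, rfl⟩
    rw [← sectorEquiv_half]
    exact Subtype.property _

theorem mem_sobolevSector_three_halves {ξ : ChargeSpace P (l + 1)} :
    ξ.toDist ∈ sobolevSector (3 / 2) (l + 1) ↔
      ∃ u, ξ = charge B P (invWt B P (invWt B P u)) := by
  have h1 : ∀ u : B.Space, (sectorEquiv B P (3 / 2) u : 𝓢'(R3, ℂ)) =
      (charge B P (invWt B P (invWt B P u))).toDist := fun u => by
    rw [← sectorEquiv_half, sectorEquiv_invWt_of_eq (t := 3 / 2) (by norm_num)]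
  constructor
  · intro h
    obtain ⟨u, hu⟩ := (sectorEquiv B P (3 / 2)).surjective ⟨_, h⟩
    refine ⟨u, ChargeSpace.toDist_injective ?_⟩
    rw [← h1, hu]
  · rintro ⟨u, rfl⟩
    rw [← h1]
    exact Subtype.property _

theorem isT_charge_iff {u : B.Space} {τ : 𝓢'(R3, ℂ)} :
    P.IsT (charge B P (invWt B P u)).toDist τ ↔ τ = (charge B P (opT B P u)).toDist := by
  have h := isT_sectorEquiv (P := P) u
  rw [sectorEquiv_half] at h
  exact ⟨fun h' => h'.unique h, fun h' => h' ▸ h⟩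

theorem isW_charge_iff {u : B.Space} {ω : 𝓢'(R3, ℂ)} :
    P.IsW (charge B P u).toDist ω ↔ ω = (charge B P (invWt B P (opW B P u))).toDist := by
  have h := isW_sectorEquiv (P := P) u
  rw [sectorEquiv_half] at h
  exact ⟨fun h' => h'.unique h, fun h' => h' ▸ h⟩

theorem toDist_shifted (u : B.Space) :
    (charge B P (opT B P u)).toDist + (α : ℂ) • (charge B P (invWt B P u)).toDist =
      (charge B P ((model B P).shifted α u)).toDist := by
  rw [← map_smul, ← map_smul, ← map_add, ← map_add]
  rfl

theorem shifted_mem_sobolevSector_half {u : B.Space} :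
    (charge B P ((model B P).shifted α u)).toDist ∈ sobolevSector (1 / 2) (l + 1) ↔
      ∃ w, (model B P).shifted α u = invWt B P w := by
  rw [mem_sobolevSector_half (B := B)]
  simp only [(charge B P).injective.eq_iff]

/-- The equation `W_λ ζ = 2 (T_λ + α) ξ` in terms of radial coefficients; the membership of
`(T_λ + α) ξ` in `H^{1/2}` follows from the equation. -/
theorem isAuxValue_iff {u v : B.Space} :
    IsAuxValue P α (l + 1) (charge B P (invWt B P u)) (charge B P v) ↔
      invWt B P (opW B P v) = (2 : ℂ) • (model B P).shifted α u := by
  have h1 : ∀ x y : B.Space, (2 : ℂ) • (charge B P x).toDist = (charge B P y).toDist ↔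
      y = (2 : ℂ) • x := fun x y => by
    rw [← map_smul, ← map_smul, ChargeSpace.toDist_injective.eq_iff,
      (charge B P).injective.eq_iff, eq_comm]
  unfold IsAuxValue
  simp only [isT_charge_iff, isW_charge_iff, exists_eq_left, toDist_shifted, h1,
    shifted_mem_sobolevSector_half]
  refine ⟨And.right, fun h => ⟨⟨(2 : ℂ)⁻¹ • opW B P v, ?_⟩, h⟩⟩
  rw [map_smul, h, inv_smul_smul₀ two_ne_zero]

theorem auxOp_le_maximalOp : auxOp P α (l + 1) ≤ (model B P).maximalOp α := by
  refine LinearPMap.le_of_le_graph fun x hx => ?_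
  rw [auxOp_graph] at hx
  obtain ⟨h1, h2⟩ := hx
  obtain ⟨g, hg⟩ := (mem_sobolevSector_three_halves (B := B)).1 h1
  obtain ⟨v, hv⟩ := (charge B P).surjective x.2
  rw [ChargeModel.mem_maximalOp_graph]
  refine ⟨_, v, hg, hv.symm, ?_⟩
  rw [hg, ← hv] at h2
  exact isAuxValue_iff.1 h2

theorem mem_auxOp_domain (B : HarmonicFrame (l + 1)) {ξ : ChargeSpace P (l + 1)} :
    ξ ∈ (auxOp P α (l + 1)).domain ↔ ξ.toDist ∈ sobolevSector (3 / 2) (l + 1) := by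
  rw [LinearPMap.mem_domain_iff]
  simp only [auxOp_graph]
  refine ⟨fun ⟨_, h⟩ => h.1, fun h => ?_⟩
  obtain ⟨g, rfl⟩ := (mem_sobolevSector_three_halves (B := B)).1 h
  obtain ⟨v, hv, -⟩ := (model B P).mem_maximalOp_graph_of_regular α g
  refine ⟨charge B P v, h, isAuxValue_iff.2 ?_⟩
  change invWt B P ((model B P).W v) = _
  rw [hv, map_smul]
  exact congrArg _ ((model B P).shifted_D α g).symm

theorem hasForm_auxOp : (model B P).HasForm α (auxOp P α (l + 1)) :=
  (model B P).hasForm_of_le auxOp_le_maximalOp fun g =>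
    (mem_auxOp_domain B).2 (mem_sobolevSector_three_halves.2 ⟨g, rfl⟩)

theorem mem_maximalOp_domain {ξ : ChargeSpace P (l + 1)} :
    ξ ∈ ((model B P).maximalOp α).domain ↔ ξ.toDist ∈ sobolevSector (1 / 2) (l + 1) ∧
      ∃ τ, P.IsT ξ.toDist τ ∧ τ + (α : ℂ) • ξ.toDist ∈ sobolevSector (1 / 2) (l + 1) := by
  rw [LinearPMap.mem_domain_iff]
  simp only [ChargeModel.mem_maximalOp_graph]
  constructor
  · rintro ⟨-, u, v, hu, -, h⟩
    refine ⟨mem_sobolevSector_half.2 ⟨u, hu⟩, ?_⟩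
    obtain ⟨τ, h1, h2, -⟩ := isAuxValue_iff.2 h
    have hu' : ξ = charge B P (invWt B P u) := hu
    rw [hu']
    exact ⟨τ, h1, h2⟩
  · rintro ⟨h1, τ, h2, h3⟩
    obtain ⟨u, rfl⟩ := (mem_sobolevSector_half (B := B)).1 h1
    rw [isT_charge_iff.1 h2, toDist_shifted, shifted_mem_sobolevSector_half] at h3
    obtain ⟨w, hw⟩ := h3
    obtain ⟨v, hv⟩ := (model B P).W_bijective.2 ((2 : ℂ) • w)
    refine ⟨_, u, v, rfl, rfl, ?_⟩
    rw [hv, map_smul, hw]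
    rfl

theorem isAuxValue_maximalOp (ξ : ((model B P).maximalOp α).domain) :
    IsAuxValue P α (l + 1) ξ ((model B P).maximalOp α ξ) := by
  obtain ⟨u, v, hu, hv, h⟩ := (model B P).mem_maximalOp_graph.1
    (((model B P).maximalOp α).mem_graph ξ)
  simp only at hu hv
  rw [hu, hv]
  exact isAuxValue_iff.2 h

theorem range_charge_invWt : (Set.range fun u => (model B P).Θ ((model B P).D u)) =
    {ξ : ChargeSpace P (l + 1) | ξ.toDist ∈ sobolevSector (1 / 2) (l + 1)} := by
  ext ξ
  rw [Set.mem_ofPred_eq, mem_sobolevSector_half (B := B), Set.mem_range]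
  exact ⟨fun ⟨u, h⟩ => ⟨u, h.symm⟩, fun ⟨u, h⟩ => ⟨u, h.symm⟩⟩

theorem pairing_charge (u v : B.Space) :
    Integrable (fun p => conj (momentum (charge B P (invWt B P u)).toDist p) *
      momentum (charge B P v).toDist p) ∧
    sobolevPairing (charge B P (invWt B P u)).toDist (charge B P v).toDist = inner ℂ u v := by
  have h1 := integral_conj_fld_mul (P := P) (s := -(1 / 2)) u v
  rw [neg_neg] at h1
  have h2 : momentum (charge B P (invWt B P u)).toDist =ᵐ[volume] fld P (1 / 2) u := by
    rw [← sectorEquiv_half]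
    exact (hasMomentum_sectorEquiv u).momentum.ae_eq (hasMomentum_sectorEquiv u)
  have h3 : (fun p => conj (fld P (1 / 2) u p) * fld P (-(1 / 2)) v p) =ᵐ[volume]
      fun p => conj (momentum (charge B P (invWt B P u)).toDist p) *
        momentum (charge B P v).toDist p := by
    filter_upwards [h2, momentum_charge (P := P) v] with p h4 h5
    rw [h4, h5]
  exact ⟨h1.1.congr h3, by rw [← h1.2]; exact (integral_congr_ae h3).symm⟩

theorem re_inner_invWt_nonneg (u : B.Space) : 0 ≤ (inner ℂ u (invWt B P u)).re := by
  rw [L2.inner_def, integral_congr_ae (g := fun r => ((P.wt r ^ (-1 : ℝ) * ‖u r‖ ^ 2 : ℝ) : ℂ))]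
  · rw [integral_complex_ofReal, Complex.ofReal_re]
    refine integral_nonneg fun r => ?_
    have := Real.rpow_nonneg (P.wt_pos r).le (-1)
    positivity
  · filter_upwards [invWt_apply (P := P) u] with r hr
    rw [hr, inner_smul_right, inner_self_eq_norm_sq_to_K]
    push_cast
    rfl

/-- For `α < 0` the term `α` is dominated by `T_λ` once `λ` is large, because multiplication by
`1 / w` has norm at most `λ^{-1/2}`. -/
theorem exists_shifted_coercive (hm : mStar < P.mass)
    (hα : 0 ≤ α ∨ (α / (2 * Real.pi ^ 2 * (1 - efimov P.mass))) ^ 2 < P.lam) :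
    ∃ c : ℝ, 0 < c ∧ ∀ u : B.Space, c * ‖u‖ ^ 2 ≤ (inner ℂ u ((model B P).shifted α u)).re := by
  have hc : 0 < 2 * Real.pi ^ 2 * (1 - efimov P.mass) := by
    have := efimov_lt_one hm
    have : 0 < 1 - efimov P.mass := by linarith
    positivity
  set c₀ := 2 * Real.pi ^ 2 * (1 - efimov P.mass) with hc₀
  have h1 : ∀ u : B.Space, (inner ℂ u ((model B P).shifted α u)).re =
      (inner ℂ u (opT B P u)).re + α * (inner ℂ u (invWt B P u)).re := fun u => by
    have h2 : (model B P).shifted α u = opT B P u + (α : ℂ) • invWt B P u := rfl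
    rw [h2, inner_add_right, inner_smul_right, Complex.add_re, Complex.re_ofReal_mul]
  rcases hα with hα | hα
  · refine ⟨c₀, hc, fun u => ?_⟩
    rw [h1]
    have := opT_coercive (P := P) u
    have := mul_nonneg hα (re_inner_invWt_nonneg (P := P) u)
    linarith
  · have hl := Real.sqrt_pos.2 P.lam_pos
    have h3 : |α| < c₀ * √P.lam := by
      rw [← Real.sqrt_lt_sqrt_iff (sq_nonneg _), Real.sqrt_sq_eq_abs, abs_div, abs_of_pos hc,
        div_lt_iff₀ hc] at hα
      linarith
    refine ⟨c₀ - |α| * (√P.lam)⁻¹, ?_, fun u => ?_⟩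
    · rw [sub_pos, mul_inv_lt_iff₀ hl]
      exact h3
    · rw [h1]
      have h4 := opT_coercive (P := P) u
      have h5 : |(inner ℂ u (invWt B P u)).re| ≤ (√P.lam)⁻¹ * ‖u‖ ^ 2 :=
        calc _ ≤ ‖inner ℂ u (invWt B P u)‖ := Complex.abs_re_le_norm _
          _ ≤ ‖u‖ * ‖invWt B P u‖ := norm_inner_le_norm _ _
          _ ≤ ‖u‖ * ((√P.lam)⁻¹ * ‖u‖) := by
              gcongr
              exact ((invWt B P).le_opNorm u).trans (by gcongr; exact norm_invWt_le)
          _ = _ := by ring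
      have h6 : |α * (inner ℂ u (invWt B P u)).re| ≤ |α| * ((√P.lam)⁻¹ * ‖u‖ ^ 2) := by
        rw [abs_mul]
        gcongr
      have h7 := neg_abs_le (α * (inner ℂ u (invWt B P u)).re)
      rw [← hc₀] at h4
      linarith

end HarmonicFrame

end
end TMS

/-! ### The Friedrichs extension of the auxiliary operator -/

theorem mainTheorem4 (m α : ℝ) (hm : TMS.mStar < m) :
    (∃ lam₀ : ℝ, 0 ≤ lam₀ ∧ (0 ≤ α → lam₀ = 0) ∧
      ∀ P : TMS.Params, P.mass = m → lam₀ < P.lam → ∀ ℓ : ℕ, 1 ≤ ℓ →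
        TMS.HasPositiveBottom (TMS.auxOp P α ℓ)) ∧
    ∀ P : TMS.Params, P.mass = m → ∀ ℓ : ℕ, 1 ≤ ℓ →
      -- `H^{-1/2}_{W_λ,ℓ}` is a Hilbert space
      ∃ _ : CompleteSpace (TMS.ChargeSpace P ℓ),
      -- `W_λ` is a bijection from `H^{-1/2}_ℓ` onto `H^{1/2}_ℓ`
      (∀ ζ : TMS.ChargeSpace P ℓ, ∃ ω ∈ TMS.sobolevSector (1 / 2) ℓ, P.IsW ζ.toDist ω) ∧
      (∀ ω ∈ TMS.sobolevSector (1 / 2) ℓ, ∃! ζ : TMS.ChargeSpace P ℓ, P.IsW ζ.toDist ω) ∧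
      -- `𝒜_{λ,α}^{(ℓ)}` has domain `H^{3/2}_ℓ`, is densely defined and symmetric
      (∀ ξ : TMS.ChargeSpace P ℓ, ξ ∈ (TMS.auxOp P α ℓ).domain ↔
        ξ.toDist ∈ TMS.sobolevSector (3 / 2) ℓ) ∧
      Dense ((TMS.auxOp P α ℓ).domain : Set (TMS.ChargeSpace P ℓ)) ∧
      (TMS.auxOp P α ℓ).IsFormalAdjoint (TMS.auxOp P α ℓ) ∧
      (TMS.HasPositiveBottom (TMS.auxOp P α ℓ) →
        ∃ B : TMS.ChargeSpace P ℓ →ₗ.[ℂ] TMS.ChargeSpace P ℓ,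
          -- `B` is the Friedrichs extension
          TMS.IsFriedrichsExtension (TMS.auxOp P α ℓ) B ∧
          IsSelfAdjoint B ∧ TMS.auxOp P α ℓ ≤ B ∧
          -- its domain and its action
          (∀ ξ : TMS.ChargeSpace P ℓ, ξ ∈ B.domain ↔
            ξ.toDist ∈ TMS.sobolevSector (1 / 2) ℓ ∧
            ∃ τ, P.IsT ξ.toDist τ ∧ τ + (α : ℂ) • ξ.toDist ∈ TMS.sobolevSector (1 / 2) ℓ) ∧
          (∀ ξ : B.domain, TMS.IsAuxValue P α ℓ ξ (B ξ)) ∧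
          (∀ ξ : TMS.ChargeSpace P ℓ, ξ.toDist ∈ TMS.sobolevSector (3 / 2) ℓ → ξ ∈ B.domain) ∧
          -- its quadratic form
          TMS.formDomain (TMS.auxOp P α ℓ) = {ξ | ξ.toDist ∈ TMS.sobolevSector (1 / 2) ℓ} ∧
          TMS.formDomain B = {ξ | ξ.toDist ∈ TMS.sobolevSector (1 / 2) ℓ} ∧
          ∀ ξ₁ ξ₂ : TMS.ChargeSpace P ℓ,
            ξ₁.toDist ∈ TMS.sobolevSector (1 / 2) ℓ → ξ₂.toDist ∈ TMS.sobolevSector (1 / 2) ℓ →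
            ∃ τ ∈ TMS.sobolevSector (-(1 / 2)) ℓ, P.IsT ξ₂.toDist τ ∧
              MeasureTheory.Integrable (fun p =>
                conj (TMS.momentum ξ₁.toDist p) *
                  TMS.momentum (τ + (α : ℂ) • ξ₂.toDist) p) MeasureTheory.volume ∧
              TMS.IsFormValue (TMS.auxOp P α ℓ) ξ₁ ξ₂
                (2 * TMS.sobolevPairing ξ₁.toDist (τ + (α : ℂ) • ξ₂.toDist)) ∧
              TMS.IsFormValue B ξ₁ ξ₂
                (2 * TMS.sobolevPairing ξ₁.toDist (τ + (α : ℂ) • ξ₂.toDist))) := by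
  constructor
  · -- for `α < 0` this is the `λ` at which `|α| λ^{-1/2}` equals the coercivity constant of `T_λ`
    refine ⟨if 0 ≤ α then 0 else (α / (2 * Real.pi ^ 2 * (1 - TMS.efimov m))) ^ 2, ?_, ?_, ?_⟩
    · split_ifs <;> positivity
    · intro h
      rw [if_pos h]
    · intro P hP hlam ℓ hℓ
      obtain ⟨l, rfl⟩ := Nat.exists_eq_succ_of_ne_zero (Nat.one_le_iff_ne_zero.1 hℓ)
      obtain ⟨F⟩ := TMS.nonempty_harmonicFrame (l + 1)
      subst hP
      obtain ⟨c, hc, hM⟩ := TMS.HarmonicFrame.exists_shifted_coercive (B := F) (α := α) hm (by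
        by_cases h : 0 ≤ α
        · exact Or.inl h
        · rw [if_neg h] at hlam
          exact Or.inr hlam)
      exact TMS.ChargeModel.hasPositiveBottom (TMS.HarmonicFrame.hasForm_auxOp (B := F)) hc hM
  · intro P hP ℓ hℓ
    obtain ⟨l, rfl⟩ := Nat.exists_eq_succ_of_ne_zero (Nat.one_le_iff_ne_zero.1 hℓ)
    obtain ⟨F⟩ := TMS.nonempty_harmonicFrame (l + 1)
    subst hP
    set X := TMS.HarmonicFrame.model F P with hX
    have hA : X.HasForm α (TMS.auxOp P α (l + 1)) := TMS.HarmonicFrame.hasForm_auxOp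
    have hcomplete : CompleteSpace (TMS.ChargeSpace P (l + 1)) := X.completeSpace
    refine ⟨hcomplete, fun ζ => ?_, fun ω hω => ?_, fun ξ => TMS.HarmonicFrame.mem_auxOp_domain F,
      hA.dense, hA.isFormalAdjoint, fun hpos => ?_⟩
    · -- `W_λ` takes values in `H^{1/2}`
      obtain ⟨u, rfl⟩ := (TMS.HarmonicFrame.charge F P).surjective ζ
      exact ⟨_, TMS.HarmonicFrame.mem_sobolevSector_half.2 ⟨_, rfl⟩,
        TMS.HarmonicFrame.isW_charge_iff.2 rfl⟩
    · -- each element of `H^{1/2}` is attained exactly once, by the Lax–Milgram theorem for `opW`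
      obtain ⟨w, hw⟩ := (TMS.HarmonicFrame.sectorEquiv F P (1 / 2)).surjective ⟨ω, hω⟩
      have hw' : ω = (TMS.HarmonicFrame.charge F P (TMS.HarmonicFrame.invWt F P w)).toDist := by
        rw [← TMS.HarmonicFrame.sectorEquiv_half, hw]
      obtain ⟨u, hu⟩ := X.W_bijective.2 w
      refine ⟨TMS.HarmonicFrame.charge F P u, ?_, fun ζ hζ => ?_⟩
      · refine TMS.HarmonicFrame.isW_charge_iff.2 ?_
        rw [hw', ← hu]
        rfl
      · obtain ⟨v, rfl⟩ := (TMS.HarmonicFrame.charge F P).surjective ζ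
        have h := TMS.HarmonicFrame.isW_charge_iff.1 hζ
        rw [hw', TMS.ChargeSpace.toDist_injective.eq_iff,
          (TMS.HarmonicFrame.charge F P).injective.eq_iff,
          TMS.HarmonicFrame.invWt_injective.eq_iff, ← hu] at h
        rw [X.W_bijective.1 h]
    · have hc₀ : 0 < 2 * Real.pi ^ 2 * (1 - TMS.efimov P.mass) := by
        have := TMS.efimov_lt_one hm
        have : 0 < 1 - TMS.efimov P.mass := by linarith
        positivity
      obtain ⟨c, hc, hM⟩ := X.shifted_coercive hA hc₀
        TMS.HarmonicFrame.opT_coercive hpos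
      have hB := X.hasForm_maximalOp α
      have hdom := fun ξ =>
        TMS.HarmonicFrame.mem_maximalOp_domain (B := F) (P := P) (α := α) (ξ := ξ)
      have hle : TMS.auxOp P α (l + 1) ≤ X.maximalOp α := TMS.HarmonicFrame.auxOp_le_maximalOp
      refine ⟨X.maximalOp α, X.isFriedrichsExtension_maximalOp hA hc hM,
        X.isSelfAdjoint_maximalOp hc hM, hle, hdom, TMS.HarmonicFrame.isAuxValue_maximalOp,
        fun ξ hξ => hle.1 ((TMS.HarmonicFrame.mem_auxOp_domain F).2 hξ), ?_, ?_, ?_⟩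
      · rw [hA.formDomain_eq hc hM]
        exact TMS.HarmonicFrame.range_charge_invWt
      · rw [hB.formDomain_eq hc hM]
        exact TMS.HarmonicFrame.range_charge_invWt
      · intro ξ₁ ξ₂ h₁ h₂
        obtain ⟨u, rfl⟩ := (TMS.HarmonicFrame.mem_sobolevSector_half (B := F)).1 h₁
        obtain ⟨v, rfl⟩ := (TMS.HarmonicFrame.mem_sobolevSector_half (B := F)).1 h₂
        refine ⟨_, (TMS.HarmonicFrame.charge F P (TMS.HarmonicFrame.opT F P v)).toDist_mem,
          TMS.HarmonicFrame.isT_charge_iff.2 rfl, ?_⟩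
        rw [TMS.HarmonicFrame.toDist_shifted]
        obtain ⟨h3, h4⟩ := TMS.HarmonicFrame.pairing_charge (P := P) u (X.shifted α v)
        rw [h4]
        exact ⟨h3, hA.isFormValue hc hM u v, hB.isFormValue hc hM u v⟩
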